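/- **Theorem 1.2.** Let $G$ be a Carnot group, i.e. a connected, simply connected (real, smooth) Lie group whose Lie algebra $\mathfrak g$ of left-invariant vector fields has a stratification $\mathfrak g=\mathfrak g_1\oplus\dots\oplus\mathfrak g_s$, $s\ge 1$: $[\mathfrak g_1,\mathfrak g_i]=\mathfrak g_{i+1}$ for $1\le i\le s$, where $\mathfrak g_s\neq\{0\}$ and $\mathfrak g_i=\{0\}$ for $i>s$ (and $[\mathfrak g_1,\mathfrak g_i]$ is the linear span of the brackets). Let $\mu$ be a Haar measure on $G$, let $\langle\cdot,\cdot\rangle$ be any scalar product on $\mathfrak g_1$, and let $\mathbf X$ be the collection of orthonormal bases of $(\mathfrak g_1,\langle\cdot,\cdot\rangle)$. Then every monotone subset of $G$ is a local minimizer for the $\mathbf X$-perimeter. Here the following definitions are used. * A *line* is the unparameterized oriented image $\{x\cdot\exp(tX):t\in\mathbb R\}$, oriented by $X$, of an integral curve of some $X\in\mathfrak g_1\setminus\{0\}$. The set of lines carries the smooth structure for which the map $(X,x)\mapsto$ (line through $x$ in the direction $X$) from $(\mathfrak g_1\setminus\{0\})\times G$ is a submersion, and almost every line is meant with respect to the induced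 null sets; that is, a set of lines is null if and only if the set of the pairs $(X,x)$ that represent its members is null for the product of Lebesgue measure on $\mathfrak g_1$ and $\mu$. * A set $E\subset G$ is *monotone* if it is $\mu$-measurable and for almost every line, parameterized as $t\mapsto x\cdot\exp(tX)$, the function $t\mapsto \mathbf 1_E(x\cdot\exp(tX))$ agrees a.e. on $\mathbb R$ with a monotone (nondecreasing or nonincreasing) function. * A set $E\subset G$ has *locally finite perimeter* if it is $\mu$-measurable and for every $X\in\mathfrak g_1$ the distribution $\varphi\mapsto-\int_E X\varphi\,d\mu$, $\varphi\in C_c^\infty(G)$, is a (signed) Radon measure, i.e. a difference of two nonnegative Radon measures. * For $\mu$-measurable $E$ and open $\Omega\subset G$, the *$\mathbf X$-perimeter* is $$\operatorname{Per}_{\mathbf X}(E,\Omega)=\sup\Big\{\int_E\sum_{i=1}^r X_i\varphi_i\,d\mu:\ \varphi=(\varphi_1,\dots,\varphi_r)\in C^1_c(\Omega,\mathbb R^r),\ \|\varphi\|_\infty\le1\Big\}\in[0,+\infty]$$ for some, equivalently any, $(X_1,\dots,X_r)\in\mathbf X$, where $\|\varphi\|_\infty$ is the supremum of the Euclidean norm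 of $\varphi$. * $E$ is a *local minimizer for the $\mathbf X$-perimeter* if it has locally finite perimeter and, for every relatively compact open set $\Omega\subset G$ and every $\mu$-measurable $F\subset G$ such that the closure of $E\,\triangle\,F$ is compact and contained in $\Omega$, one has $\operatorname{Per}_{\mathbf X}(E,\Omega)\le\operatorname{Per}_{\mathbf X}(F,\Omega)$. -/

import Mathlib

open MeasureTheory Set Topology
open scoped Manifold ContDiff ENNReal

noncomputable section

namespace Carnot

/-- A stratification of a real Lie algebra `𝔤`: linear subspaces `𝔤₁, …, 𝔤ₛ` (`s ≥ 1`) with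
`𝔤 = 𝔤₁ ⊕ ⋯ ⊕ 𝔤ₛ`, `[𝔤₁, 𝔤ᵢ] = 𝔤ᵢ₊₁` for `1 ≤ i ≤ s`, `𝔤ₛ ≠ 0` and `𝔤ᵢ = 0` for `i > s`,
where `[𝔤₁, 𝔤ᵢ]` is the linear span of all brackets. The value `layer 0` plays no role. -/
structure Stratification (𝔤 : Type*) [LieRing 𝔤] [LieAlgebra ℝ 𝔤] where
  /-- the step `s` -/
  step : ℕ
  /-- the layers `𝔤ᵢ` -/
  layer : ℕ → Submodule ℝ 𝔤
  one_le_step : 1 ≤ step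
  isInternal : DirectSum.IsInternal (fun i : Fin step => layer (i + 1))
  bracket_eq : ∀ i, 1 ≤ i → i ≤ step →
    Submodule.span ℝ {Z : 𝔤 | ∃ X ∈ layer 1, ∃ Y ∈ layer i, ⁅X, Y⁆ = Z} = layer (i + 1)
  layer_step_ne_bot : layer step ≠ ⊥
  layer_eq_bot : ∀ i, step < i → layer i = ⊥

section LieGroup

variable {E : Type*} [NormedAddCommGroup E] [NormedSpace ℝ E]
  {G : Type*} [TopologicalSpace G] [ChartedSpace E G] [Group G]

open Classical in
/-- The exponential map of a Lie group: `exp X = γ 1`, where `γ : ℝ → G` is the integral curve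
of the left-invariant vector field `X` with `γ 0 = 1` (it exists and is unique on a Lie group). -/
def lieExp (X : GroupLieAlgebra 𝓘(ℝ, E) G) : G :=
  if h : ∃ γ : ℝ → G, γ 0 = 1 ∧
      IsMIntegralCurve (I := 𝓘(ℝ, E)) γ (mulInvariantVectorField (I := 𝓘(ℝ, E)) (G := G) X)
  then h.choose 1 else 1

/-- The flow `Φ_X(x, t) = x · exp (tX)` of a left-invariant vector field. -/
def flow (X : GroupLieAlgebra 𝓘(ℝ, E) G) (x : G) (t : ℝ) : G := x * lieExp (t • X)

/-- The derivative `Xφ` of a real function along a left-invariant vector field. -/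
def lieDeriv (X : GroupLieAlgebra 𝓘(ℝ, E) G) (φ : G → ℝ) (x : G) : ℝ :=
  mfderiv 𝓘(ℝ, E) 𝓘(ℝ, ℝ) φ x (mulInvariantVectorField (I := 𝓘(ℝ, E)) (G := G) X x)

end LieGroup

/-- A smooth Lie group has the finite smoothness used to define its Lie algebra. -/
instance {E : Type*} [NormedAddCommGroup E] [NormedSpace ℝ E] {G : Type*} [TopologicalSpace G]
    [ChartedSpace E G] [Group G] [LieGroup 𝓘(ℝ, E) ∞ G] :
    LieGroup 𝓘(ℝ, E) (minSmoothness ℝ 3) G := by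
  rw [minSmoothness_of_isRCLikeNormedField]
  infer_instance

/-- The Lie algebra of a finite dimensional Lie group is finite dimensional. -/
instance {E : Type*} [NormedAddCommGroup E] [NormedSpace ℝ E] [FiniteDimensional ℝ E]
    {G : Type*} [TopologicalSpace G] [ChartedSpace E G] [Group G] :
    FiniteDimensional ℝ (GroupLieAlgebra 𝓘(ℝ, E) G) :=
  inferInstanceAs (FiniteDimensional ℝ E)

section Lines

variable {E : Type*} [NormedAddCommGroup E] [NormedSpace ℝ E] [FiniteDimensional ℝ E]
  {G : Type*} [TopologicalSpace G] [ChartedSpace E G] [Group G]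

/-- The line `L = (X, x)`, for `X ∈ V`, `X ≠ 0`, `x ∈ G`, as an unparameterized oriented image:
the set `Φ_X(x, ℝ)`, with the ray spanned by `X` as orientation. -/
def orientedImage (V : Submodule ℝ (GroupLieAlgebra 𝓘(ℝ, E) G)) (X : {X : V // X ≠ 0}) (x : G) :
    Set G × Module.Ray ℝ V :=
  (range (flow (X : V).1 x), rayOfNeZero ℝ (X : V) X.2)

/-- The collection of all lines in the directions of `V`. -/
def OrientedLine (V : Submodule ℝ (GroupLieAlgebra 𝓘(ℝ, E) G)) : Type _ :=
  {L : Set G × Module.Ray ℝ V // ∃ X x, orientedImage V X x = L}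

/-- The projection `(X, x) ↦ L = (X, x)` from `(V ∖ {0}) × G` onto the collection of lines. -/
def lineMk (V : Submodule ℝ (GroupLieAlgebra 𝓘(ℝ, E) G)) (X : {X : V // X ≠ 0}) (x : G) :
    OrientedLine V :=
  ⟨orientedImage V X x, X, x, rfl⟩

/-- Null sets of lines. The smooth structure of the collection of lines is the one for which the
projection `(X, x) ↦ (X, x)` from the manifold `(V ∖ {0}) × G` is a surjective submersion, so a
set of lines is null (for smooth measures with positive density) exactly when its preimage is
null. Null sets in `V × G` are those of (Lebesgue measure) `⊗` (Haar measure `μ`), the former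
taken in linear coordinates on `V` (null sets do not depend on the coordinates). -/
def IsNullSetOfLines [MeasurableSpace G] (μ : Measure G)
    (V : Submodule ℝ (GroupLieAlgebra 𝓘(ℝ, E) G)) (A : Set (OrientedLine V)) : Prop :=
  ((volume : Measure (Fin (Module.finrank ℝ V) → ℝ)).prod μ)
    {p | ∃ (X : {X : V // X ≠ 0}), (X : V) = ∑ i, p.1 i • Module.finBasis ℝ V i ∧
      lineMk V X p.2 ∈ A} = 0

/-- The line `L` is monotone for `S`: for every parameterization `Φ_X(x, ·)` of `L` as an integral
curve, the characteristic function of `S` along it agrees a.e. with a monotone (nondecreasing or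
nonincreasing) function. -/
def IsMonotoneLine (V : Submodule ℝ (GroupLieAlgebra 𝓘(ℝ, E) G)) (L : OrientedLine V)
    (S : Set G) : Prop :=
  ∀ (X : {X : V // X ≠ 0}) (x : G), lineMk V X x = L →
    ∃ f : ℝ → ℝ, (Monotone f ∨ Antitone f) ∧
      (fun t => S.indicator (1 : G → ℝ) (flow (X : V).1 x t)) =ᵐ[volume] f

/-- Monotone sets: `μ`-measurable sets for which almost every line is monotone. -/
def IsMonotoneSet [MeasurableSpace G] (μ : Measure G)
    (V : Submodule ℝ (GroupLieAlgebra 𝓘(ℝ, E) G)) (S : Set G) : Prop :=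
  NullMeasurableSet S μ ∧ IsNullSetOfLines μ V {L | ¬ IsMonotoneLine V L S}

end Lines

section Perimeter

variable {E : Type*} [NormedAddCommGroup E] [NormedSpace ℝ E]
  {G : Type*} [TopologicalSpace G] [ChartedSpace E G] [Group G] [MeasurableSpace G]

/-- The distribution `X 𝟙_S`, given by `φ ↦ - ∫_S Xφ dμ` for `φ ∈ C_c^∞(G)`, is a (signed) Radon
measure, i.e. a difference of two nonnegative Radon measures. -/
def IsRadonDerivative (μ : Measure G) (X : GroupLieAlgebra 𝓘(ℝ, E) G) (S : Set G) : Prop :=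
  ∃ ν₁ ν₂ : Measure G, ν₁.Regular ∧ ν₂.Regular ∧
    ∀ φ : G → ℝ, ContMDiff 𝓘(ℝ, E) 𝓘(ℝ, ℝ) ∞ φ → HasCompactSupport φ →
      -∫ x in S, lieDeriv X φ x ∂μ = ∫ x, φ x ∂ν₁ - ∫ x, φ x ∂ν₂

/-- Sets with locally finite perimeter, relative to the first layer `V`. -/
def HasLocallyFinitePerimeter (μ : Measure G) (V : Submodule ℝ (GroupLieAlgebra 𝓘(ℝ, E) G))
    (S : Set G) : Prop :=
  NullMeasurableSet S μ ∧ ∀ X ∈ V, IsRadonDerivative μ X S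

/-- The perimeter of `S` in `Ω` relative to `(X₁, …, X_r)`: the supremum in `[0, ∞]` of
`∫_S ∑ᵢ Xᵢ φᵢ dμ` over all `φ ∈ C_c^1(Ω, ℝ^r)` with `‖φ‖_∞ ≤ 1`, where `ℝ^r` carries the
Euclidean norm. -/
def perimeter (μ : Measure G) {r : ℕ} (X : Fin r → GroupLieAlgebra 𝓘(ℝ, E) G)
    (S Ω : Set G) : ℝ≥0∞ :=
  ⨆ φ : {φ : G → EuclideanSpace ℝ (Fin r) //
      ContMDiff 𝓘(ℝ, E) 𝓘(ℝ, EuclideanSpace ℝ (Fin r)) 1 φ ∧ HasCompactSupport φ ∧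
        tsupport φ ⊆ Ω ∧ ∀ x, ‖φ x‖ ≤ 1},
    ENNReal.ofReal (∫ x in S, ∑ i, lieDeriv (X i) (fun y => φ.1 y i) x ∂μ)

/-- `A ⊂⊂ B`: the set `A` is a relatively compact subset of `B`. -/
def IsRelativelyCompactIn (A B : Set G) : Prop :=
  IsCompact (closure A) ∧ closure A ⊆ B

/-- Local minimizers for the perimeter relative to a basis `(X₁, …, X_r)` of the first layer. -/
def IsLocalMinimizer (μ : Measure G) (V : Submodule ℝ (GroupLieAlgebra 𝓘(ℝ, E) G))
    {r : ℕ} (X : Module.Basis (Fin r) ℝ V) (S : Set G) : Prop :=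
  HasLocallyFinitePerimeter μ V S ∧
    ∀ Ω : Set G, IsOpen Ω → IsRelativelyCompactIn Ω univ →
      ∀ F : Set G, NullMeasurableSet F μ → IsRelativelyCompactIn (symmDiff S F) Ω →
        perimeter μ (fun i => (X i : GroupLieAlgebra 𝓘(ℝ, E) G)) S Ω ≤
          perimeter μ (fun i => (X i : GroupLieAlgebra 𝓘(ℝ, E) G)) F Ω

end Perimeter

/-- Scalar products on a real vector space. -/
structure IsScalarProduct {V : Type*} [AddCommGroup V] [Module ℝ V]
    (B : LinearMap.BilinForm ℝ V) : Prop where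
  symm : ∀ X Y, B X Y = B Y X
  pos : ∀ X, X ≠ 0 → 0 < B X X

/-- The basis `X` is orthonormal for the scalar product `B`. -/
def IsOrthonormalBasis {V : Type*} [AddCommGroup V] [Module ℝ V] (B : LinearMap.BilinForm ℝ V)
    {r : ℕ} (X : Module.Basis (Fin r) ℝ V) : Prop :=
  ∀ i j, B (X i) (X j) = if i = j then 1 else 0

end Carnot

end

/-! The proof is a calibration argument. It is carried out on difference quotients rather than
derivatives, and a finite frame then passes from single directions to the Euclidean norm.

Fix a direction `Y` in the first layer along which almost every line is monotone, and put `g = exp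
(tY)` with `t > 0`. Almost every orbit `x * g ^ n` meets `S` in an initial or a final segment, so
`|𝟙_S(x g⁻¹) - 𝟙_S(x)|` is the difference itself times a sign `s` that is constant on orbits.
Summation by parts turns `∫ |𝟙_S(x g⁻¹) - 𝟙_S(x)| η` into the integral over `S` of the `g`-increment
of `s η`. If `η` does not change from `x` to `x g` on `S ∆ F`, then `S` may be replaced by `F`
there, and undoing the summation bounds the result by the variation of `F`
(`IsMonotoneAlong.integral_abs_translateDiff_le`).

The same formula bounds the variation of `S` by `∫ |η(xg) - η(x)|`, which is `O(t)`. The difference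
quotients of `𝟙_S` are therefore locally bounded in `L¹`, and a vague limit of them is the signed
Radon measure `Y 𝟙_S` (`IsMonotoneDirection.hasRadonDerivative`). The directions with this property
form a subspace and contain a dense set, so they are all of the first layer.

Summation by parts needs the Haar measure to be invariant under right translation by `g`.
Conjugation by `h` enlarges small balls by a factor of at most `‖Ad h‖ + 1`, and `μ` is doubling, so
the modular function grows at most polynomially in `‖Ad h‖`. Since `ad Y` is nilpotent, `Ad (exp
tY)` grows polynomially in `t`, while the modular function is multiplicative along the one-parameter
group. It is therefore trivial there (`map_mul_lieExp_eq`).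

Finally, `exists_frame_of_dense` finds finitely many good directions `e j` for which `∑ |⟨e j, ν⟩|`
lies within a factor `1 ± ε` of `‖ν‖`. The upper bound says that fields `∑ σ j • e j` with `|σ j| ≤
1` have norm at most `1 + ε`, so the directional variations of `F` add up to at most `(1 + ε) Per
F`. The lower bound says, by duality, that every field `φ` with `‖φ‖ ≤ 1` satisfies `(1 - ε) φ ≈ ∑ ψ
j (φ) • e j` with `|ψ j| ≤ 1` (`exists_contDiff_coeff_of_frame`), so the divergence of `φ` on `S` is
controlled by directional variations of `S`. The uniformly small remainder is paired with the Radon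
measures `X i 𝟙_S`, and `ε → 0` concludes. -/

noncomputable section

namespace Carnot

set_option linter.unusedSectionVars false

/-! ### One-parameter subgroups and the exponential map -/

section ExponentialMap

variable {E : Type*} [NormedAddCommGroup E] [NormedSpace ℝ E] [FiniteDimensional ℝ E]
  {G : Type*} [TopologicalSpace G] [ChartedSpace E G] [Group G] [LieGroup 𝓘(ℝ, E) ∞ G]

theorem mdifferentiableAt_mul_left (g h : G) :
    MDifferentiableAt 𝓘(ℝ, E) 𝓘(ℝ, E) (fun x : G => g * x) h :=
  (contMDiff_mul_left (I := 𝓘(ℝ, E)) (n := ∞)).contMDiffAt.mdifferentiableAt (by simp)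

theorem mdifferentiableAt_mul_right (g h : G) :
    MDifferentiableAt 𝓘(ℝ, E) 𝓘(ℝ, E) (fun x : G => x * g) h :=
  (contMDiff_mul_right (I := 𝓘(ℝ, E)) (n := ∞)).contMDiffAt.mdifferentiableAt (by simp)

theorem mfderiv_mul_left_mulInvariantVectorField (X : GroupLieAlgebra 𝓘(ℝ, E) G) (g h : G) :
    mfderiv 𝓘(ℝ, E) 𝓘(ℝ, E) (fun x : G => g * x) h
      (mulInvariantVectorField (I := 𝓘(ℝ, E)) X h) =
    mulInvariantVectorField (I := 𝓘(ℝ, E)) X (g * h) := by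
  have hD : (fun x : G => g * h * x) = (fun x => g * x) ∘ (fun x => h * x) := by
    ext x; simp [mul_assoc]
  simp only [mulInvariantVectorField]
  rw [hD]
  exact (mfderiv_comp_apply_of_eq (I' := 𝓘(ℝ, E)) _ (mdifferentiableAt_mul_left _ _)
    (mdifferentiableAt_mul_left _ _) (mul_one h) X).symm

theorem contMDiff_one_mulInvariantVectorField (X : GroupLieAlgebra 𝓘(ℝ, E) G) :
    ContMDiff 𝓘(ℝ, E) 𝓘(ℝ, E).tangent 1
      (fun g : G => (⟨g, mulInvariantVectorField (I := 𝓘(ℝ, E)) X g⟩ :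
        TangentBundle 𝓘(ℝ, E) G)) :=
  (contMDiff_mulInvariantVectorField X).of_le
    (by rw [minSmoothness_of_isRCLikeNormedField]; norm_num)

theorem isMIntegralCurveOn_mul_left {X : GroupLieAlgebra 𝓘(ℝ, E) G} {γ : ℝ → G} {s : Set ℝ}
    (hγ : IsMIntegralCurveOn (I := 𝓘(ℝ, E)) γ (mulInvariantVectorField (I := 𝓘(ℝ, E)) X) s)
    (g : G) : IsMIntegralCurveOn (I := 𝓘(ℝ, E)) (fun t => g * γ t)
      (mulInvariantVectorField (I := 𝓘(ℝ, E)) X) s := by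
  intro t ht
  have h := ((mdifferentiableAt_mul_left (E := E) g (γ t)).hasMFDerivAt).comp_hasMFDerivWithinAt
    t (hγ t ht)
  refine h.congr_mfderiv (ContinuousLinearMap.ext fun a : ℝ => ?_)
  exact (map_smul (mfderiv 𝓘(ℝ, E) 𝓘(ℝ, E) (fun x : G => g * x) (γ t)) a _).trans
    (congrArg (fun v : E => a • v) (mfderiv_mul_left_mulInvariantVectorField X g (γ t)))

theorem isMIntegralCurve_mul_left {X : GroupLieAlgebra 𝓘(ℝ, E) G} {γ : ℝ → G}
    (hγ : IsMIntegralCurve (I := 𝓘(ℝ, E)) γ (mulInvariantVectorField (I := 𝓘(ℝ, E)) X))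
    (g : G) : IsMIntegralCurve (I := 𝓘(ℝ, E)) (fun t => g * γ t)
      (mulInvariantVectorField (I := 𝓘(ℝ, E)) X) := by
  rw [isMIntegralCurve_iff_isMIntegralCurveOn] at hγ ⊢
  exact isMIntegralCurveOn_mul_left hγ g

variable [T2Space G]

/-- Left translation moves a local integral curve at `1` to one through any other point with the
same lifetime. A uniform lifetime forces completeness. -/
theorem exists_isMIntegralCurve_mulInvariantVectorField (X : GroupLieAlgebra 𝓘(ℝ, E) G) :
    ∃ γ : ℝ → G, γ 0 = 1 ∧
      IsMIntegralCurve (I := 𝓘(ℝ, E)) γ (mulInvariantVectorField (I := 𝓘(ℝ, E)) X) := by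
  obtain ⟨γ, h0, hγ⟩ := exists_isMIntegralCurveAt_of_contMDiffAt_boundaryless (t₀ := 0)
    ((contMDiff_one_mulInvariantVectorField X).contMDiffAt (x := (1 : G)))
  obtain ⟨ε, hε, h⟩ := isMIntegralCurveAt_iff'.1 hγ
  refine exists_isMIntegralCurve_of_isMIntegralCurveOn
    (contMDiff_one_mulInvariantVectorField X) hε (fun x => ⟨fun t => x * γ t, by simp [h0], ?_⟩) 1
  rw [Real.ball_eq_Ioo] at h
  simpa using isMIntegralCurveOn_mul_left h x

theorem isMIntegralCurve_eq {X : GroupLieAlgebra 𝓘(ℝ, E) G} {γ γ' : ℝ → G}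
    (hγ : IsMIntegralCurve (I := 𝓘(ℝ, E)) γ (mulInvariantVectorField (I := 𝓘(ℝ, E)) X))
    (hγ' : IsMIntegralCurve (I := 𝓘(ℝ, E)) γ' (mulInvariantVectorField (I := 𝓘(ℝ, E)) X))
    (h : γ 0 = γ' 0) : γ = γ' :=
  isMIntegralCurve_Ioo_eq_of_contMDiff_boundaryless (t₀ := 0)
    (contMDiff_one_mulInvariantVectorField X) hγ hγ' h

theorem lieExp_eq {X : GroupLieAlgebra 𝓘(ℝ, E) G} {γ : ℝ → G} (h0 : γ 0 = 1)
    (hγ : IsMIntegralCurve (I := 𝓘(ℝ, E)) γ (mulInvariantVectorField (I := 𝓘(ℝ, E)) X)) :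
    lieExp X = γ 1 := by
  have h := exists_isMIntegralCurve_mulInvariantVectorField X
  rw [lieExp, dif_pos h, isMIntegralCurve_eq h.choose_spec.2 hγ (h.choose_spec.1.trans h0.symm)]

theorem lieExp_smul_eq {X : GroupLieAlgebra 𝓘(ℝ, E) G} {γ : ℝ → G} (h0 : γ 0 = 1)
    (hγ : IsMIntegralCurve (I := 𝓘(ℝ, E)) γ (mulInvariantVectorField (I := 𝓘(ℝ, E)) X)) (t : ℝ) :
    lieExp (t • X) = γ t := by
  have h := hγ.comp_mul t
  rw [← mulInvariantVectorField_smul] at h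
  rw [lieExp_eq (by simpa using h0) h]
  simp

theorem isMIntegralCurve_lieExp (X : GroupLieAlgebra 𝓘(ℝ, E) G) :
    IsMIntegralCurve (I := 𝓘(ℝ, E)) (fun t => lieExp (t • X))
      (mulInvariantVectorField (I := 𝓘(ℝ, E)) X) := by
  obtain ⟨γ, h0, hγ⟩ := exists_isMIntegralCurve_mulInvariantVectorField X
  rwa [show (fun t : ℝ => lieExp (t • X)) = γ from funext (lieExp_smul_eq h0 hγ)]

theorem lieExp_zero_smul (X : GroupLieAlgebra 𝓘(ℝ, E) G) : lieExp ((0 : ℝ) • X) = 1 := by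
  obtain ⟨γ, h0, hγ⟩ := exists_isMIntegralCurve_mulInvariantVectorField X
  rw [lieExp_smul_eq h0 hγ, h0]

theorem lieExp_add_smul (X : GroupLieAlgebra 𝓘(ℝ, E) G) (s t : ℝ) :
    lieExp ((s + t) • X) = lieExp (s • X) * lieExp (t • X) := by
  have h1 := (isMIntegralCurve_lieExp X).comp_add s
  have h2 := isMIntegralCurve_mul_left (isMIntegralCurve_lieExp X) (lieExp (s • X))
  have h := congrFun (isMIntegralCurve_eq h1 h2 (by
    have := lieExp_zero_smul X
    simp_all)) t
  simpa [add_comm] using h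

theorem lieExp_neg_smul (X : GroupLieAlgebra 𝓘(ℝ, E) G) (t : ℝ) :
    lieExp ((-t) • X) = (lieExp (t • X))⁻¹ := by
  rw [eq_inv_iff_mul_eq_one, ← lieExp_add_smul, neg_add_cancel, lieExp_zero_smul]

theorem lieExp_mul_intCast_smul (X : GroupLieAlgebra 𝓘(ℝ, E) G) (t : ℝ) (k : ℤ) :
    lieExp ((k * t) • X) = lieExp (t • X) ^ k := by
  induction k using Int.induction_on with
  | zero => simpa using lieExp_zero_smul X
  | succ k ih => push_cast at ih ⊢; rw [add_mul, lieExp_add_smul, ih, zpow_add_one, one_mul]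
  | pred k ih =>
    push_cast at ih ⊢
    rw [sub_mul, sub_eq_add_neg, lieExp_add_smul, ih, one_mul, lieExp_neg_smul, zpow_sub_one]

theorem continuous_lieExp_smul (X : GroupLieAlgebra 𝓘(ℝ, E) G) :
    Continuous fun t : ℝ => lieExp (t • X) :=
  (isMIntegralCurve_lieExp X).continuous

theorem hasMFDerivAt_mul_lieExp (X : GroupLieAlgebra 𝓘(ℝ, E) G) (x : G) (t : ℝ) :
    HasMFDerivAt 𝓘(ℝ, ℝ) 𝓘(ℝ, E) (fun t : ℝ => x * lieExp (t • X)) t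
      (ContinuousLinearMap.smulRight (1 : ℝ →L[ℝ] ℝ)
        (mulInvariantVectorField (I := 𝓘(ℝ, E)) X (x * lieExp (t • X)))) :=
  isMIntegralCurve_mul_left (isMIntegralCurve_lieExp X) x t

theorem hasDerivAt_comp_mul_lieExp {X : GroupLieAlgebra 𝓘(ℝ, E) G} {φ : G → ℝ} {x : G} {t : ℝ}
    (hφ : MDifferentiableAt 𝓘(ℝ, E) 𝓘(ℝ, ℝ) φ (x * lieExp (t • X))) :
    HasDerivAt (fun t : ℝ => φ (x * lieExp (t • X))) (lieDeriv X φ (x * lieExp (t • X))) t := by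
  have h := hφ.hasMFDerivAt.comp t (hasMFDerivAt_mul_lieExp X x t)
  refine hasDerivAt_iff_hasFDerivAt.2 (hasMFDerivAt_iff_hasFDerivAt.1 (h.congr_mfderiv ?_))
  refine ContinuousLinearMap.ext fun a : ℝ => ?_
  exact map_smul (mfderiv 𝓘(ℝ, E) 𝓘(ℝ, ℝ) φ (x * lieExp (t • X))) a _

end ExponentialMap

/-! ### Derivatives along left-invariant fields -/

section LieDerivative

variable {E : Type*} [NormedAddCommGroup E] [NormedSpace ℝ E]
  {G : Type*} [TopologicalSpace G] [ChartedSpace E G] [Group G]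

theorem lieDeriv_add_left (X Y : GroupLieAlgebra 𝓘(ℝ, E) G) (φ : G → ℝ) (x : G) :
    lieDeriv (X + Y) φ x = lieDeriv X φ x + lieDeriv Y φ x := by
  simp only [lieDeriv, mulInvariantVectorField_add]
  exact map_add _ _ _

theorem lieDeriv_smul_left (c : ℝ) (X : GroupLieAlgebra 𝓘(ℝ, E) G) (φ : G → ℝ) (x : G) :
    lieDeriv (c • X) φ x = c * lieDeriv X φ x := by
  simp only [lieDeriv, mulInvariantVectorField_smul]
  exact map_smul _ c _

theorem lieDeriv_sum_left {ι : Type*} (s : Finset ι) (c : ι → ℝ)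
    (X : ι → GroupLieAlgebra 𝓘(ℝ, E) G) (φ : G → ℝ) (x : G) :
    lieDeriv (∑ i ∈ s, c i • X i) φ x = ∑ i ∈ s, c i * lieDeriv (X i) φ x := by
  classical
  induction s using Finset.induction_on with
  | empty =>
    simp only [Finset.sum_empty]
    simpa using lieDeriv_smul_left 0 (0 : GroupLieAlgebra 𝓘(ℝ, E) G) φ x
  | insert a s ha ih =>
    rw [Finset.sum_insert ha, Finset.sum_insert ha, lieDeriv_add_left, lieDeriv_smul_left, ih]

theorem lieDeriv_eq_zero_of_notMem_tsupport {X : GroupLieAlgebra 𝓘(ℝ, E) G} {φ : G → ℝ} {x : G}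
    (hx : x ∉ tsupport φ) : lieDeriv X φ x = 0 := by
  have h : φ =ᶠ[𝓝 x] fun _ => 0 := notMem_tsupport_iff_eventuallyEq.1 hx
  rw [lieDeriv, h.mfderiv_eq, mfderiv_const]
  rfl

end LieDerivative

section LieDerivativeSmooth

variable {E : Type*} [NormedAddCommGroup E] [NormedSpace ℝ E] [FiniteDimensional ℝ E]
  {G : Type*} [TopologicalSpace G] [ChartedSpace E G] [Group G] [LieGroup 𝓘(ℝ, E) ∞ G]
  [T2Space G]

theorem lieDeriv_eq_of_hasDerivAt {X : GroupLieAlgebra 𝓘(ℝ, E) G} {φ : G → ℝ} {x : G} {c : ℝ}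
    (hφ : MDifferentiableAt 𝓘(ℝ, E) 𝓘(ℝ, ℝ) φ x)
    (h : HasDerivAt (fun t : ℝ => φ (x * lieExp (t • X))) c 0) : lieDeriv X φ x = c := by
  have h1 : x * lieExp ((0 : ℝ) • X) = x := by rw [lieExp_zero_smul, mul_one]
  have h2 := hasDerivAt_comp_mul_lieExp (X := X) (x := x) (t := 0) (by rwa [h1])
  rw [h1] at h2
  exact h2.unique h

theorem hasDerivAt_zero_comp_mul_lieExp {X : GroupLieAlgebra 𝓘(ℝ, E) G} {φ : G → ℝ} {x : G}
    (hφ : MDifferentiableAt 𝓘(ℝ, E) 𝓘(ℝ, ℝ) φ x) :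
    HasDerivAt (fun t : ℝ => φ (x * lieExp (t • X))) (lieDeriv X φ x) 0 := by
  have h1 : x * lieExp ((0 : ℝ) • X) = x := by rw [lieExp_zero_smul, mul_one]
  have h2 := hasDerivAt_comp_mul_lieExp (X := X) (x := x) (t := 0) (by rwa [h1])
  rwa [h1] at h2

theorem lieDeriv_linearCombination {ι : Type*} (s : Finset ι) (c : ι → ℝ) {φ : ι → G → ℝ}
    (hφ : ∀ i, ContMDiff 𝓘(ℝ, E) 𝓘(ℝ, ℝ) 1 (φ i)) (X : GroupLieAlgebra 𝓘(ℝ, E) G) (x : G) :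
    lieDeriv X (fun y => ∑ i ∈ s, c i * φ i y) x = ∑ i ∈ s, c i * lieDeriv X (φ i) x := by
  have hd : ∀ i, MDifferentiableAt 𝓘(ℝ, E) 𝓘(ℝ, ℝ) (φ i) x :=
    fun i => (hφ i).contMDiffAt.mdifferentiableAt (by simp)
  refine lieDeriv_eq_of_hasDerivAt ?_ ?_
  · refine ContMDiffAt.mdifferentiableAt (n := 1) ?_ (by simp)
    exact contMDiffAt_finsetSum fun i _ => contMDiffAt_const.mul (hφ i).contMDiffAt
  · exact HasDerivAt.fun_sum fun i _ => (hasDerivAt_zero_comp_mul_lieExp (hd i)).const_mul (c i)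

/-- Right translations do not commute with left-invariant fields in general. This one does because
it is the flow of `X` itself. -/
theorem lieDeriv_comp_mul_lieExp (X : GroupLieAlgebra 𝓘(ℝ, E) G) {φ : G → ℝ}
    (hφ : ContMDiff 𝓘(ℝ, E) 𝓘(ℝ, ℝ) 1 φ) (x : G) (s : ℝ) :
    lieDeriv X (fun y => φ (y * lieExp (s • X))) x = lieDeriv X φ (x * lieExp (s • X)) := by
  have hd : ∀ y, MDifferentiableAt 𝓘(ℝ, E) 𝓘(ℝ, ℝ) φ y :=
    fun y => hφ.contMDiffAt.mdifferentiableAt (by simp)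
  refine lieDeriv_eq_of_hasDerivAt ((hd _).comp x (mdifferentiableAt_mul_right _ _)) ?_
  have h := hasDerivAt_zero_comp_mul_lieExp (X := X) (hd (x * lieExp (s • X)))
  convert h using 3 with t
  rw [mul_assoc, mul_assoc, ← lieExp_add_smul, ← lieExp_add_smul, add_comm]

theorem continuous_lieDeriv (X : GroupLieAlgebra 𝓘(ℝ, E) G) {φ : G → ℝ}
    (hφ : ContMDiff 𝓘(ℝ, E) 𝓘(ℝ, ℝ) 1 φ) : Continuous (lieDeriv X φ) := by
  have h := (hφ.continuous_tangentMap le_rfl).comp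
    (contMDiff_one_mulInvariantVectorField X).continuous
  have h' := (tangentBundleModelSpaceHomeomorph 𝓘(ℝ, ℝ)).continuous.comp h
  exact continuous_snd.comp h'

end LieDerivativeSmooth

/-! ### The adjoint representation and its derivative along one-parameter subgroups -/

section Adjoint

variable {E : Type*} [NormedAddCommGroup E] [NormedSpace ℝ E] [FiniteDimensional ℝ E]
  {G : Type*} [TopologicalSpace G] [ChartedSpace E G] [Group G] [LieGroup 𝓘(ℝ, E) ∞ G]

variable (E) in
/-- The adjoint representation, in the coordinates of the tangent spaces. -/
def adjointMap (g : G) : E →L[ℝ] E :=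
  mfderiv 𝓘(ℝ, E) 𝓘(ℝ, E) (fun x : G => g * x * g⁻¹) 1

variable (E G) in
/-- The multiplication of a Lie group in the preferred chart at `1`. -/
def chartMul (p : E × E) : E :=
  extChartAt 𝓘(ℝ, E) (1 : G)
    ((extChartAt 𝓘(ℝ, E) (1 : G)).symm p.1 * (extChartAt 𝓘(ℝ, E) (1 : G)).symm p.2)

/-- The derivative at `1` of a left translation, in the preferred chart at `1`. -/
def leftChartDeriv (g : G) : E →L[ℝ] E :=
  mfderiv 𝓘(ℝ, E) 𝓘(ℝ, E) (fun y : G => extChartAt 𝓘(ℝ, E) (1 : G) (g * y)) 1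

/-- The derivative at `1` of a right translation, in the preferred chart at `1`. -/
def rightChartDeriv (g : G) : E →L[ℝ] E :=
  mfderiv 𝓘(ℝ, E) 𝓘(ℝ, E) (fun y : G => extChartAt 𝓘(ℝ, E) (1 : G) (y * g)) 1

theorem mdifferentiableAt_conj (g h : G) :
    MDifferentiableAt 𝓘(ℝ, E) 𝓘(ℝ, E) (fun x : G => g * x * g⁻¹) h :=
  (((contMDiff_mul_right (I := 𝓘(ℝ, E)) (n := ∞) (a := g⁻¹)).comp
    (contMDiff_mul_left (I := 𝓘(ℝ, E)) (n := ∞) (a := g))).contMDiffAt).mdifferentiableAt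
    (by simp)

theorem adjointMap_mul (g h : G) :
    adjointMap E (g * h) = (adjointMap E g).comp (adjointMap E h) := by
  have hD : (fun x : G => g * h * x * (g * h)⁻¹) =
      (fun x => g * x * g⁻¹) ∘ (fun x => h * x * h⁻¹) := by
    ext x; simp [mul_assoc]
  unfold adjointMap
  rw [hD]
  exact ContinuousLinearMap.ext fun v => mfderiv_comp_apply_of_eq (I' := 𝓘(ℝ, E)) (1 : G)
    (mdifferentiableAt_conj _ _) (mdifferentiableAt_conj _ _) (by simp) v

theorem contMDiffAt_chartSymm :
    ContMDiffAt 𝓘(ℝ, E) 𝓘(ℝ, E) ∞ (extChartAt 𝓘(ℝ, E) (1 : G)).symm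
      (extChartAt 𝓘(ℝ, E) (1 : G) 1) :=
  (contMDiffOn_extChartAt_symm (1 : G)).contMDiffAt (extChartAt_target_mem_nhds (1 : G))

theorem contDiffAt_chartMul : ContDiffAt ℝ ∞ (chartMul E G)
    (extChartAt 𝓘(ℝ, E) (1 : G) 1, extChartAt 𝓘(ℝ, E) (1 : G) 1) := by
  rw [← contMDiffAt_iff_contDiffAt]
  set a := extChartAt 𝓘(ℝ, E) (1 : G) 1 with ha
  have h0 : (extChartAt 𝓘(ℝ, E) (1 : G)).symm a = 1 := extChartAt_to_inv (1 : G)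
  have h1 : ContMDiffAt 𝓘(ℝ, E × E) 𝓘(ℝ, E) ∞
      (fun p : E × E => (extChartAt 𝓘(ℝ, E) (1 : G)).symm p.1) (a, a) :=
    ContMDiffAt.comp (a, a) (g := (extChartAt 𝓘(ℝ, E) (1 : G)).symm) (f := Prod.fst)
      contMDiffAt_chartSymm contDiff_fst.contMDiff.contMDiffAt
  have h2 : ContMDiffAt 𝓘(ℝ, E × E) 𝓘(ℝ, E) ∞
      (fun p : E × E => (extChartAt 𝓘(ℝ, E) (1 : G)).symm p.2) (a, a) :=
    ContMDiffAt.comp (a, a) (g := (extChartAt 𝓘(ℝ, E) (1 : G)).symm) (f := Prod.snd)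
      contMDiffAt_chartSymm contDiff_snd.contMDiff.contMDiffAt
  refine ContMDiffAt.comp_of_eq (g := extChartAt 𝓘(ℝ, E) (1 : G)) (y := 1)
    contMDiffAt_extChartAt (h1.mul h2) ?_
  simp only [h0, mul_one]

theorem hasMFDerivAt_extChartAt_one :
    HasMFDerivAt 𝓘(ℝ, E) 𝓘(ℝ, E) (extChartAt 𝓘(ℝ, E) (1 : G)) 1
      (ContinuousLinearMap.id ℝ E) := by
  have h := (mdifferentiableAt_extChartAt (I := 𝓘(ℝ, E)) (mem_chart_source E (1 : G))).hasMFDerivAt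
  rwa [mfderiv_extChartAt_self] at h

theorem hasMFDerivAt_prodMk_space {f g : G → E} {f' g' : E →L[ℝ] E} {x : G}
    (hf : HasMFDerivAt 𝓘(ℝ, E) 𝓘(ℝ, E) f x f') (hg : HasMFDerivAt 𝓘(ℝ, E) 𝓘(ℝ, E) g x g') :
    HasMFDerivAt 𝓘(ℝ, E) 𝓘(ℝ, E × E) (fun y => (f y, g y)) x (f'.prod g') := by
  rw [modelWithCornersSelf_prod, ← chartedSpaceSelf_prod]
  exact hf.prodMk hg

theorem leftChartDeriv_eq {g : G} (hg : g ∈ (extChartAt 𝓘(ℝ, E) (1 : G)).source)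
    (hd : DifferentiableAt ℝ (chartMul E G)
      (extChartAt 𝓘(ℝ, E) (1 : G) g, extChartAt 𝓘(ℝ, E) (1 : G) 1)) :
    leftChartDeriv g = (fderiv ℝ (chartMul E G)
      (extChartAt 𝓘(ℝ, E) (1 : G) g, extChartAt 𝓘(ℝ, E) (1 : G) 1)).comp
        (ContinuousLinearMap.inr ℝ E E) := by
  have h1 : HasMFDerivAt 𝓘(ℝ, E) 𝓘(ℝ, E × E)
      (fun y : G => (extChartAt 𝓘(ℝ, E) (1 : G) g, extChartAt 𝓘(ℝ, E) (1 : G) y)) 1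
      (ContinuousLinearMap.inr ℝ E E) :=
    hasMFDerivAt_prodMk_space (hasMFDerivAt_const _ _) hasMFDerivAt_extChartAt_one
  have h2 := HasMFDerivAt.comp (1 : G) hd.hasFDerivAt.hasMFDerivAt h1
  refine (HasMFDerivAt.congr_of_eventuallyEq h2 ?_).mfderiv
  filter_upwards [extChartAt_source_mem_nhds (I := 𝓘(ℝ, E)) (1 : G)] with y hy
  simp only [Function.comp_apply, chartMul]
  rw [(extChartAt 𝓘(ℝ, E) (1 : G)).left_inv hg, (extChartAt 𝓘(ℝ, E) (1 : G)).left_inv hy]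

theorem rightChartDeriv_eq {g : G} (hg : g ∈ (extChartAt 𝓘(ℝ, E) (1 : G)).source)
    (hd : DifferentiableAt ℝ (chartMul E G)
      (extChartAt 𝓘(ℝ, E) (1 : G) 1, extChartAt 𝓘(ℝ, E) (1 : G) g)) :
    rightChartDeriv g = (fderiv ℝ (chartMul E G)
      (extChartAt 𝓘(ℝ, E) (1 : G) 1, extChartAt 𝓘(ℝ, E) (1 : G) g)).comp
        (ContinuousLinearMap.inl ℝ E E) := by
  have h1 : HasMFDerivAt 𝓘(ℝ, E) 𝓘(ℝ, E × E)
      (fun y : G => (extChartAt 𝓘(ℝ, E) (1 : G) y, extChartAt 𝓘(ℝ, E) (1 : G) g)) 1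
      (ContinuousLinearMap.inl ℝ E E) :=
    hasMFDerivAt_prodMk_space hasMFDerivAt_extChartAt_one (hasMFDerivAt_const _ _)
  have h2 := HasMFDerivAt.comp (1 : G) hd.hasFDerivAt.hasMFDerivAt h1
  refine (HasMFDerivAt.congr_of_eventuallyEq h2 ?_).mfderiv
  filter_upwards [extChartAt_source_mem_nhds (I := 𝓘(ℝ, E)) (1 : G)] with y hy
  simp only [Function.comp_apply, chartMul]
  rw [(extChartAt 𝓘(ℝ, E) (1 : G)).left_inv hg, (extChartAt 𝓘(ℝ, E) (1 : G)).left_inv hy]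

theorem mdifferentiableAt_extChartAt_one {g : G}
    (hg : g ∈ (extChartAt 𝓘(ℝ, E) (1 : G)).source) :
    MDifferentiableAt 𝓘(ℝ, E) 𝓘(ℝ, E) (extChartAt 𝓘(ℝ, E) (1 : G)) g :=
  mdifferentiableAt_extChartAt (by rwa [extChartAt_source] at hg)

/-- Differentiate `g * y = (g * y * g⁻¹) * g` at `y = 1`. -/
theorem leftChartDeriv_eq_comp_adjointMap {g : G}
    (hg : g ∈ (extChartAt 𝓘(ℝ, E) (1 : G)).source) :
    leftChartDeriv (E := E) g = (rightChartDeriv g).comp (adjointMap E g) := by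
  have hD : (fun y : G => extChartAt 𝓘(ℝ, E) (1 : G) (g * y)) =
      (fun y : G => extChartAt 𝓘(ℝ, E) (1 : G) (y * g)) ∘ (fun x => g * x * g⁻¹) := by
    ext x; simp
  unfold leftChartDeriv
  rw [hD]
  refine ContinuousLinearMap.ext fun v => mfderiv_comp_apply_of_eq (I' := 𝓘(ℝ, E)) (y := (1 : G))
    (1 : G) ?_ (mdifferentiableAt_conj _ _) (by simp) v
  refine MDifferentiableAt.comp_of_eq (I' := 𝓘(ℝ, E)) (y := g) (1 : G)
    (mdifferentiableAt_extChartAt_one hg) (mdifferentiableAt_mul_right _ _) (by simp)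

theorem mfderiv_extChartAt_mulInvariantVectorField (X : GroupLieAlgebra 𝓘(ℝ, E) G) {g : G}
    (hg : g ∈ (extChartAt 𝓘(ℝ, E) (1 : G)).source) :
    mfderiv 𝓘(ℝ, E) 𝓘(ℝ, E) (extChartAt 𝓘(ℝ, E) (1 : G)) g
      (mulInvariantVectorField (I := 𝓘(ℝ, E)) X g) = leftChartDeriv (E := E) g X := by
  exact (mfderiv_comp_apply_of_eq (I' := 𝓘(ℝ, E)) (y := g) (1 : G)
    (mdifferentiableAt_extChartAt_one hg) (mdifferentiableAt_mul_left _ _) (mul_one g) X).symm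

/-- The left-invariant vector field in the preferred chart at `1`. -/
theorem mpullbackWithin_mulInvariantVectorField (X : GroupLieAlgebra 𝓘(ℝ, E) G) {z : E}
    (hz : z ∈ (extChartAt 𝓘(ℝ, E) (1 : G)).target) :
    VectorField.mpullbackWithin 𝓘(ℝ, E) 𝓘(ℝ, E) (extChartAt 𝓘(ℝ, E) (1 : G)).symm
      (mulInvariantVectorField (I := 𝓘(ℝ, E)) X) (range 𝓘(ℝ, E)) z =
    leftChartDeriv (E := E) ((extChartAt 𝓘(ℝ, E) (1 : G)).symm z) X := by
  rw [VectorField.mpullbackWithin_apply, ContinuousLinearMap.inverse_eq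
    (mfderivWithin_extChartAt_symm_comp_mfderiv_extChartAt hz)
    (mfderiv_extChartAt_comp_mfderivWithin_extChartAt_symm hz)]
  exact mfderiv_extChartAt_mulInvariantVectorField X
    ((extChartAt 𝓘(ℝ, E) (1 : G)).map_target hz)

theorem eventually_leftChartDeriv_eq :
    ∀ᶠ z in 𝓝 (extChartAt 𝓘(ℝ, E) (1 : G) 1),
      leftChartDeriv (E := E) ((extChartAt 𝓘(ℝ, E) (1 : G)).symm z) =
        (fderiv ℝ (chartMul E G) (z, extChartAt 𝓘(ℝ, E) (1 : G) 1)).comp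
          (ContinuousLinearMap.inr ℝ E E) := by
  set a := extChartAt 𝓘(ℝ, E) (1 : G) 1
  have h1 : ∀ᶠ p in 𝓝 (a, a), DifferentiableAt ℝ (chartMul E G) p :=
    ((contDiffAt_chartMul (E := E) (G := G)).of_le (m := 1) (by simp)).eventually (by simp)
      |>.mono fun p hp => hp.differentiableAt (by simp)
  have h2 : ∀ᶠ z in 𝓝 a, DifferentiableAt ℝ (chartMul E G) (z, a) :=
    (Continuous.tendsto (by fun_prop : Continuous fun z : E => (z, a)) a).eventually h1
  filter_upwards [h2, extChartAt_target_mem_nhds (I := 𝓘(ℝ, E)) (1 : G)] with z hz hzt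
  have hr := (extChartAt 𝓘(ℝ, E) (1 : G)).right_inv hzt
  have := leftChartDeriv_eq (E := E) (G := G) ((extChartAt 𝓘(ℝ, E) (1 : G)).map_target hzt)
    (by rwa [hr])
  rwa [hr] at this

theorem eventually_rightChartDeriv_eq :
    ∀ᶠ z in 𝓝 (extChartAt 𝓘(ℝ, E) (1 : G) 1),
      rightChartDeriv (E := E) ((extChartAt 𝓘(ℝ, E) (1 : G)).symm z) =
        (fderiv ℝ (chartMul E G) (extChartAt 𝓘(ℝ, E) (1 : G) 1, z)).comp
          (ContinuousLinearMap.inl ℝ E E) := by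
  set a := extChartAt 𝓘(ℝ, E) (1 : G) 1
  have h1 : ∀ᶠ p in 𝓝 (a, a), DifferentiableAt ℝ (chartMul E G) p :=
    ((contDiffAt_chartMul (E := E) (G := G)).of_le (m := 1) (by simp)).eventually (by simp)
      |>.mono fun p hp => hp.differentiableAt (by simp)
  have h2 : ∀ᶠ z in 𝓝 a, DifferentiableAt ℝ (chartMul E G) (a, z) :=
    (Continuous.tendsto (by fun_prop : Continuous fun z : E => (a, z)) a).eventually h1
  filter_upwards [h2, extChartAt_target_mem_nhds (I := 𝓘(ℝ, E)) (1 : G)] with z hz hzt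
  have hr := (extChartAt 𝓘(ℝ, E) (1 : G)).right_inv hzt
  have := rightChartDeriv_eq (E := E) (G := G) ((extChartAt 𝓘(ℝ, E) (1 : G)).map_target hzt)
    (by rwa [hr])
  rwa [hr] at this

variable (E G) in
/-- The second derivative at the identity of the multiplication in the chart at `1`. -/
def chartMulDeriv₂ : E × E →L[ℝ] E × E →L[ℝ] E :=
  fderiv ℝ (fderiv ℝ (chartMul E G))
    (extChartAt 𝓘(ℝ, E) (1 : G) 1, extChartAt 𝓘(ℝ, E) (1 : G) 1)

theorem hasFDerivAt_fderiv_chartMul :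
    HasFDerivAt (fderiv ℝ (chartMul E G)) (chartMulDeriv₂ E G)
      (extChartAt 𝓘(ℝ, E) (1 : G) 1, extChartAt 𝓘(ℝ, E) (1 : G) 1) :=
  (((contDiffAt_chartMul (E := E) (G := G)).fderiv_right (m := 1)
    (by norm_cast)).differentiableAt (by simp)).hasFDerivAt

theorem chartMulDeriv₂_comm (p q : E × E) : chartMulDeriv₂ E G p q = chartMulDeriv₂ E G q p :=
  ((contDiffAt_chartMul (E := E) (G := G)).isSymmSndFDerivAt
    (by rw [minSmoothness_of_isRCLikeNormedField]; norm_cast)) p q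

theorem hasFDerivAt_leftChartDeriv (Y : E) :
    HasFDerivAt (fun z => leftChartDeriv (E := E) ((extChartAt 𝓘(ℝ, E) (1 : G)).symm z) Y)
      (((chartMulDeriv₂ E G).flip (0, Y)).comp (ContinuousLinearMap.inl ℝ E E))
      (extChartAt 𝓘(ℝ, E) (1 : G) 1) := by
  set a := extChartAt 𝓘(ℝ, E) (1 : G) 1
  have h1 : HasFDerivAt (fun z : E => (z, a)) (ContinuousLinearMap.inl ℝ E E) a :=
    (hasFDerivAt_id a).prodMk (hasFDerivAt_const a a)
  have h2 := (HasFDerivAt.comp a (f := fun z : E => (z, a))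
    (hasFDerivAt_fderiv_chartMul (E := E) (G := G)) h1).clm_apply
    (hasFDerivAt_const ((0 : E), Y) a)
  have h3 : HasFDerivAt (fun z => fderiv ℝ (chartMul E G) (z, a) (0, Y))
      (((chartMulDeriv₂ E G).flip (0, Y)).comp (ContinuousLinearMap.inl ℝ E E)) a := by
    refine h2.congr_fderiv (ContinuousLinearMap.ext fun v => ?_)
    simp
  refine h3.congr_of_eventuallyEq ?_
  filter_upwards [eventually_leftChartDeriv_eq (E := E) (G := G)] with z hz
  rw [hz]
  simp [a]

theorem leftChartDeriv_one : leftChartDeriv (1 : G) = ContinuousLinearMap.id ℝ E := by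
  have h : (fun y : G => extChartAt 𝓘(ℝ, E) (1 : G) (1 * y)) = extChartAt 𝓘(ℝ, E) (1 : G) := by
    ext y; rw [one_mul]
  unfold leftChartDeriv
  rw [h]
  exact mfderiv_extChartAt_self

theorem rightChartDeriv_one : rightChartDeriv (1 : G) = ContinuousLinearMap.id ℝ E := by
  have h : (fun y : G => extChartAt 𝓘(ℝ, E) (1 : G) (y * 1)) = extChartAt 𝓘(ℝ, E) (1 : G) := by
    ext y; rw [mul_one]
  unfold rightChartDeriv
  rw [h]
  exact mfderiv_extChartAt_self

theorem lieBracket_leftChartDeriv (X Y : E) :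
    VectorField.lieBracket ℝ
      (fun z => leftChartDeriv (E := E) ((extChartAt 𝓘(ℝ, E) (1 : G)).symm z) X)
      (fun z => leftChartDeriv (E := E) ((extChartAt 𝓘(ℝ, E) (1 : G)).symm z) Y)
      (extChartAt 𝓘(ℝ, E) (1 : G) 1) =
    chartMulDeriv₂ E G (X, 0) (0, Y) - chartMulDeriv₂ E G (0, X) (Y, 0) := by
  have hval : ∀ Z : E, leftChartDeriv (E := E)
      ((extChartAt 𝓘(ℝ, E) (1 : G)).symm (extChartAt 𝓘(ℝ, E) (1 : G) 1)) Z = Z := by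
    intro Z
    rw [extChartAt_to_inv (1 : G), leftChartDeriv_one, ContinuousLinearMap.id_apply]
  rw [VectorField.lieBracket,
    (hasFDerivAt_leftChartDeriv (E := E) (G := G) X).fderiv,
    (hasFDerivAt_leftChartDeriv (E := E) (G := G) Y).fderiv, hval, hval,
    chartMulDeriv₂_comm (0, X) (Y, 0)]
  rfl

/-- The Lie bracket in terms of the second derivative of the multiplication. -/
theorem bracket_eq_chartMulDeriv₂ (X Y : GroupLieAlgebra 𝓘(ℝ, E) G) :
    (⁅X, Y⁆ : GroupLieAlgebra 𝓘(ℝ, E) G) =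
      (chartMulDeriv₂ E G (X, 0) (0, Y) - chartMulDeriv₂ E G (0, X) (Y, 0) : E) := by
  rw [GroupLieAlgebra.bracket_def, ← VectorField.mlieBracketWithin_univ,
    VectorField.mlieBracketWithin_apply,
    mfderiv_extChartAt_self]
  set a := extChartAt 𝓘(ℝ, E) (1 : G) 1 with ha
  have hV : ∀ Z : GroupLieAlgebra 𝓘(ℝ, E) G,
      VectorField.mpullbackWithin 𝓘(ℝ, E) 𝓘(ℝ, E) (extChartAt 𝓘(ℝ, E) (1 : G)).symm
        (mulInvariantVectorField (I := 𝓘(ℝ, E)) Z) (range 𝓘(ℝ, E)) =ᶠ[𝓝 a]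
      fun z => (leftChartDeriv (E := E) ((extChartAt 𝓘(ℝ, E) (1 : G)).symm z) Z : E) := by
    intro Z
    filter_upwards [extChartAt_target_mem_nhds (I := 𝓘(ℝ, E)) (1 : G)] with z hz
    exact mpullbackWithin_mulInvariantVectorField Z hz
  have h1 := (hV X).lieBracketWithin_vectorField_eq_nhds (𝕜 := ℝ)
    (s := (extChartAt 𝓘(ℝ, E) (1 : G)).symm ⁻¹' univ ∩ range 𝓘(ℝ, E)) (hV Y)
  have h2 := lieBracket_leftChartDeriv (E := E) (G := G) X Y
  rw [← VectorField.lieBracketWithin_univ] at h2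
  have h3 : ∀ v : E, (ContinuousLinearMap.id ℝ E).inverse v = v := by simp
  rw [preimage_univ, univ_inter, modelWithCornersSelf_coe, range_id] at h1
  rw [preimage_univ, univ_inter, modelWithCornersSelf_coe, range_id]
  exact (h3 _).trans (h1.trans h2)

theorem hasDerivAt_extChartAt_lieExp [T2Space G] (X : GroupLieAlgebra 𝓘(ℝ, E) G) :
    HasDerivAt (fun t : ℝ => extChartAt 𝓘(ℝ, E) (1 : G) (lieExp (t • X))) (X : E) 0 := by
  have h0 : lieExp ((0 : ℝ) • X) = (1 : G) := lieExp_zero_smul X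
  have h1 := isMIntegralCurve_lieExp X 0
  have h2 : HasMFDerivAt 𝓘(ℝ, E) 𝓘(ℝ, E) (extChartAt 𝓘(ℝ, E) (1 : G)) (lieExp ((0 : ℝ) • X))
      (ContinuousLinearMap.id ℝ E) := by
    rw [h0]; exact hasMFDerivAt_extChartAt_one
  have h := h2.comp 0 h1
  refine hasDerivAt_iff_hasFDerivAt.2 (hasMFDerivAt_iff_hasFDerivAt.1 (h.congr_mfderiv ?_))
  refine ContinuousLinearMap.ext fun c : ℝ => ?_
  have h3 : (mulInvariantVectorField (I := 𝓘(ℝ, E)) X (lieExp ((0 : ℝ) • X)) : E) = X := by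
    have h4 : (fun y : G => 1 * y) = id := by ext y; simp
    rw [h0]
    unfold mulInvariantVectorField
    rw [h4]
    exact congrArg (fun L : E →L[ℝ] E => L X) (mfderiv_id (I := 𝓘(ℝ, E)) (x := (1 : G)))
  exact congrArg (fun v : E => c • v) h3

/-- Near `1` the adjoint map is `R⁻¹ L`, where `L` and `R` are the partial derivatives of the
multiplication in the chart. Both are the identity at `1`, so the derivative is `L' - R'`. By
`bracket_eq_chartMulDeriv₂` this is `ad X`. -/
theorem hasDerivAt_adjointMap_lieExp [T2Space G] (X : GroupLieAlgebra 𝓘(ℝ, E) G) :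
    HasDerivAt (fun t : ℝ => adjointMap E (lieExp (t • X) : G))
      ((chartMulDeriv₂ E G (X, 0)).comp (ContinuousLinearMap.inr ℝ E E) -
        (chartMulDeriv₂ E G (0, X)).comp (ContinuousLinearMap.inl ℝ E E)) 0 := by
  set a := extChartAt 𝓘(ℝ, E) (1 : G) 1 with ha
  set x : ℝ → E := fun t => extChartAt 𝓘(ℝ, E) (1 : G) (lieExp (t • X)) with hx
  have hx0 : x 0 = a := by simp only [hx, lieExp_zero_smul, ha]
  have hxd : HasDerivAt x (X : E) 0 := hasDerivAt_extChartAt_lieExp X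
  have htend : Filter.Tendsto x (𝓝 0) (𝓝 a) := by simpa [hx0] using hxd.continuousAt.tendsto
  have hexp : Filter.Tendsto (fun t : ℝ => (lieExp (t • X) : G)) (𝓝 0) (𝓝 1) := by
    have := (continuous_lieExp_smul X).tendsto 0
    rwa [lieExp_zero_smul] at this
  have hsrc := hexp.eventually (extChartAt_source_mem_nhds (I := 𝓘(ℝ, E)) (1 : G))
  set n : ℝ → (E →L[ℝ] E) := fun t =>
    (fderiv ℝ (chartMul E G) (a, x t)).comp (ContinuousLinearMap.inl ℝ E E) with hn
  set l : ℝ → (E →L[ℝ] E) := fun t =>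
    (fderiv ℝ (chartMul E G) (x t, a)).comp (ContinuousLinearMap.inr ℝ E E) with hl
  have hD := hasFDerivAt_fderiv_chartMul (E := E) (G := G)
  have hld : HasDerivAt l
      ((chartMulDeriv₂ E G (X, 0)).comp (ContinuousLinearMap.inr ℝ E E)) 0 := by
    have h1 : HasDerivAt (fun t => (x t, a)) (((X : E), (0 : E))) 0 :=
      hxd.prodMk (hasDerivAt_const 0 a)
    have h2 := (HasFDerivAt.comp_hasDerivAt_of_eq 0 hD h1 (by simp [hx0, ha]))
    exact ((ContinuousLinearMap.compL ℝ E (E × E) E).flip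
      (ContinuousLinearMap.inr ℝ E E)).hasFDerivAt.comp_hasDerivAt 0 h2
  have hnd : HasDerivAt n
      ((chartMulDeriv₂ E G (0, X)).comp (ContinuousLinearMap.inl ℝ E E)) 0 := by
    have h1 : HasDerivAt (fun t => (a, x t)) (((0 : E), (X : E))) 0 :=
      (hasDerivAt_const 0 a).prodMk hxd
    have h2 := (HasFDerivAt.comp_hasDerivAt_of_eq 0 hD h1 (by simp [hx0, ha]))
    exact ((ContinuousLinearMap.compL ℝ E (E × E) E).flip
      (ContinuousLinearMap.inl ℝ E E)).hasFDerivAt.comp_hasDerivAt 0 h2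
  have hleft : ∀ᶠ t in 𝓝 (0 : ℝ), leftChartDeriv (lieExp (t • X) : G) = l t := by
    filter_upwards [htend.eventually (eventually_leftChartDeriv_eq (E := E) (G := G)), hsrc]
      with t ht hs
    rwa [(extChartAt 𝓘(ℝ, E) (1 : G)).left_inv hs] at ht
  have hright : ∀ᶠ t in 𝓝 (0 : ℝ), rightChartDeriv (lieExp (t • X) : G) = n t := by
    filter_upwards [htend.eventually (eventually_rightChartDeriv_eq (E := E) (G := G)), hsrc]
      with t ht hs
    rwa [(extChartAt 𝓘(ℝ, E) (1 : G)).left_inv hs] at ht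
  have hn0 : n 0 = 1 := by
    rw [← hright.self_of_nhds, lieExp_zero_smul, rightChartDeriv_one]; rfl
  have hl0 : l 0 = 1 := by
    rw [← hleft.self_of_nhds, lieExp_zero_smul, leftChartDeriv_one]; rfl
  have hunit : ∀ᶠ t in 𝓝 (0 : ℝ), IsUnit (n t) := by
    have h1 : {T : E →L[ℝ] E | IsUnit T} ∈ 𝓝 (n 0) := by
      rw [hn0]; exact Units.isOpen.mem_nhds isUnit_one
    exact hnd.continuousAt.eventually h1
  have hinv : HasDerivAt (fun t => Ring.inverse (n t))
      (-(chartMulDeriv₂ E G (0, X)).comp (ContinuousLinearMap.inl ℝ E E)) 0 := by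
    have h1 := HasFDerivAt.comp_hasDerivAt_of_eq 0
      (hasFDerivAt_ringInverse (𝕜 := ℝ) (1 : (E →L[ℝ] E)ˣ)) hnd (by simp [hn0])
    exact h1.congr_deriv (by simp)
  have hprod := hinv.mul hld
  rw [hn0, hl0, Ring.inverse_one, mul_one, one_mul, neg_add_eq_sub] at hprod
  refine hprod.congr_of_eventuallyEq ?_
  filter_upwards [hleft, hright, hunit, hsrc] with t h1 h2 h3 h4
  have h5 := leftChartDeriv_eq_comp_adjointMap (E := E) h4
  rw [h1, h2] at h5
  simp only [Pi.mul_apply]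
  rw [h5, ← ContinuousLinearMap.mul_def, ← mul_assoc, Ring.inverse_mul_cancel _ h3, one_mul]

end Adjoint

/-! ### Polynomial growth against exponential growth -/

section Growth

/-- The derivative of `α B^m` is `α B^(m+1)`. Starting from `B^N = 0`, each integration lowers the
power of `B` by one and costs one factor `1 + t`. -/
theorem exists_norm_le_of_hasDerivAt_mul_nilpotent {A : Type*} [NormedRing A] [NormedAlgebra ℝ A]
    {α : ℝ → A} {B : A} (hα : ∀ t, HasDerivAt α (α t * B) t) {N : ℕ} (hB : B ^ N = 0) :
    ∃ C, 0 ≤ C ∧ ∀ t, 0 ≤ t → ‖α t‖ ≤ C * (1 + t) ^ N := by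
  have key : ∀ j ≤ N, ∃ C, 0 ≤ C ∧ ∀ t, 0 ≤ t → ‖α t * B ^ (N - j)‖ ≤ C * (1 + t) ^ j := by
    intro j
    induction j with
    | zero => exact fun _ => ⟨0, le_rfl, fun t _ => by simp [hB]⟩
    | succ j ih =>
      intro hj
      obtain ⟨C, hC0, hC⟩ := ih (by omega)
      have hNj : N - j = (N - (j + 1)) + 1 := by omega
      refine ⟨C + ‖α 0 * B ^ (N - (j + 1))‖, by positivity, fun t ht => ?_⟩
      have hd : ∀ s, HasDerivAt (fun s => α s * B ^ (N - (j + 1))) (α s * B ^ (N - j)) s := by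
        intro s
        have := (hα s).mul_const (B ^ (N - (j + 1)))
        rwa [mul_assoc, ← pow_succ', ← hNj] at this
      have h1 := Convex.norm_image_sub_le_of_norm_hasDerivWithin_le (s := Icc 0 t)
        (C := C * (1 + t) ^ j) (x := 0) (y := t) (fun s _ => (hd s).hasDerivWithinAt)
        (fun s hs => (hC s hs.1).trans (by have := hs.1; have := hs.2; gcongr))
        (convex_Icc 0 t) ⟨le_rfl, ht⟩ ⟨ht, le_rfl⟩
      have h2 : ‖t - 0‖ ≤ 1 + t := by rw [sub_zero, Real.norm_of_nonneg ht]; linarith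
      have h3 : 1 ≤ (1 + t) ^ (j + 1) := one_le_pow₀ (by linarith)
      calc ‖α t * B ^ (N - (j + 1))‖
          ≤ ‖α t * B ^ (N - (j + 1)) - α 0 * B ^ (N - (j + 1))‖ + ‖α 0 * B ^ (N - (j + 1))‖ := by
            simpa using norm_add_le (α t * B ^ (N - (j + 1)) - α 0 * B ^ (N - (j + 1)))
              (α 0 * B ^ (N - (j + 1)))
        _ ≤ C * (1 + t) ^ j * (1 + t) + ‖α 0 * B ^ (N - (j + 1))‖ * (1 + t) ^ (j + 1) := by
            gcongr
            · exact h1.trans (by gcongr)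
            · exact le_mul_of_one_le_right (norm_nonneg _) h3
        _ = _ := by ring
  obtain ⟨C, hC0, hC⟩ := key N le_rfl
  exact ⟨C, hC0, by simpa using hC⟩

/-- Take logarithms and divide by `2 ^ i`: the right side is then linear in `i` over `2 ^ i` and
tends to `0`. -/
theorem le_one_of_pow_two_pow_le {x D : ℝ} {k N : ℕ}
    (h : ∀ i : ℕ, x ^ (2 ^ i) ≤ D ^ (k + N * i)) : x ≤ 1 := by
  by_contra! hx
  have hlx : 0 < Real.log x := Real.log_pos hx
  have h1 : ∀ i : ℕ, Real.log x ≤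
      k * Real.log D * (1 / 2 : ℝ) ^ i + N * Real.log D * (i * (1 / 2 : ℝ) ^ i) := by
    intro i
    have h2 := Real.log_le_log (by positivity) (h i)
    rw [Real.log_pow, Real.log_pow] at h2
    push_cast at h2
    have h3 : (0 : ℝ) < (1 / 2) ^ i := by positivity
    have h4 := mul_le_mul_of_nonneg_left h2 h3.le
    have h5 : (1 / 2 : ℝ) ^ i * 2 ^ i = 1 := by rw [← mul_pow]; norm_num
    calc Real.log x = (1 / 2 : ℝ) ^ i * 2 ^ i * Real.log x := by rw [h5, one_mul]
      _ ≤ _ := by linarith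
  have t1 : Filter.Tendsto (fun i : ℕ => (1 / 2 : ℝ) ^ i) Filter.atTop (𝓝 0) :=
    tendsto_pow_atTop_nhds_zero_of_lt_one (by norm_num) (by norm_num)
  have t2 : Filter.Tendsto (fun i : ℕ => (i : ℝ) * (1 / 2 : ℝ) ^ i) Filter.atTop (𝓝 0) :=
    tendsto_self_mul_const_pow_of_lt_one (by norm_num) (by norm_num)
  have t3 := ge_of_tendsto' ((t1.const_mul (k * Real.log D)).add (t2.const_mul (N * Real.log D))) h1
  simp only [mul_zero, add_zero] at t3
  linarith

end Growth

/-! ### Nilpotency of the first layer -/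

section Nilpotent

/-- Each bracket with `X` raises the layer by one, and after `step` brackets every layer `i ≥ 1` has
been pushed beyond the last one. -/
theorem Stratification.ad_pow_step_eq_zero {𝔤 : Type*} [LieRing 𝔤] [LieAlgebra ℝ 𝔤]
    (𝔰 : Stratification 𝔤) {X : 𝔤} (hX : X ∈ 𝔰.layer 1) : (LieAlgebra.ad ℝ 𝔤 X) ^ 𝔰.step = 0 := by
  have h1 : ∀ i, 1 ≤ i → ∀ Y ∈ 𝔰.layer i, ⁅X, Y⁆ ∈ 𝔰.layer (i + 1) := by
    intro i hi Y hY
    by_cases his : i ≤ 𝔰.step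
    · rw [← 𝔰.bracket_eq i hi his]
      exact Submodule.subset_span ⟨X, hX, Y, hY, rfl⟩
    · rw [𝔰.layer_eq_bot i (by omega), Submodule.mem_bot] at hY
      simp [hY]
  have h2 : ∀ k i, 1 ≤ i → ∀ Y ∈ 𝔰.layer i,
      ((LieAlgebra.ad ℝ 𝔤 X) ^ k) Y ∈ 𝔰.layer (i + k) := by
    intro k
    induction k with
    | zero => intro i _ Y hY; simpa using hY
    | succ k ih =>
      intro i hi Y hY
      rw [pow_succ', Module.End.mul_apply, LieAlgebra.ad_apply]
      exact h1 (i + k) (by omega) _ (ih i hi Y hY)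
  have h3 : (⊤ : Submodule ℝ 𝔤) ≤ LinearMap.ker ((LieAlgebra.ad ℝ 𝔤 X) ^ 𝔰.step) := by
    rw [← 𝔰.isInternal.submodule_iSup_eq_top]
    refine iSup_le fun i Y hY => ?_
    have h4 := h2 𝔰.step (i + 1) (by omega) Y hY
    rw [𝔰.layer_eq_bot _ (by omega), Submodule.mem_bot] at h4
    exact h4
  exact LinearMap.ext fun Y => h3 (Submodule.mem_top (x := Y))

end Nilpotent

/-! ### Right invariance of the Haar measure along the first layer -/

section Unimodular

variable {E : Type*} [NormedAddCommGroup E] [NormedSpace ℝ E] [FiniteDimensional ℝ E]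
  {G : Type*} [TopologicalSpace G] [ChartedSpace E G] [Group G] [LieGroup 𝓘(ℝ, E) ∞ G]

/-- Since `Ad` is multiplicative, its derivative at time `0` propagates to the equation `α' = α B`
with `B = ad X`, and `B` is nilpotent. -/
theorem exists_norm_adjointMap_le [T2Space G] {X : GroupLieAlgebra 𝓘(ℝ, E) G} {N : ℕ}
    (hX : (LieAlgebra.ad ℝ (GroupLieAlgebra 𝓘(ℝ, E) G) X) ^ N = 0) :
    ∃ C, 0 ≤ C ∧ ∀ t, 0 ≤ t → ‖adjointMap E (lieExp (t • X) : G)‖ ≤ C * (1 + t) ^ N := by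
  set B : E →L[ℝ] E := (chartMulDeriv₂ E G (X, 0)).comp (ContinuousLinearMap.inr ℝ E E) -
        (chartMulDeriv₂ E G (0, X)).comp (ContinuousLinearMap.inl ℝ E E) with hBdef
  have hB : ∀ Y : E, B Y = (⁅X, (Y : GroupLieAlgebra 𝓘(ℝ, E) G)⁆ : GroupLieAlgebra 𝓘(ℝ, E) G) :=
    fun Y => (bracket_eq_chartMulDeriv₂ X Y).symm
  have hBk : ∀ (k : ℕ) (Y : E), (B ^ k) Y =
      ((LieAlgebra.ad ℝ (GroupLieAlgebra 𝓘(ℝ, E) G) X) ^ k) Y := by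
    intro k
    induction k with
    | zero => intro Y; rfl
    | succ k ih =>
      intro Y
      rw [pow_succ', pow_succ', mul_apply_eq_comp]
      exact (hB _).trans (congrArg (fun Z : GroupLieAlgebra 𝓘(ℝ, E) G => ⁅X, Z⁆) (ih Y))
  refine exists_norm_le_of_hasDerivAt_mul_nilpotent (B := B) (fun t => ?_)
    (ContinuousLinearMap.ext fun Y => ?_)
  · have h0 := hasDerivAt_adjointMap_lieExp (E := E) X
    have h1 : HasDerivAt (fun s : ℝ => adjointMap E (lieExp ((s - t) • X) : G)) B t := by
      have h2 : HasDerivAt (fun s : ℝ => adjointMap E (lieExp (s • X) : G)) B (t - t) := by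
        rw [sub_self]; exact h0
      exact h2.comp_sub_const t t
    have h3 := h1.const_mul (adjointMap E (lieExp (t • X) : G))
    refine h3.congr_of_eventuallyEq (Filter.Eventually.of_forall fun s => ?_)
    have h4 : (lieExp (s • X) : G) = lieExp (t • X) * lieExp ((s - t) • X) := by
      rw [← lieExp_add_smul, add_sub_cancel]
    simp only [h4, adjointMap_mul]
    rfl
  · rw [hBk, hX]; rfl

variable (E) in
/-- The set of points of the preferred chart at `1` that lie in a ball around `1`. -/
def chartBall (G : Type*) [TopologicalSpace G] [ChartedSpace E G] [Group G] (ρ : ℝ) : Set G :=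
  (extChartAt 𝓘(ℝ, E) (1 : G)).source ∩
    extChartAt 𝓘(ℝ, E) (1 : G) ⁻¹' Metric.ball (extChartAt 𝓘(ℝ, E) (1 : G) 1) ρ

theorem isOpen_chartBall (ρ : ℝ) : IsOpen (chartBall E G ρ) := by
  unfold chartBall
  rw [extChartAt_source]
  exact isOpen_extChartAt_preimage (I := 𝓘(ℝ, E)) (1 : G) Metric.isOpen_ball

theorem one_mem_chartBall {ρ : ℝ} (hρ : 0 < ρ) : (1 : G) ∈ chartBall E G ρ :=
  ⟨mem_extChartAt_source (1 : G), Metric.mem_ball_self hρ⟩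

theorem exists_chartBall_subset {U : Set G} (hU : U ∈ 𝓝 (1 : G)) :
    ∃ ρ₀ > 0, ∀ ρ ≤ ρ₀, chartBall E G ρ ⊆ U := by
  have h1 : (extChartAt 𝓘(ℝ, E) (1 : G)).symm ⁻¹' U ∈ 𝓝 (extChartAt 𝓘(ℝ, E) (1 : G) 1) :=
    (continuousAt_extChartAt_symm (I := 𝓘(ℝ, E)) (1 : G)).preimage_mem_nhds
      (by rwa [extChartAt_to_inv])
  obtain ⟨ρ₀, hρ₀, h⟩ := Metric.mem_nhds_iff.1 h1
  refine ⟨ρ₀, hρ₀, fun ρ hρ x hx => ?_⟩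
  have h2 := h (Metric.ball_subset_ball hρ hx.2)
  rwa [mem_preimage, (extChartAt 𝓘(ℝ, E) (1 : G)).left_inv hx.1] at h2

/-- In the chart, `(p, x) ↦ p⁻¹ x` is `C¹` near the base point, hence Lipschitz, and it is constant
on the diagonal. Small chart balls are thus comparable with left translates of balls around `1`. -/
theorem exists_lipschitz_chart_div : ∃ K : ℝ, 0 ≤ K ∧ ∃ r > 0,
    Metric.ball (extChartAt 𝓘(ℝ, E) (1 : G) 1) r ⊆ (extChartAt 𝓘(ℝ, E) (1 : G)).target ∧
    ∀ p ∈ Metric.ball (extChartAt 𝓘(ℝ, E) (1 : G) 1) r,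
    ∀ x ∈ Metric.ball (extChartAt 𝓘(ℝ, E) (1 : G) 1) r, ∀ ρ, K * dist x p < ρ →
      ((extChartAt 𝓘(ℝ, E) (1 : G)).symm p)⁻¹ * (extChartAt 𝓘(ℝ, E) (1 : G)).symm x ∈
        chartBall E G ρ := by
  set e := extChartAt 𝓘(ℝ, E) (1 : G) with he
  set a := e 1 with ha
  have h0 : e.symm a = 1 := extChartAt_to_inv (1 : G)
  have h1 : ContMDiffAt 𝓘(ℝ, E × E) 𝓘(ℝ, E) ∞ (fun p : E × E => e.symm p.1) (a, a) :=
    ContMDiffAt.comp (a, a) (g := e.symm) (f := Prod.fst)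
      contMDiffAt_chartSymm contDiff_fst.contMDiff.contMDiffAt
  have h2 : ContMDiffAt 𝓘(ℝ, E × E) 𝓘(ℝ, E) ∞ (fun p : E × E => e.symm p.2) (a, a) :=
    ContMDiffAt.comp (a, a) (g := e.symm) (f := Prod.snd)
      contMDiffAt_chartSymm contDiff_snd.contMDiff.contMDiffAt
  have h3 := h1.inv.mul h2
  have h4 : ContDiffAt ℝ 1 (fun p : E × E => e ((e.symm p.1)⁻¹ * e.symm p.2)) (a, a) := by
    rw [← contMDiffAt_iff_contDiffAt]
    refine ContMDiffAt.comp_of_eq (g := e) (y := 1)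
      contMDiffAt_extChartAt (h3.of_le (by simp)) ?_
    simp only [h0, inv_one, mul_one]
  obtain ⟨K, t, ht, hK⟩ := h4.exists_lipschitzOnWith
  have h5 : (fun p : E × E => (e.symm p.1)⁻¹ * e.symm p.2) ⁻¹' e.source ∈ 𝓝 (a, a) :=
    h3.continuousAt.preimage_mem_nhds (by
      have h6 : (e.symm a)⁻¹ * e.symm a = 1 := inv_mul_cancel _
      change e.source ∈ 𝓝 ((e.symm a)⁻¹ * e.symm a)
      rw [h6]
      exact extChartAt_source_mem_nhds (1 : G))
  obtain ⟨r1, hr1, hr1'⟩ := Metric.mem_nhds_iff.1 (Filter.inter_mem ht h5)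
  obtain ⟨r2, hr2, hr2'⟩ := Metric.mem_nhds_iff.1 (extChartAt_target_mem_nhds (I := 𝓘(ℝ, E)) (1 : G))
  have hb : ∀ p ∈ Metric.ball a (min r1 r2), ∀ x ∈ Metric.ball a (min r1 r2), (p, x) ∈
      t ∩ (fun p : E × E => (e.symm p.1)⁻¹ * e.symm p.2) ⁻¹' e.source := by
    intro p hp x hx
    refine hr1' ?_
    rw [← ball_prod_same]
    exact ⟨Metric.ball_subset_ball (min_le_left _ _) hp,
      Metric.ball_subset_ball (min_le_left _ _) hx⟩
  refine ⟨K, K.2, min r1 r2, lt_min hr1 hr2,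
    (Metric.ball_subset_ball (min_le_right _ _)).trans hr2', fun p hp x hx ρ hρ => ?_⟩
  refine ⟨(hb p hp x hx).2, ?_⟩
  have h6 := hK.dist_le_mul _ (hb p hp x hx).1 _ (hb p hp p hp).1
  have h7 : e ((e.symm p)⁻¹ * e.symm p) = a := by rw [inv_mul_cancel]
  rw [mem_preimage, Metric.mem_ball]
  change dist (e ((e.symm p)⁻¹ * e.symm x)) a < ρ
  rw [← h7]
  refine lt_of_le_of_lt h6 (lt_of_le_of_lt ?_ hρ)
  rw [Prod.dist_eq]
  simp

variable [MeasurableSpace G] [BorelSpace G] (μ : Measure G) [μ.IsHaarMeasure]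

-- A Euclidean ball of radius `2` is covered by finitely many small balls. Rescaling by `ρ` covers a
-- chart ball by that many left translates of the half-size one, and these all have the same
-- measure.
variable (E) in
theorem exists_measure_chartBall_two_mul_le [IsTopologicalGroup G] :
    ∃ D : ℕ, ∃ ρ₀ > 0, ∀ ρ, 0 < ρ → ρ ≤ ρ₀ →
    μ (chartBall E G (2 * ρ)) ≤ D * μ (chartBall E G ρ) := by
  obtain ⟨K, hK, r, hr, hrt, h⟩ := exists_lipschitz_chart_div (E := E) (G := G)
  set e := extChartAt 𝓘(ℝ, E) (1 : G) with he
  set a := e 1 with ha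
  -- The radius `1 / (K + 1)` absorbs the Lipschitz constant of the division map.
  obtain ⟨T, hT, hTf, hTc⟩ := finite_cover_balls_of_compact (isCompact_closedBall (0 : E) 2)
    (e := 1 / (K + 1)) (by positivity)
  lift T to Finset E using hTf
  refine ⟨T.card, r / 4, by positivity, fun ρ hρ hρr => ?_⟩
  have hcov : chartBall E G (2 * ρ) ⊆
      ⋃ q ∈ T, (fun g => (e.symm (a + ρ • q))⁻¹ * g) ⁻¹' chartBall E G ρ := by
    intro g hg
    have hx : dist (e g) a < 2 * ρ := hg.2
    have h1 : ρ⁻¹ • (e g - a) ∈ Metric.closedBall (0 : E) 2 := by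
      rw [mem_closedBall_zero_iff, norm_smul, norm_inv, Real.norm_of_nonneg hρ.le,
        inv_mul_le_iff₀ hρ, ← dist_eq_norm]
      linarith
    obtain ⟨q, hq, hqd⟩ := mem_iUnion₂.1 (hTc h1)
    refine mem_iUnion₂.2 ⟨q, hq, ?_⟩
    have hq2 : ‖q‖ ≤ 2 := by simpa using hT hq
    have hp : a + ρ • q ∈ Metric.ball a r := by
      rw [Metric.mem_ball, dist_eq_norm, add_sub_cancel_left, norm_smul, Real.norm_of_nonneg hρ.le]
      nlinarith
    have hdist : dist (e g) (a + ρ • q) = ρ * dist (ρ⁻¹ • (e g - a)) q := by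
      rw [dist_eq_norm, dist_eq_norm, ← Real.norm_of_nonneg hρ.le, ← norm_smul,
        Real.norm_of_nonneg hρ.le, smul_sub, smul_inv_smul₀ hρ.ne', sub_sub]
    have h2 := h (a + ρ • q) hp (e g) (Metric.mem_ball.2 (by linarith)) ρ (by
      rw [hdist]
      have h3 : dist (ρ⁻¹ • (e g - a)) q < 1 / (K + 1) := hqd
      rw [lt_div_iff₀ (by positivity)] at h3
      have : (0:ℝ) ≤ dist (ρ⁻¹ • (e g - a)) q := dist_nonneg
      nlinarith)
    rwa [e.left_inv hg.1] at h2
  calc μ (chartBall E G (2 * ρ)) ≤ ∑ q ∈ T, μ ((fun g => (e.symm (a + ρ • q))⁻¹ * g) ⁻¹'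
        chartBall E G ρ) := (measure_mono hcov).trans (measure_biUnion_finset_le _ _)
    _ = T.card * μ (chartBall E G ρ) := by simp [measure_preimage_mul]

/-- The derivative of the conjugation at the fixed point `1` is `Ad g`. The extra `1` in `c` pays
for the first-order remainder on small balls. -/
theorem exists_conj_chartBall_subset (g : G) {c : ℝ} (hc : ‖adjointMap E g‖ + 1 ≤ c) :
    ∃ ρ₀ > 0, ∀ ρ, 0 < ρ → ρ ≤ ρ₀ →
      chartBall E G ρ ⊆ (fun x => g * x * g⁻¹) ⁻¹' chartBall E G (c * ρ) := by
  set e := extChartAt 𝓘(ℝ, E) (1 : G) with he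
  set a := e 1 with ha
  have h1 : HasMFDerivAt 𝓘(ℝ, E) 𝓘(ℝ, E) (fun x : G => e (g * x * g⁻¹)) 1 (adjointMap E g) := by
    have h2 : HasMFDerivAt 𝓘(ℝ, E) 𝓘(ℝ, E) e (g * 1 * g⁻¹) (ContinuousLinearMap.id ℝ E) := by
      rw [show g * 1 * g⁻¹ = 1 by group]; exact hasMFDerivAt_extChartAt_one
    exact h2.comp (1 : G) (mdifferentiableAt_conj (E := E) g 1).hasMFDerivAt
  have h2 : HasFDerivAt (fun z => e (g * e.symm z * g⁻¹)) (adjointMap E g) a := by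
    have := h1.2
    rw [modelWithCornersSelf_coe, range_id] at this
    exact hasFDerivWithinAt_univ.1 this
  have h3 := h2.isLittleO.def one_pos
  obtain ⟨r, hr, hr'⟩ := Metric.eventually_nhds_iff_ball.1 h3
  have hcont : Continuous fun x : G => g * x * g⁻¹ :=
    ((contMDiff_mul_right (I := 𝓘(ℝ, E)) (n := ∞) (a := g⁻¹)).comp
    (contMDiff_mul_left (I := 𝓘(ℝ, E)) (n := ∞) (a := g))).continuous
  obtain ⟨r', hr'0, hr'1⟩ := exists_chartBall_subset (E := E)
    (hcont.continuousAt.preimage_mem_nhds (x := (1 : G)) (t := e.source) (by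
      rw [mul_one, mul_inv_cancel]; exact extChartAt_source_mem_nhds (I := 𝓘(ℝ, E)) (1 : G)))
  refine ⟨min r r', lt_min hr hr'0, fun ρ hρ hρr x hx => ⟨hr'1 ρ (hρr.trans (min_le_right _ _)) hx,
    ?_⟩⟩
  have h4 := hr' (e x) (Metric.ball_subset_ball (hρr.trans (min_le_left _ _)) hx.2)
  rw [e.left_inv hx.1, show e.symm a = 1 from extChartAt_to_inv (1 : G), mul_one,
    mul_inv_cancel, one_mul] at h4
  have hxa : ‖e x - a‖ < ρ := by rw [← dist_eq_norm]; exact hx.2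
  rw [mem_preimage, Metric.mem_ball, dist_eq_norm]
  have h5 := (adjointMap E g).le_opNorm (e x - a)
  have h6 : ‖e (g * x * g⁻¹) - a‖ ≤ (‖adjointMap E g‖ + 1) * ‖e x - a‖ := by
    calc ‖e (g * x * g⁻¹) - a‖
        = ‖(e (g * x * g⁻¹) - e 1 - adjointMap E g (e x - a)) + adjointMap E g (e x - a)‖ := by
          rw [sub_add_cancel]
      _ ≤ ‖e x - a‖ + ‖adjointMap E g‖ * ‖e x - a‖ :=
          (norm_add_le _ _).trans (add_le_add (by simpa using h4) h5)
      _ = _ := by ring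
  calc _ ≤ (‖adjointMap E g‖ + 1) * ‖e x - a‖ := h6
    _ ≤ c * ‖e x - a‖ := by gcongr
    _ < c * ρ := by
      have : 0 < c := lt_of_lt_of_le (by positivity) hc
      gcongr

-- Conjugation by `g` maps a small ball into one `2 ^ k` times larger, whose measure is at most `D ^
-- k` times as large by doubling. It also scales the measure by the modular function. The point is
-- that `D` does not depend on `g`; only the admissible radius does.
open Measure in
variable (E G) in
theorem exists_modularCharacter_le [IsTopologicalGroup G] [LocallyCompactSpace G]
    [μ.InnerRegular] : ∃ D : ℕ, ∀ (g : G) (k : ℕ),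
      ‖adjointMap E g‖ + 1 ≤ 2 ^ k → (modularCharacterFun g : ℝ) ≤ D ^ k := by
  obtain ⟨D, ρ₁, hρ₁, hD⟩ := exists_measure_chartBall_two_mul_le E μ
  refine ⟨D, fun g k hk => ?_⟩
  obtain ⟨ρ₂, hρ₂, hconj⟩ := exists_conj_chartBall_subset (E := E) g hk
  obtain ⟨U, hU, hUfin⟩ := μ.finiteAt_nhds (1 : G)
  obtain ⟨ρ₃, hρ₃, hsub⟩ := exists_chartBall_subset (E := E) hU
  -- Small enough for `k` successive doublings, for the conjugation estimate, and for finite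
  -- measure.
  set ρ := min (ρ₁ / 2 ^ k) (min ρ₂ ρ₃) with hρdef
  have hρ : 0 < ρ := by positivity
  have hfin : μ (chartBall E G ρ) ≠ ⊤ :=
    ((measure_mono (hsub ρ ((min_le_right _ _).trans (min_le_right _ _)))).trans_lt hUfin).ne
  have hpos : μ (chartBall E G ρ) ≠ 0 :=
    (isOpen_chartBall ρ).measure_ne_zero μ ⟨1, one_mem_chartBall hρ⟩
  have hDk : ∀ j ≤ k, μ (chartBall E G (2 ^ j * ρ)) ≤ (D : ℝ≥0∞) ^ j * μ (chartBall E G ρ) := by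
    intro j
    induction j with
    | zero => intro _; simp
    | succ j ih =>
      intro hj
      have h1 : 2 ^ j * ρ ≤ ρ₁ := by
        have : ρ ≤ ρ₁ / 2 ^ k := min_le_left _ _
        rw [le_div_iff₀ (by positivity)] at this
        have h2 : (2 : ℝ) ^ j ≤ 2 ^ k := pow_le_pow_right₀ (by norm_num) (by omega)
        nlinarith
      calc μ (chartBall E G (2 ^ (j + 1) * ρ)) = μ (chartBall E G (2 * (2 ^ j * ρ))) := by
            congr 2; ring
        _ ≤ D * μ (chartBall E G (2 ^ j * ρ)) := hD _ (by positivity) h1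
        _ ≤ D * (D ^ j * μ (chartBall E G ρ)) := by gcongr; exact ih (by omega)
        _ = _ := by ring
  have h1 : μ (chartBall E G ρ) ≤
      modularCharacterFun g⁻¹ * ((D : ℝ≥0∞) ^ k * μ (chartBall E G ρ)) := by
    calc μ (chartBall E G ρ) ≤ μ ((fun x => g * x * g⁻¹) ⁻¹' chartBall E G (2 ^ k * ρ)) :=
          measure_mono (hconj ρ hρ ((min_le_right _ _).trans (min_le_left _ _)))
      _ = μ ((fun x => g * x) ⁻¹' ((fun x => x * g⁻¹) ⁻¹' chartBall E G (2 ^ k * ρ))) := rfl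
      _ = μ.map (fun x => x * g⁻¹) (chartBall E G (2 ^ k * ρ)) := by
          rw [measure_preimage_mul, Measure.map_apply (measurable_mul_const _)
            (isOpen_chartBall _).measurableSet]
      _ = modularCharacterFun g⁻¹ * μ (chartBall E G (2 ^ k * ρ)) := by
          rw [map_right_mul_eq_modularCharacterFun_smul]; rfl
      _ ≤ _ := by gcongr; exact hDk k le_rfl
  rw [← mul_assoc] at h1
  have h2 : (1 : ℝ≥0∞) ≤ modularCharacterFun g⁻¹ * (D : ℝ≥0∞) ^ k := by
    by_contra! hlt
    have := ENNReal.mul_lt_mul_left hpos hfin hlt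
    rw [one_mul] at this
    exact absurd h1 this.not_ge
  have h3 : (1 : NNReal) ≤ modularCharacterFun g⁻¹ * (D : NNReal) ^ k := by exact_mod_cast h2
  have h4 : modularCharacterFun g * modularCharacterFun g⁻¹ = 1 := by
    rw [← modularCharacterFun_map_mul, mul_inv_cancel, modularCharacterFun_map_one]
  have h5 : modularCharacterFun g ≤ (D : NNReal) ^ k := by
    calc modularCharacterFun g ≤ modularCharacterFun g *
          (modularCharacterFun g⁻¹ * (D : NNReal) ^ k) := le_mul_of_one_le_right (by simp) h3
      _ = _ := by rw [← mul_assoc, h4, one_mul]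
  exact_mod_cast h5

-- The value at `exp (2^i X)` is the `2^i`-th power of the value at `exp X`, yet it is at most `D ^
-- (k + N i)` because `Ad` grows polynomially.
open Measure in
theorem modularCharacterFun_lieExp_le_one [T2Space G] [IsTopologicalGroup G]
    [LocallyCompactSpace G] [μ.InnerRegular] {X : GroupLieAlgebra 𝓘(ℝ, E) G} {N : ℕ}
    (hX : (LieAlgebra.ad ℝ (GroupLieAlgebra 𝓘(ℝ, E) G) X) ^ N = 0) :
    modularCharacterFun (lieExp X : G) ≤ 1 := by
  obtain ⟨D, hD⟩ := exists_modularCharacter_le E G μ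
  obtain ⟨C, hC0, hC⟩ := exists_norm_adjointMap_le hX
  obtain ⟨k, hk⟩ := pow_unbounded_of_one_lt (C * 2 ^ N + 1) (one_lt_two (α := ℝ))
  have hmul : ∀ (g : G) (m : ℕ), modularCharacterFun (g ^ m) = modularCharacterFun g ^ m :=
    fun g m => map_pow modularCharacter g m
  suffices h : (modularCharacterFun (lieExp X : G) : ℝ) ≤ 1 by exact_mod_cast h
  refine le_one_of_pow_two_pow_le (D := D) (k := k) (N := N) fun i => ?_
  have h1 : (lieExp X : G) ^ (2 ^ i) = lieExp (((2 : ℝ) ^ i) • X) := by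
    have := lieExp_mul_intCast_smul X 1 ((2 ^ i : ℕ) : ℤ)
    rw [one_smul, mul_one, zpow_natCast] at this
    rw [← this]
    push_cast
    rfl
  have h2 : ((modularCharacterFun (lieExp X : G) : ℝ)) ^ (2 ^ i) =
      modularCharacterFun (lieExp (((2 : ℝ) ^ i) • X) : G) := by
    rw [← h1, hmul]; simp
  rw [h2]
  refine hD _ _ ?_
  have h3 : (1 : ℝ) ≤ 2 ^ i := one_le_pow₀ (by norm_num)
  have h4 : (1 : ℝ) ≤ (2 ^ i) ^ N := one_le_pow₀ h3
  calc ‖adjointMap E (lieExp (((2 : ℝ) ^ i) • X) : G)‖ + 1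
      ≤ C * (1 + 2 ^ i) ^ N + 1 := by gcongr; exact hC _ (by positivity)
    _ ≤ C * (2 * 2 ^ i) ^ N + (2 ^ i) ^ N := by gcongr; linarith
    _ = (C * 2 ^ N + 1) * (2 ^ i) ^ N := by rw [mul_pow]; ring
    _ ≤ 2 ^ k * (2 ^ i) ^ N := by gcongr
    _ = 2 ^ (k + N * i) := by rw [← pow_mul, ← pow_add, mul_comm i N]

open Measure in
/-- A Haar measure of a Lie group is invariant under the flow of a left-invariant vector field
that acts nilpotently on the Lie algebra. -/
theorem map_mul_lieExp_eq [T2Space G] [IsTopologicalGroup G] [LocallyCompactSpace G]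
    [μ.InnerRegular] {X : GroupLieAlgebra 𝓘(ℝ, E) G} {N : ℕ}
    (hX : (LieAlgebra.ad ℝ (GroupLieAlgebra 𝓘(ℝ, E) G) X) ^ N = 0) :
    μ.map (fun x => x * lieExp X) = μ := by
  have h1 := modularCharacterFun_lieExp_le_one μ hX
  -- The bound at `-X` is the reverse inequality, since `exp (-X)` is the inverse of `exp X`.
  have h2 := modularCharacterFun_lieExp_le_one μ (X := -X) (N := N) (by
    rw [map_neg, neg_pow, hX, mul_zero])
  have h3 : modularCharacterFun (lieExp X : G) * modularCharacterFun (lieExp (-X) : G) = 1 := by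
    have h4 : (lieExp X : G) * lieExp (-X) = 1 := by
      have := lieExp_neg_smul X 1
      rw [neg_one_smul, one_smul] at this
      rw [this, mul_inv_cancel]
    rw [← modularCharacterFun_map_mul, h4, modularCharacterFun_map_one]
  have h4 : modularCharacterFun (lieExp X : G) = 1 := by
    refine le_antisymm h1 ?_
    rw [← h3]
    exact mul_le_of_le_one_right (by simp) h2
  rw [map_right_mul_eq_modularCharacterFun_smul, h4, one_smul]

end Unimodular

/-! ### Calibration along the orbits of one translation -/

section Translations

variable {G : Type*} [MeasurableSpace G] [Group G] [MeasurableMul G] {μ : Measure G}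

/-- The difference `𝟙_T (x g⁻¹) - 𝟙_T (x)`. -/
def translateDiff (T : Set G) (g x : G) : ℝ :=
  T.indicator (1 : G → ℝ) (x * g⁻¹) - T.indicator (1 : G → ℝ) x

/-- Along the orbits of almost every point, the set `S` is an initial or a final segment. -/
def IsMonotoneAlong (μ : Measure G) (S : Set G) (g : G) : Prop :=
  ∀ᵐ x ∂μ, (∀ n m : ℤ, n ≤ m → x * g ^ n ∈ S → x * g ^ m ∈ S) ∨
    (∀ n m : ℤ, n ≤ m → x * g ^ m ∈ S → x * g ^ n ∈ S)

theorem abs_translateDiff_le_one (T : Set G) (g x : G) : |translateDiff T g x| ≤ 1 := by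
  classical
  simp only [translateDiff, indicator, Pi.one_apply]
  split_ifs <;> simp

theorem measurePreserving_mul_inv {g : G} (hg : MeasurePreserving (fun x => x * g) μ μ) :
    MeasurePreserving (fun x => x * g⁻¹) μ μ := by
  have h := MeasurePreserving.symm (MeasurableEquiv.mulRight g) hg
  rwa [MeasurableEquiv.symm_mulRight] at h

theorem measurePreserving_mul_zpow {g : G} (hg : MeasurePreserving (fun x => x * g) μ μ) (n : ℤ) :
    MeasurePreserving (fun x => x * g ^ n) μ μ := by
  induction n using Int.induction_on with
  | zero => simpa using! MeasurePreserving.id μ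
  | succ n ih =>
    have h := hg.comp ih
    simpa [Function.comp_def, mul_assoc, zpow_add_one] using h
  | pred n ih =>
    have h := (measurePreserving_mul_inv hg).comp ih
    simpa [Function.comp_def, mul_assoc, zpow_sub_one] using h

theorem aestronglyMeasurable_indicator_one {T : Set G} (hT : NullMeasurableSet T μ) :
    AEStronglyMeasurable (T.indicator (1 : G → ℝ)) μ :=
  (aestronglyMeasurable_const (b := (1 : ℝ))).indicator₀ hT

theorem aestronglyMeasurable_translateDiff {T : Set G} (hT : NullMeasurableSet T μ) {g : G}
    (hg : MeasurePreserving (fun x => x * g) μ μ) :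
    AEStronglyMeasurable (translateDiff T g) μ :=
  ((aestronglyMeasurable_indicator_one hT).comp_measurePreserving
    (measurePreserving_mul_inv hg)).sub (aestronglyMeasurable_indicator_one hT)

theorem integrable_translateDiff_mul {T : Set G} (hT : NullMeasurableSet T μ) {g : G}
    (hg : MeasurePreserving (fun x => x * g) μ μ) {h : G → ℝ} (hh : Integrable h μ) :
    Integrable (fun x => translateDiff T g x * h x) μ :=
  hh.bdd_mul (aestronglyMeasurable_translateDiff hT hg)
    (Filter.Eventually.of_forall fun x => abs_translateDiff_le_one T g x)

theorem integrable_comp_mul_right {g : G} (hg : MeasurePreserving (fun x => x * g) μ μ)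
    {h : G → ℝ} (hh : Integrable h μ) : Integrable (fun x => h (x * g)) μ :=
  hg.integrable_comp_of_integrable hh

/-- The discrete integration by parts: right invariance moves the translation from the set to the
test function. -/
theorem integral_translateDiff_mul {T : Set G} (hT : NullMeasurableSet T μ) {g : G}
    (hg : MeasurePreserving (fun x => x * g) μ μ) {h : G → ℝ} (hh : Integrable h μ) :
    ∫ x, translateDiff T g x * h x ∂μ = ∫ x in T, (h (x * g) - h x) ∂μ := by
  have hind := aestronglyMeasurable_indicator_one hT
  have hb : ∀ x, ‖T.indicator (1 : G → ℝ) x‖ ≤ 1 := fun x => by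
    classical
    simp only [indicator, Pi.one_apply]; split_ifs <;> simp
  have hi : ∀ {k : G → ℝ}, Integrable k μ → Integrable (fun x => T.indicator (1 : G → ℝ) x * k x) μ :=
    fun hk => hk.bdd_mul hind (Filter.Eventually.of_forall hb)
  have hset : ∀ k : G → ℝ, ∫ x in T, k x ∂μ = ∫ x, T.indicator (1 : G → ℝ) x * k x ∂μ := by
    intro k
    rw [← integral_indicator₀ hT]
    refine integral_congr_ae (Filter.Eventually.of_forall fun x => ?_)
    by_cases hx : x ∈ T <;> simp [hx]
  have h1 : ∫ x, T.indicator (1 : G → ℝ) (x * g⁻¹) * h x ∂μ =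
      ∫ x, T.indicator (1 : G → ℝ) x * h (x * g) ∂μ := by
    rw [← hg.integral_comp (MeasurableEquiv.mulRight g).measurableEmbedding]
    simp
  have h2 : Integrable (fun x => T.indicator (1 : G → ℝ) (x * g⁻¹) * h x) μ :=
    hh.bdd_mul (hind.comp_measurePreserving (measurePreserving_mul_inv hg))
      (Filter.Eventually.of_forall fun x => hb _)
  rw [hset]
  simp only [translateDiff, sub_mul, mul_sub]
  rw [integral_sub h2 (hi hh), integral_sub (hi (integrable_comp_mul_right hg hh)) (hi hh), h1]

theorem nullMeasurableSet_forall_zpow {S : Set G} (hS : NullMeasurableSet S μ) {g : G}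
    (hg : MeasurePreserving (fun x => x * g) μ μ) :
    NullMeasurableSet {x | ∀ n m : ℤ, n ≤ m → x * g ^ n ∈ S → x * g ^ m ∈ S} μ := by
  have : {x | ∀ n m : ℤ, n ≤ m → x * g ^ n ∈ S → x * g ^ m ∈ S} = ⋂ (n : ℤ), ⋂ (m : ℤ),
      ⋂ (_ : n ≤ m), (((fun x => x * g ^ n) ⁻¹' S)ᶜ ∪ (fun x => x * g ^ m) ⁻¹' S) := by
    ext x
    simp only [mem_ofPred_eq, mem_iInter, mem_union, mem_compl_iff, mem_preimage,
      imp_iff_not_or]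
  rw [this]
  refine .iInter fun n => .iInter fun m => .iInter fun _ => .union (.compl ?_) ?_
  · exact hS.preimage (measurePreserving_mul_zpow hg n).quasiMeasurePreserving
  · exact hS.preimage (measurePreserving_mul_zpow hg m).quasiMeasurePreserving

theorem nullMeasurableSet_forall_zpow' {S : Set G} (hS : NullMeasurableSet S μ) {g : G}
    (hg : MeasurePreserving (fun x => x * g) μ μ) :
    NullMeasurableSet {x | ∀ n m : ℤ, n ≤ m → x * g ^ m ∈ S → x * g ^ n ∈ S} μ := by
  simpa only [mem_compl_iff, not_imp_not] using nullMeasurableSet_forall_zpow hS.compl hg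

/-- The sign depends only on whether the orbit meets `S` in a final segment, a condition unchanged
by `x ↦ x * g`. This invariance makes `s` a calibration. -/
theorem IsMonotoneAlong.exists_sign {S : Set G} (hS : NullMeasurableSet S μ) {g : G}
    (hg : MeasurePreserving (fun x => x * g) μ μ) (h : IsMonotoneAlong μ S g) :
    ∃ s : G → ℝ, AEStronglyMeasurable s μ ∧ (∀ x, |s x| = 1) ∧ (∀ x, s (x * g) = s x) ∧
      ∀ᵐ x ∂μ, |translateDiff S g x| = s x * translateDiff S g x := by
  classical
  set P : Set G := {x | ∀ n m : ℤ, n ≤ m → x * g ^ n ∈ S → x * g ^ m ∈ S} with hP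
  have hPm : NullMeasurableSet P μ := nullMeasurableSet_forall_zpow hS hg
  have hPg : ∀ x, x * g ∈ P ↔ x ∈ P := by
    intro x
    have hz : ∀ n : ℤ, x * g * g ^ n = x * g ^ (n + 1) := fun n => by
      rw [mul_assoc, ← zpow_one_add, add_comm]
    simp only [hP, mem_ofPred_eq, hz]
    constructor
    · intro hx n m hnm
      have := hx (n - 1) (m - 1) (by omega)
      simpa using this
    · intro hx n m hnm
      exact hx (n + 1) (m + 1) (by omega)
  -- The sign is `-1` on `P`, where `x * g⁻¹ ∈ S` implies `x ∈ S` and the difference is nonpositive,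
  -- and `1` elsewhere.
  refine ⟨P.indicator (-2 : G → ℝ) + 1, ?_, fun x => ?_, fun x => ?_, ?_⟩
  · exact ((aestronglyMeasurable_const (b := (-2 : ℝ))).indicator₀ hPm).add
      aestronglyMeasurable_const
  · by_cases hx : x ∈ P <;> simp [hx]; norm_num
  · by_cases hx : x ∈ P
    · simp [hx, (hPg x).2 hx]
    · simp [hx, mt (hPg x).1 hx]
  · filter_upwards [h] with x hx
    have e0 : x * g ^ (0 : ℤ) = x := by simp
    have e1 : x * g ^ (-1 : ℤ) = x * g⁻¹ := by simp
    by_cases hxP : x ∈ P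
    · have h1 := hxP (-1) 0 (by norm_num)
      rw [e0, e1] at h1
      have h2 : translateDiff S g x ≤ 0 := by
        simp only [translateDiff, indicator, Pi.one_apply]
        split_ifs <;> simp_all
      rw [abs_of_nonpos h2]
      simp [hxP]; ring
    · have h1 := (hx.resolve_left hxP) (-1) 0 (by norm_num)
      rw [e0, e1] at h1
      have h2 : 0 ≤ translateDiff S g x := by
        simp only [translateDiff, indicator, Pi.one_apply]
        split_ifs <;> simp_all
      rw [abs_of_nonneg h2]
      simp [hxP]

theorem integrable_abs_translateDiff_mul {T : Set G} (hT : NullMeasurableSet T μ) {g : G}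
    (hg : MeasurePreserving (fun x => x * g) μ μ) {h : G → ℝ} (hh : Integrable h μ) :
    Integrable (fun x => |translateDiff T g x| * h x) μ :=
  hh.bdd_mul (aestronglyMeasurable_translateDiff hT hg).norm
    (Filter.Eventually.of_forall fun x => by
      simpa using abs_translateDiff_le_one T g x)

theorem IsMonotoneAlong.exists_integral_eq {S : Set G} (hS : NullMeasurableSet S μ) {g : G}
    (hg : MeasurePreserving (fun x => x * g) μ μ) (h : IsMonotoneAlong μ S g) {η : G → ℝ}
    (hη : Integrable η μ) :
    ∃ s : G → ℝ, Integrable (fun x => s x * η x) μ ∧ (∀ x, |s x| = 1) ∧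
      (∀ x, s (x * g) = s x) ∧ ∫ x, |translateDiff S g x| * η x ∂μ =
        ∫ x in S, (s (x * g) * η (x * g) - s x * η x) ∂μ := by
  obtain ⟨s, hsm, hs1, hsg, hs⟩ := h.exists_sign hS hg
  have hsη : Integrable (fun x => s x * η x) μ :=
    hη.bdd_mul hsm (Filter.Eventually.of_forall fun x => (hs1 x).le)
  refine ⟨s, hsη, hs1, hsg, ?_⟩
  rw [← integral_translateDiff_mul hS hg hsη]
  refine integral_congr_ae ?_
  filter_upwards [hs] with x hx
  rw [hx]; ring

/-- Sets that are monotone along the orbits have minimal variation along the orbits. -/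
theorem IsMonotoneAlong.integral_abs_translateDiff_le {S F : Set G} (hS : NullMeasurableSet S μ)
    (hF : NullMeasurableSet F μ) {g : G} (hg : MeasurePreserving (fun x => x * g) μ μ)
    (h : IsMonotoneAlong μ S g) {η : G → ℝ} (hη : Integrable η μ) (hη0 : ∀ x, 0 ≤ η x)
    (hSF : ∀ x ∈ symmDiff S F, η (x * g) = η x) :
    ∫ x, |translateDiff S g x| * η x ∂μ ≤ ∫ x, |translateDiff F g x| * η x ∂μ := by
  obtain ⟨s, hsη, hs1, hsg, h1⟩ := h.exists_integral_eq hS hg hη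
  -- The increment of `s η` vanishes on the symmetric difference, so the competitor gives the same
  -- value.
  have h2 : ∫ x in S, (s (x * g) * η (x * g) - s x * η x) ∂μ =
      ∫ x in F, (s (x * g) * η (x * g) - s x * η x) ∂μ := by
    rw [← integral_indicator₀ hS, ← integral_indicator₀ hF]
    refine integral_congr_ae (Filter.Eventually.of_forall fun x => ?_)
    by_cases hxS : x ∈ S <;> by_cases hxF : x ∈ F
    · simp [hxS, hxF]
    · have := hSF x (Or.inl ⟨hxS, hxF⟩); simp [hxS, hxF, hsg, this]
    · have := hSF x (Or.inr ⟨hxF, hxS⟩); simp [hxS, hxF, hsg, this]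
    · simp [hxS, hxF]
  rw [h1, h2, ← integral_translateDiff_mul hF hg hsη]
  refine integral_mono (integrable_translateDiff_mul hF hg hsη)
    (integrable_abs_translateDiff_mul hF hg hη) fun x => ?_
  have h3 : s x * translateDiff F g x ≤ |translateDiff F g x| :=
    (le_abs_self _).trans (by rw [abs_mul, hs1, one_mul])
  calc translateDiff F g x * (s x * η x) = s x * translateDiff F g x * η x := by ring
    _ ≤ _ := by gcongr; exact hη0 x

/-- The a priori bound behind locally finite perimeter: no information on the boundary of `S` enters
the right side. -/
theorem IsMonotoneAlong.integral_abs_translateDiff_le_integral_abs_sub {S : Set G}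
    (hS : NullMeasurableSet S μ) {g : G} (hg : MeasurePreserving (fun x => x * g) μ μ)
    (h : IsMonotoneAlong μ S g) {η : G → ℝ} (hη : Integrable η μ) :
    ∫ x, |translateDiff S g x| * η x ∂μ ≤ ∫ x, |η (x * g) - η x| ∂μ := by
  obtain ⟨s, hsη, hs1, hsg, h1⟩ := h.exists_integral_eq hS hg hη
  have hi : Integrable (fun x => |η (x * g) - η x|) μ :=
    ((integrable_comp_mul_right hg hη).sub hη).abs
  rw [h1]
  calc ∫ x in S, (s (x * g) * η (x * g) - s x * η x) ∂μ
      ≤ ∫ x in S, |η (x * g) - η x| ∂μ := by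
        refine integral_mono ((integrable_comp_mul_right hg hsη).sub hsη).integrableOn
          hi.integrableOn fun x => ?_
        rw [hsg, ← mul_sub]
        exact (le_abs_self _).trans (by rw [abs_mul, hs1, one_mul])
    _ ≤ ∫ x, |η (x * g) - η x| ∂μ :=
        setIntegral_le_integral hi (Filter.Eventually.of_forall fun x => abs_nonneg _)

end Translations

/-! ### From monotone lines to monotone orbits -/

section Fubini

variable {E : Type*} [NormedAddCommGroup E] [NormedSpace ℝ E] [FiniteDimensional ℝ E]
  {G : Type*} [TopologicalSpace G] [ChartedSpace E G] [Group G] [LieGroup 𝓘(ℝ, E) ∞ G]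
  [T2Space G] [IsTopologicalGroup G] [SecondCountableTopology G] [MeasurableSpace G] [BorelSpace G]

/-- Almost every line in the direction `X` is monotone for `S`. -/
def IsMonotoneDirection (μ : Measure G) (X : GroupLieAlgebra 𝓘(ℝ, E) G) (S : Set G) : Prop :=
  ∀ᵐ x ∂μ, ∃ f : ℝ → ℝ, (Monotone f ∨ Antitone f) ∧
    (fun t => S.indicator (1 : G → ℝ) (flow X x t)) =ᵐ[volume] f

/-- Along a good line the indicator equals a monotone function off a null set of times, and almost
every progression `u + n t` avoids that set. Fubini and the invariance of `μ` turn "almost every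
point of almost every line" into "almost every point". -/
theorem IsMonotoneDirection.isMonotoneAlong {μ : Measure G} [SFinite μ]
    {X : GroupLieAlgebra 𝓘(ℝ, E) G} {S : Set G}
    (h : IsMonotoneDirection μ X S) (hS : NullMeasurableSet S μ)
    (hX : ∀ t : ℝ, MeasurePreserving (fun x : G => x * lieExp (t • X)) μ μ) {t : ℝ} (ht : 0 ≤ t) :
    IsMonotoneAlong μ S (lieExp (t • X)) := by
  classical
  set g : G := lieExp (t • X) with hg
  set P : Set G := {x | ∀ n m : ℤ, n ≤ m → x * g ^ n ∈ S → x * g ^ m ∈ S} with hP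
  set Q : Set G := {x | ∀ n m : ℤ, n ≤ m → x * g ^ m ∈ S → x * g ^ n ∈ S} with hQ
  have hPm : NullMeasurableSet P μ := nullMeasurableSet_forall_zpow hS (hX t)
  have hQm : NullMeasurableSet Q μ := nullMeasurableSet_forall_zpow' hS (hX t)
  have hPQ : NullMeasurableSet (P ∪ Q)ᶜ μ := (hPm.union hQm).compl
  -- The bad set is only null measurable, while exchanging the quantifiers requires a measurable
  -- one. `N` is a measurable hull, and `Z` below is a measurable null set containing the excess.
  obtain ⟨N, hNsup, hNm, hNae⟩ := hPQ.exists_measurable_superset_ae_eq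
  have hZ : μ (toMeasurable μ (N \ (P ∪ Q)ᶜ)) = 0 := by
    rw [measure_toMeasurable]; exact (ae_le_set.1 hNae.le)
  set Z := toMeasurable μ (N \ (P ∪ Q)ᶜ) with hZdef
  have hcont : Continuous fun p : G × ℝ => p.1 * lieExp (p.2 • X) :=
    continuous_fst.mul ((continuous_lieExp_smul X).comp continuous_snd)
  have hmeas : ∀ {A : Set G}, MeasurableSet A →
      MeasurableSet {p : G × ℝ | p.1 * lieExp (p.2 • X) ∉ A} := fun hA =>
    (hcont.measurable hA).compl
  have h1 : ∀ᵐ x ∂μ, ∀ᵐ u : ℝ, x * lieExp (u • X) ∉ Z := by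
    rw [Measure.ae_ae_comm (hmeas (measurableSet_toMeasurable _ _))]
    refine Filter.Eventually.of_forall fun u => ?_
    exact (hX u).quasiMeasurePreserving.ae (measure_eq_zero_iff_ae_notMem.1 hZ)
  have h2 : ∀ᵐ x ∂μ, ∀ᵐ u : ℝ, x * lieExp (u • X) ∈ P ∪ Q := by
    filter_upwards [h] with x hx
    obtain ⟨f, hf, hfe⟩ := hx
    have h3 : ∀ᵐ u : ℝ, ∀ n : ℤ, S.indicator (1 : G → ℝ) (flow X x (u + n * t)) = f (u + n * t) :=
      ae_all_iff.2 fun n =>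
        (measurePreserving_add_right (volume : Measure ℝ) (n * t)).quasiMeasurePreserving.ae hfe
    filter_upwards [h3] with u hu
    have h4 : ∀ n : ℤ, x * lieExp (u • X) * g ^ n = flow X x (u + n * t) := fun n => by
      rw [flow, lieExp_add_smul, lieExp_mul_intCast_smul, mul_assoc]
    have h5 : ∀ n : ℤ, (flow X x (u + n * t) ∈ S → f (u + n * t) = 1) ∧
        (flow X x (u + n * t) ∉ S → f (u + n * t) = 0) := fun n => by
      have := hu n
      constructor <;> intro h6 <;> simp [h6] at this <;> exact this.symm
    have h7 : ∀ n m : ℤ, n ≤ m → u + n * t ≤ u + m * t := fun n m hnm => by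
      have : (n : ℝ) ≤ m := by exact_mod_cast hnm
      gcongr
    rcases hf with hf | hf
    · refine Or.inl fun n m hnm hn => ?_
      rw [h4] at hn ⊢
      by_contra hm
      have := hf (h7 n m hnm)
      rw [(h5 n).1 hn, (h5 m).2 hm] at this
      linarith
    · refine Or.inr fun n m hnm hn => ?_
      rw [h4] at hn ⊢
      by_contra hm
      have := hf (h7 n m hnm)
      rw [(h5 m).1 hn, (h5 n).2 hm] at this
      linarith
  have h3 : ∀ᵐ x ∂μ, ∀ᵐ u : ℝ, x * lieExp (u • X) ∉ N := by
    filter_upwards [h1, h2] with x hx1 hx2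
    filter_upwards [hx1, hx2] with u hu1 hu2 hN
    exact hu1 (subset_toMeasurable _ _ ⟨hN, fun hc => hc hu2⟩)
  -- After the exchange, one time `u` serves almost every `x`; translation by `exp (uX)` preserves
  -- `μ`, so `N` is null.
  rw [Measure.ae_ae_comm (hmeas hNm)] at h3
  obtain ⟨u, hu⟩ := h3.exists
  have h4 : μ N = 0 := by
    rw [← (hX u).measure_preimage hNm.nullMeasurableSet]
    exact measure_eq_zero_iff_ae_notMem.2 hu
  have h5 : μ (P ∪ Q)ᶜ = 0 := measure_mono_null hNsup h4
  filter_upwards [measure_eq_zero_iff_ae_notMem.1 h5] with x hx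
  exact not_not.1 hx

end Fubini

/-! ### Difference quotients of test functions -/

section DifferenceQuotients

variable {E : Type*} [NormedAddCommGroup E] [NormedSpace ℝ E] [FiniteDimensional ℝ E]
  {G : Type*} [TopologicalSpace G] [ChartedSpace E G] [Group G] [LieGroup 𝓘(ℝ, E) ∞ G]
  [T2Space G] [IsTopologicalGroup G]

theorem lieExp_zero : lieExp (0 : GroupLieAlgebra 𝓘(ℝ, E) G) = 1 := by
  simpa using lieExp_zero_smul (0 : GroupLieAlgebra 𝓘(ℝ, E) G)

/-- The points that the flow of `X` moves into `K` at some time in `[0, t]`. -/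
def flowHull (X : GroupLieAlgebra 𝓘(ℝ, E) G) (K : Set G) (t : ℝ) : Set G :=
  (fun p : G × ℝ => p.1 * lieExp ((-p.2) • X)) '' (K ×ˢ Icc 0 t)

theorem continuous_mul_lieExp_neg (X : GroupLieAlgebra 𝓘(ℝ, E) G) :
    Continuous fun p : G × ℝ => p.1 * lieExp ((-p.2) • X) :=
  continuous_fst.mul ((continuous_lieExp_smul X).comp continuous_snd.neg)

theorem continuous_mul_lieExp (X : GroupLieAlgebra 𝓘(ℝ, E) G) :
    Continuous fun p : ℝ × G => p.2 * lieExp (p.1 • X) :=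
  continuous_snd.mul ((continuous_lieExp_smul X).comp continuous_fst)

theorem isCompact_flowHull (X : GroupLieAlgebra 𝓘(ℝ, E) G) {K : Set G} (hK : IsCompact K) (t : ℝ) :
    IsCompact (flowHull X K t) :=
  (hK.prod isCompact_Icc).image (continuous_mul_lieExp_neg X)

theorem notMem_of_notMem_flowHull {X : GroupLieAlgebra 𝓘(ℝ, E) G} {K : Set G} {t s : ℝ} {x : G}
    (hx : x ∉ flowHull X K t) (hs0 : 0 ≤ s) (hst : s ≤ t) : x * lieExp (s • X) ∉ K := fun h =>
  hx ⟨(x * lieExp (s • X), s), ⟨h, hs0, hst⟩, by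
    simp only [lieExp_neg_smul, mul_inv_cancel_right]⟩

theorem subset_flowHull (X : GroupLieAlgebra 𝓘(ℝ, E) G) (K : Set G) {t : ℝ} (ht : 0 ≤ t) :
    K ⊆ flowHull X K t := fun x hx => by
  by_contra h
  have := notMem_of_notMem_flowHull h le_rfl ht
  rw [lieExp_zero_smul, mul_one] at this
  exact this hx

theorem eventually_mul_lieExp_mem (X : GroupLieAlgebra 𝓘(ℝ, E) G) {K Ω : Set G} (hK : IsCompact K)
    (hΩ : IsOpen Ω) (hKΩ : K ⊆ Ω) : ∀ᶠ t : ℝ in 𝓝 0, ∀ x ∈ K, x * lieExp (t • X) ∈ Ω := by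
  refine hK.eventually_forall_of_forall_eventually fun x hx => ?_
  refine (continuous_mul_lieExp X).continuousAt.eventually (hΩ.mem_nhds ?_)
  simpa only [lieExp_zero_smul, mul_one] using hKΩ hx

theorem eventually_flowHull_subset (X : GroupLieAlgebra 𝓘(ℝ, E) G) {K Ω : Set G} (hK : IsCompact K)
    (hΩ : IsOpen Ω) (hKΩ : K ⊆ Ω) : ∀ᶠ t : ℝ in 𝓝 0, flowHull X K t ⊆ Ω := by
  obtain ⟨ε, hε, h⟩ := Metric.eventually_nhds_iff.1 (eventually_mul_lieExp_mem X hK hΩ hKΩ)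
  refine Metric.eventually_nhds_iff.2 ⟨ε, hε, fun t ht => ?_⟩
  rintro _ ⟨⟨x, s⟩, ⟨hx, hs0, hst⟩, rfl⟩
  refine h ?_ x hx
  rw [Real.dist_eq, sub_zero] at ht ⊢
  rw [abs_neg, abs_of_nonneg hs0]
  exact lt_of_le_of_lt hst ((le_abs_self t).trans_lt ht)

theorem hasCompactSupport_lieDeriv {X : GroupLieAlgebra 𝓘(ℝ, E) G} {φ : G → ℝ}
    (hc : HasCompactSupport φ) : HasCompactSupport (lieDeriv X φ) :=
  HasCompactSupport.intro hc fun _ hx => lieDeriv_eq_zero_of_notMem_tsupport hx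

theorem hasDerivAt_mul_lieExp (X : GroupLieAlgebra 𝓘(ℝ, E) G) {φ : G → ℝ}
    (hφ : ContMDiff 𝓘(ℝ, E) 𝓘(ℝ, ℝ) 1 φ) (x : G) (t : ℝ) :
    HasDerivAt (fun t : ℝ => φ (x * lieExp (t • X))) (lieDeriv X φ (x * lieExp (t • X))) t :=
  hasDerivAt_comp_mul_lieExp (hφ.contMDiffAt.mdifferentiableAt (by simp))

theorem exists_abs_sub_le (X : GroupLieAlgebra 𝓘(ℝ, E) G) {φ : G → ℝ}
    (hφ : ContMDiff 𝓘(ℝ, E) 𝓘(ℝ, ℝ) 1 φ) (hc : HasCompactSupport φ) :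
    ∃ C, 0 ≤ C ∧ ∀ (x : G) (t : ℝ), |φ (x * lieExp (t • X)) - φ x| ≤ C * |t| := by
  obtain ⟨C, hC⟩ := (continuous_lieDeriv X hφ).bounded_above_of_compact_support
    (hasCompactSupport_lieDeriv hc)
  refine ⟨C, (norm_nonneg _).trans (hC 1), fun x t => ?_⟩
  have h := Convex.norm_image_sub_le_of_norm_hasDerivWithin_le (s := univ) (x := 0) (y := t)
    (fun s _ => (hasDerivAt_mul_lieExp X hφ x s).hasDerivWithinAt) (fun s _ => hC _)
    convex_univ (mem_univ _) (mem_univ _)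
  simpa [lieExp_zero] using h

theorem sub_eq_zero_of_notMem_flowHull {X : GroupLieAlgebra 𝓘(ℝ, E) G} {φ : G → ℝ} {t s : ℝ} {x : G}
    (hx : x ∉ flowHull X (tsupport φ) t) (hs0 : 0 ≤ s) (hst : s ≤ t) :
    φ (x * lieExp (s • X)) - φ x = 0 := by
  have h1 := notMem_of_notMem_flowHull hx hs0 hst
  have h2 : x ∉ tsupport φ := fun h => hx (subset_flowHull X _ (hs0.trans hst) h)
  rw [image_eq_zero_of_notMem_tsupport h1, image_eq_zero_of_notMem_tsupport h2, sub_zero]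

theorem continuous_comp_mul_lieExp {φ : G → ℝ} (hφ : Continuous φ)
    (X : GroupLieAlgebra 𝓘(ℝ, E) G) (t : ℝ) : Continuous fun x => φ (x * lieExp (t • X)) :=
  hφ.comp (continuous_mul_const _)

variable [MeasurableSpace G] [BorelSpace G] {μ : Measure G} [IsFiniteMeasureOnCompacts μ]

theorem exists_integral_abs_sub_le (X : GroupLieAlgebra 𝓘(ℝ, E) G) {φ : G → ℝ}
    (hφ : ContMDiff 𝓘(ℝ, E) 𝓘(ℝ, ℝ) 1 φ) (hc : HasCompactSupport φ) :
    ∃ C, 0 ≤ C ∧ ∀ t, 0 ≤ t → t ≤ 1 →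
      ∫ x, |φ (x * lieExp (t • X)) - φ x| ∂μ ≤ C * t := by
  obtain ⟨C, hC0, hC⟩ := exists_abs_sub_le X hφ hc
  set K := flowHull X (tsupport φ) 1
  have hK : IsCompact K := isCompact_flowHull X hc 1
  refine ⟨C * μ.real K, by positivity, fun t ht0 ht1 => ?_⟩
  have h1 : ∀ x, |φ (x * lieExp (t • X)) - φ x| ≤ K.indicator (fun _ => C * t) x := by
    intro x
    by_cases hx : x ∈ K
    · rw [indicator_of_mem hx]
      exact (hC x t).trans (by rw [abs_of_nonneg ht0])
    · rw [indicator_of_notMem hx, sub_eq_zero_of_notMem_flowHull hx ht0 ht1, abs_zero]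
  calc ∫ x, |φ (x * lieExp (t • X)) - φ x| ∂μ ≤ ∫ x, K.indicator (fun _ => C * t) x ∂μ := by
        refine integral_mono_of_nonneg (Filter.Eventually.of_forall fun x => abs_nonneg _) ?_
          (Filter.Eventually.of_forall h1)
        exact (integrable_indicator_iff hK.measurableSet).2
          (integrableOn_const hK.measure_lt_top.ne)
    _ = C * μ.real K * t := by
        rw [integral_indicator hK.measurableSet, setIntegral_const, smul_eq_mul]; ring

theorem tendsto_integral_sub_div (X : GroupLieAlgebra 𝓘(ℝ, E) G) {φ : G → ℝ}
    (hφ : ContMDiff 𝓘(ℝ, E) 𝓘(ℝ, ℝ) 1 φ) (hc : HasCompactSupport φ) (T : Set G) :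
    Filter.Tendsto (fun t : ℝ => t⁻¹ * ∫ x in T, (φ (x * lieExp (t • X)) - φ x) ∂μ)
      (𝓝[>] 0) (𝓝 (∫ x in T, lieDeriv X φ x ∂μ)) := by
  obtain ⟨C, hC0, hC⟩ := exists_abs_sub_le X hφ hc
  set K := flowHull X (tsupport φ) 1
  have hK : IsCompact K := isCompact_flowHull X hc 1
  simp_rw [← integral_const_mul]
  -- The Lipschitz constant along the flow dominates, on a compact set that contains the supports
  -- for all `t ≤ 1`.
  refine tendsto_integral_filter_of_dominated_convergence (K.indicator fun _ => C) ?_ ?_ ?_ ?_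
  · refine Filter.Eventually.of_forall fun t => ?_
    exact (continuous_const.mul ((continuous_comp_mul_lieExp hφ.continuous X t).sub
      hφ.continuous)).aestronglyMeasurable
  · filter_upwards [Ioc_mem_nhdsGT (zero_lt_one (α := ℝ))] with t ht
    refine Filter.Eventually.of_forall fun x => ?_
    by_cases hx : x ∈ K
    · rw [indicator_of_mem hx, norm_mul, norm_inv, Real.norm_of_nonneg ht.1.le,
        inv_mul_le_iff₀ ht.1, mul_comm]
      exact (hC x t).trans (by rw [abs_of_nonneg ht.1.le])
    · rw [indicator_of_notMem hx, sub_eq_zero_of_notMem_flowHull hx ht.1.le ht.2]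
      simp
  · exact (((integrable_indicator_iff hK.measurableSet).2
      (integrableOn_const hK.measure_lt_top.ne))).integrableOn
  · refine Filter.Eventually.of_forall fun x => ?_
    have h := (hasDerivAt_zero_comp_mul_lieExp (X := X) (x := x)
      (hφ.contMDiffAt.mdifferentiableAt (by simp))).tendsto_slope_zero_right
    simpa [lieExp_zero] using h

/-- The difference quotient is the time average of `Xφ` along the flow, replaced here by a Riemann
sum. A finite sum is convenient because it is the derivative of a finite average of translates of
`φ`, which is plainly `C¹`. -/
theorem exists_abs_slope_sub_average_le (X : GroupLieAlgebra 𝓘(ℝ, E) G) {φ : G → ℝ}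
    (hφ : ContMDiff 𝓘(ℝ, E) 𝓘(ℝ, ℝ) 1 φ) (hc : HasCompactSupport φ) {t : ℝ} (ht : 0 < t)
    {δ : ℝ} (hδ : 0 < δ) : ∃ N : ℕ, 0 < N ∧ ∀ x, |t⁻¹ * (φ (x * lieExp (t • X)) - φ x) -
      (N : ℝ)⁻¹ * ∑ k ∈ Finset.range N, lieDeriv X φ (x * lieExp ((k * (t / N)) • X))| ≤ δ := by
  have hcont := continuous_lieDeriv X hφ
  set K := flowHull X (tsupport φ) 1
  have hK : IsCompact K := isCompact_flowHull X hc 1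
  have h1 : ∀ᶠ s : ℝ in 𝓝 0, ∀ x ∈ K, |lieDeriv X φ (x * lieExp (s • X)) - lieDeriv X φ x| < δ := by
    refine hK.eventually_forall_of_forall_eventually fun x hx => ?_
    have h2 : Continuous fun p : ℝ × G =>
        |lieDeriv X φ (p.2 * lieExp (p.1 • X)) - lieDeriv X φ p.2| :=
      ((hcont.comp (continuous_mul_lieExp X)).sub (hcont.comp continuous_snd)).abs
    refine h2.continuousAt.eventually_lt continuousAt_const ?_
    simp only [lieExp_zero_smul, mul_one, sub_self, abs_zero, hδ]
  obtain ⟨ε, hε, h⟩ := Metric.eventually_nhds_iff.1 h1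
  obtain ⟨N, hN⟩ := exists_nat_gt (max (t / ε) t)
  have hN0 : (0 : ℝ) < N := ht.trans ((le_max_right _ _).trans_lt hN)
  have hNε : t / N < ε := by
    rw [div_lt_iff₀ hN0, mul_comm, ← div_lt_iff₀ hε]; exact (le_max_left _ _).trans_lt hN
  have hN1 : t / N ≤ 1 := by
    rw [div_le_one hN0]; exact ((le_max_right _ _).trans_lt hN).le
  have htN : 0 < t / N := by positivity
  have h2 : ∀ s, 0 ≤ s → s ≤ t / N → ∀ x,
      |lieDeriv X φ (x * lieExp (s • X)) - lieDeriv X φ x| ≤ δ := by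
    intro s hs0 hs x
    by_cases hx : x ∈ K
    · refine (h ?_ x hx).le
      rw [Real.dist_eq, sub_zero, abs_of_nonneg hs0]; linarith
    · have h3 := notMem_of_notMem_flowHull hx hs0 (hs.trans hN1)
      have h4 : x ∉ tsupport φ := fun h => hx (subset_flowHull X _ zero_le_one h)
      rw [lieDeriv_eq_zero_of_notMem_tsupport h3, lieDeriv_eq_zero_of_notMem_tsupport h4]
      simpa using hδ.le
  have h3 : ∀ y, |φ (y * lieExp ((t / N) • X)) - φ y - t / N * lieDeriv X φ y| ≤ t / N * δ := by
    intro y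
    obtain ⟨s, hs, hs'⟩ := exists_hasDerivAt_eq_slope _ _ htN
      (fun s _ => (hasDerivAt_mul_lieExp X hφ y s).continuousAt.continuousWithinAt)
      (fun s _ => hasDerivAt_mul_lieExp X hφ y s)
    rw [eq_div_iff (by linarith), sub_zero, lieExp_zero_smul, mul_one] at hs'
    rw [← hs', mul_comm, ← mul_sub, abs_mul, abs_of_pos htN]
    gcongr
    exact h2 s hs.1.le hs.2.le y
  refine ⟨N, by exact_mod_cast hN0, fun x => ?_⟩
  have h4 : φ (x * lieExp (t • X)) - φ x = ∑ k ∈ Finset.range N,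
      (φ (x * lieExp ((k * (t / N)) • X) * lieExp ((t / N) • X)) -
        φ (x * lieExp ((k * (t / N)) • X))) := by
    have h5 := Finset.sum_range_sub (fun k : ℕ => φ (x * lieExp ((k * (t / N)) • X))) N
    rw [mul_div_cancel₀ _ hN0.ne', Nat.cast_zero, zero_mul, lieExp_zero_smul, mul_one] at h5
    rw [← h5]
    refine Finset.sum_congr rfl fun k _ => ?_
    rw [mul_assoc, ← lieExp_add_smul]
    push_cast
    rw [add_mul, one_mul]
  have h5 : t⁻¹ * (φ (x * lieExp (t • X)) - φ x) -
      (N : ℝ)⁻¹ * ∑ k ∈ Finset.range N, lieDeriv X φ (x * lieExp ((k * (t / N)) • X)) =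
      t⁻¹ * ∑ k ∈ Finset.range N, (φ (x * lieExp ((k * (t / N)) • X) * lieExp ((t / N) • X)) -
        φ (x * lieExp ((k * (t / N)) • X)) -
        t / N * lieDeriv X φ (x * lieExp ((k * (t / N)) • X))) := by
    rw [Finset.sum_sub_distrib, ← h4, ← Finset.mul_sum]
    generalize ∑ k ∈ Finset.range N, lieDeriv X φ (x * lieExp ((k * (t / N)) • X)) = A
    have : t⁻¹ * (t / N) = (N : ℝ)⁻¹ := by field_simp
    linear_combination A * this
  rw [h5, abs_mul, abs_of_pos (inv_pos.2 ht), inv_mul_le_iff₀ ht]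
  calc _ ≤ ∑ k ∈ Finset.range N, t / N * δ :=
        (Finset.abs_sum_le_sum_abs _ _).trans (Finset.sum_le_sum fun k _ => h3 _)
    _ = t * δ := by
        rw [Finset.sum_const, Finset.card_range, nsmul_eq_mul]; field_simp

end DifferenceQuotients

/-! ### Vague limits of measures -/

section VagueLimit

open CompactlySupported CompactlySupportedContinuousMap in
/-- Vague compactness along an ultrafilter. -/
theorem exists_measure_tendsto_integral {G : Type*} [TopologicalSpace G] [T2Space G]
    [LocallyCompactSpace G] [MeasurableSpace G] [BorelSpace G] {ι : Type*} (U : Ultrafilter ι)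
    (m : ι → Measure G) [∀ i, IsFiniteMeasureOnCompacts (m i)]
    (hm : ∀ K : Set G, IsCompact K → ∃ C : ℝ, ∀ᶠ i in (U : Filter ι), (m i).real K ≤ C) :
    ∃ ν : Measure G, ν.Regular ∧ ∀ f : G → ℝ, Continuous f → HasCompactSupport f →
      Filter.Tendsto (fun i => ∫ x, f x ∂(m i)) U (𝓝 (∫ x, f x ∂ν)) := by
  have hint : ∀ (f : C_c(G, ℝ)) i, Integrable f (m i) := fun f i =>
    f.continuous.integrable_of_hasCompactSupport f.hasCompactSupport
  have hlim : ∀ f : C_c(G, ℝ), ∃ L, Filter.Tendsto (fun i => ∫ x, f x ∂(m i)) U (𝓝 L) := by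
    intro f
    obtain ⟨M, hM⟩ := f.continuous.bounded_above_of_compact_support f.hasCompactSupport
    have hM0 : 0 ≤ M ∨ IsEmpty G := by
      rcases isEmpty_or_nonempty G with h | ⟨⟨x⟩⟩
      · exact Or.inr h
      · exact Or.inl ((norm_nonneg _).trans (hM x))
    rcases hM0 with hM0 | hG
    · obtain ⟨C, hC⟩ := hm (tsupport f) f.hasCompactSupport
      have h1 : ∀ᶠ i in (U : Filter ι), ∫ x, f x ∂(m i) ∈ Icc (-(M * C)) (M * C) := by
        filter_upwards [hC] with i hi
        rw [mem_Icc, ← abs_le, ← Real.norm_eq_abs]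
        have h2 : ∫ x, f x ∂(m i) = ∫ x in tsupport f, f x ∂(m i) :=
          (setIntegral_eq_integral_of_forall_compl_eq_zero fun x hx =>
            image_eq_zero_of_notMem_tsupport hx).symm
        rw [h2]
        refine (norm_setIntegral_le_of_norm_le_const f.hasCompactSupport.measure_lt_top
          fun x _ => hM x).trans ?_
        gcongr
      -- An ultrafilter gives limits for all test functions at once, so no diagonal subsequence is
      -- needed.
      obtain ⟨L, -, hL⟩ := isCompact_Icc.ultrafilter_le_nhds (U.map fun i => ∫ x, f x ∂(m i))
        (Filter.le_principal_iff.2 h1)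
      exact ⟨L, hL⟩
    · exact ⟨0, by simp [integral_of_isEmpty]⟩
  choose Λ hΛ using hlim
  let Λ' : C_c(G, ℝ) →ₚ[ℝ] ℝ := PositiveLinearMap.mk₀
    { toFun := Λ
      map_add' := fun f g => tendsto_nhds_unique (hΛ (f + g)) (by
        have := (hΛ f).add (hΛ g)
        refine this.congr fun i => ?_
        rw [← integral_add (hint f i) (hint g i)]
        rfl)
      map_smul' := fun c f => tendsto_nhds_unique (hΛ (c • f)) (by
        have := (hΛ f).const_mul c
        refine this.congr fun i => ?_
        rw [← integral_const_mul]
        rfl) }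
    (fun f hf => ge_of_tendsto' (hΛ f) fun i => integral_nonneg hf)
  refine ⟨RealRMK.rieszMeasure Λ', inferInstance, fun f hf hfc => ?_⟩
  have h := RealRMK.integral_rieszMeasure Λ' ⟨⟨f, hf⟩, hfc⟩
  have h2 := hΛ ⟨⟨f, hf⟩, hfc⟩
  rw [show Λ ⟨⟨f, hf⟩, hfc⟩ = ∫ x, f x ∂(RealRMK.rieszMeasure Λ') from h.symm] at h2
  exact h2

end VagueLimit

/-! ### Vague limits of densities -/

section SignedVagueLimit

variable {G : Type*} [TopologicalSpace G] [T2Space G] [LocallyCompactSpace G] [MeasurableSpace G]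
  [BorelSpace G] {μ : Measure G} [IsFiniteMeasureOnCompacts μ]

theorem exists_measure_tendsto_integral_mul {ι : Type*} (U : Ultrafilter ι) (w : ι → G → ℝ)
    (hw : ∀ i, AEStronglyMeasurable (w i) μ) (hw0 : ∀ i x, 0 ≤ w i x)
    (hb : ∀ i, ∃ c : ℝ, ∀ x, w i x ≤ c)
    (hK : ∀ K : Set G, IsCompact K → ∃ C : ℝ, ∀ᶠ i in (U : Filter ι), ∫ x in K, w i x ∂μ ≤ C) :
    ∃ ν : Measure G, ν.Regular ∧ ∀ f : G → ℝ, Continuous f → HasCompactSupport f →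
      Filter.Tendsto (fun i => ∫ x, w i x * f x ∂μ) U (𝓝 (∫ x, f x ∂ν)) := by
  have hint : ∀ i (K : Set G), IsCompact K → IntegrableOn (w i) K μ := by
    intro i K hK
    obtain ⟨c, hc⟩ := hb i
    refine Measure.integrableOn_of_bounded (M := c) hK.measure_lt_top.ne (hw i) ?_
    exact Filter.Eventually.of_forall fun x => by
      rw [Real.norm_of_nonneg (hw0 i x)]; exact hc x
  have hm : ∀ i (K : Set G), IsCompact K →
      μ.withDensity (fun x => ENNReal.ofReal (w i x)) K = ENNReal.ofReal (∫ x in K, w i x ∂μ) := by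
    intro i K hK
    rw [withDensity_apply _ hK.measurableSet, ofReal_integral_eq_lintegral_ofReal (hint i K hK)
      (Filter.Eventually.of_forall (hw0 i))]
  have hfin : ∀ i, IsFiniteMeasureOnCompacts (μ.withDensity fun x => ENNReal.ofReal (w i x)) :=
    fun i => ⟨fun K hK => by rw [hm i K hK]; exact ENNReal.ofReal_lt_top⟩
  obtain ⟨ν, hν, h⟩ := exists_measure_tendsto_integral U
    (fun i => μ.withDensity fun x => ENNReal.ofReal (w i x)) (by
      intro K hKc
      obtain ⟨C, hC⟩ := hK K hKc
      refine ⟨C, hC.mono fun i hi => ?_⟩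
      rw [measureReal_def, hm i K hKc, ENNReal.toReal_ofReal (integral_nonneg (hw0 i))]
      exact hi)
  refine ⟨ν, hν, fun f hf hfc => (h f hf hfc).congr fun i => ?_⟩
  rw [integral_withDensity_eq_integral_toReal_smul₀ (hw i).aemeasurable.ennreal_ofReal
    (Filter.Eventually.of_forall fun x => ENNReal.ofReal_lt_top)]
  simp only [ENNReal.toReal_ofReal (hw0 i _), smul_eq_mul]

/-- The positive and negative parts are both dominated by `|w|`, so each has its own vague limit. -/
theorem exists_measure_sub_tendsto_integral_mul {ι : Type*} (U : Ultrafilter ι) (w : ι → G → ℝ)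
    (hw : ∀ i, AEStronglyMeasurable (w i) μ) (hb : ∀ i, ∃ c : ℝ, ∀ x, |w i x| ≤ c)
    (hK : ∀ K : Set G, IsCompact K → ∃ C : ℝ, ∀ᶠ i in (U : Filter ι), ∫ x in K, |w i x| ∂μ ≤ C) :
    ∃ ν₁ ν₂ : Measure G, ν₁.Regular ∧ ν₂.Regular ∧
      ∀ f : G → ℝ, Continuous f → HasCompactSupport f →
        Filter.Tendsto (fun i => ∫ x, w i x * f x ∂μ) U (𝓝 (∫ x, f x ∂ν₁ - ∫ x, f x ∂ν₂)) := by
  have key : ∀ v : ι → G → ℝ, (∀ i, AEStronglyMeasurable (v i) μ) → (∀ i x, 0 ≤ v i x) →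
      (∀ i x, v i x ≤ |w i x|) → ∃ ν : Measure G, ν.Regular ∧ ∀ f : G → ℝ, Continuous f →
        HasCompactSupport f →
        Filter.Tendsto (fun i => ∫ x, v i x * f x ∂μ) U (𝓝 (∫ x, f x ∂ν)) := by
    intro v hv hv0 hvw
    refine exists_measure_tendsto_integral_mul U v hv hv0
      (fun i => (hb i).imp fun c hc x => (hvw i x).trans (hc x)) fun K hKc => ?_
    obtain ⟨C, hC⟩ := hK K hKc
    refine ⟨C, hC.mono fun i hi => le_trans ?_ hi⟩
    obtain ⟨c, hc⟩ := hb i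
    refine integral_mono_of_nonneg (Filter.Eventually.of_forall (hv0 i)) ?_
      (Filter.Eventually.of_forall (hvw i))
    exact (Measure.integrableOn_of_bounded (M := c) hKc.measure_lt_top.ne (hw i)
      (Filter.Eventually.of_forall (hc))).abs
  obtain ⟨ν₁, hν₁, h1⟩ := key (fun i x => max (w i x) 0)
    (fun i => (hw i).sup aestronglyMeasurable_const) (fun i x => le_max_right _ _)
    (fun i x => max_le (le_abs_self _) (abs_nonneg _))
  obtain ⟨ν₂, hν₂, h2⟩ := key (fun i x => max (-w i x) 0)
    (fun i => (hw i).neg.sup aestronglyMeasurable_const) (fun i x => le_max_right _ _)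
    (fun i x => max_le (neg_le_abs _) (abs_nonneg _))
  refine ⟨ν₁, ν₂, hν₁, hν₂, fun f hf hfc => ((h1 f hf hfc).sub (h2 f hf hfc)).congr fun i => ?_⟩
  obtain ⟨c, hc⟩ := hb i
  have hi : ∀ v : G → ℝ, AEStronglyMeasurable v μ → (∀ x, |v x| ≤ |w i x|) →
      Integrable (fun x => v x * f x) μ := fun v hv hvc =>
    (hf.integrable_of_hasCompactSupport hfc).bdd_mul hv
      (Filter.Eventually.of_forall fun x => (hvc x).trans (hc x))
  rw [← integral_sub]
  · refine integral_congr_ae (Filter.Eventually.of_forall fun x => ?_)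
    simp only [← sub_mul, max_zero_sub_max_neg_zero_eq_self]
  · refine hi _ ((hw i).sup aestronglyMeasurable_const) fun x => ?_
    rw [abs_of_nonneg (le_max_right _ _)]
    exact max_le (le_abs_self _) (abs_nonneg _)
  · refine hi _ ((hw i).neg.sup aestronglyMeasurable_const) fun x => ?_
    rw [abs_of_nonneg (le_max_right _ _)]
    exact max_le (neg_le_abs _) (abs_nonneg _)

end SignedVagueLimit

/-! ### Radon derivatives -/

section Radon

variable {E : Type*} [NormedAddCommGroup E] [NormedSpace ℝ E] [FiniteDimensional ℝ E]
  {G : Type*} [TopologicalSpace G] [ChartedSpace E G] [Group G] [LieGroup 𝓘(ℝ, E) ∞ G]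
  [T2Space G] [IsTopologicalGroup G] [SecondCountableTopology G] [LocallyCompactSpace G]

variable (E) in
theorem exists_contMDiff_cutoff {K U : Set G} (hK : IsCompact K) (hU : IsOpen U) (hKU : K ⊆ U) :
    ∃ η : G → ℝ, ContMDiff 𝓘(ℝ, E) 𝓘(ℝ, ℝ) 1 η ∧ HasCompactSupport η ∧ tsupport η ⊆ U ∧
      (∀ᶠ x in 𝓝ˢ K, η x = 1) ∧ ∀ x, η x ∈ Icc 0 1 := by
  obtain ⟨L, hL, hKL, hLU⟩ := exists_compact_between hK hU hKU
  obtain ⟨f, hf1, hf0, hf⟩ := exists_contMDiffMap_one_nhds_of_subset_interior 𝓘(ℝ, E) (n := 1)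
    hK.isClosed hKL
  have hsupp : tsupport f ⊆ L := closure_minimal (fun x hx => by
    by_contra h; exact hx (hf0 x h)) hL.isClosed
  exact ⟨f, f.contMDiff, hL.of_isClosed_subset (isClosed_tsupport _) hsupp, hsupp.trans hLU,
    hf1, hf⟩

variable [MeasurableSpace G] [BorelSpace G]

/-- The distribution `X 𝟙_S` is a signed Radon measure, tested with `C¹` functions. -/
def HasRadonDerivative (μ : Measure G) (X : GroupLieAlgebra 𝓘(ℝ, E) G) (S : Set G) : Prop :=
  ∃ ν₁ ν₂ : Measure G, ν₁.Regular ∧ ν₂.Regular ∧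
    ∀ φ : G → ℝ, ContMDiff 𝓘(ℝ, E) 𝓘(ℝ, ℝ) 1 φ → HasCompactSupport φ →
      -∫ x in S, lieDeriv X φ x ∂μ = ∫ x, φ x ∂ν₁ - ∫ x, φ x ∂ν₂

variable {μ : Measure G} [IsFiniteMeasureOnCompacts μ] {S : Set G}
  {X Y : GroupLieAlgebra 𝓘(ℝ, E) G}

theorem HasRadonDerivative.isRadonDerivative (h : HasRadonDerivative μ X S) :
    IsRadonDerivative μ X S := by
  obtain ⟨ν₁, ν₂, h1, h2, h⟩ := h
  exact ⟨ν₁, ν₂, h1, h2, fun φ hφ hc => h φ (hφ.of_le (by simp)) hc⟩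

theorem integrable_lieDeriv (X : GroupLieAlgebra 𝓘(ℝ, E) G) {φ : G → ℝ}
    (hφ : ContMDiff 𝓘(ℝ, E) 𝓘(ℝ, ℝ) 1 φ) (hc : HasCompactSupport φ) :
    Integrable (lieDeriv X φ) μ :=
  (continuous_lieDeriv X hφ).integrable_of_hasCompactSupport (hasCompactSupport_lieDeriv hc)

theorem hasRadonDerivative_zero (μ : Measure G) (S : Set G) :
    HasRadonDerivative μ (0 : GroupLieAlgebra 𝓘(ℝ, E) G) S := by
  refine ⟨0, 0, inferInstance, inferInstance, fun φ hφ hc => ?_⟩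
  have : ∀ x, lieDeriv (0 : GroupLieAlgebra 𝓘(ℝ, E) G) φ x = 0 := fun x => by
    have := lieDeriv_smul_left (0 : ℝ) (0 : GroupLieAlgebra 𝓘(ℝ, E) G) φ x
    simpa using this
  simp [this]

theorem regular_add (ν₁ ν₂ : Measure G) [ν₁.Regular] [ν₂.Regular] : (ν₁ + ν₂).Regular := by
  have := TopologicalSpace.metrizableSpace_of_t3_secondCountable G
  have : IsFiniteMeasureOnCompacts (ν₁ + ν₂) := ⟨fun K hK => by
    rw [Measure.add_apply]
    exact ENNReal.add_lt_top.2 ⟨hK.measure_lt_top, hK.measure_lt_top⟩⟩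
  infer_instance

theorem HasRadonDerivative.add (hX : HasRadonDerivative μ X S) (hY : HasRadonDerivative μ Y S) :
    HasRadonDerivative μ (X + Y) S := by
  obtain ⟨ν₁, ν₂, h1, h2, h⟩ := hX
  obtain ⟨ν₃, ν₄, h3, h4, h'⟩ := hY
  refine ⟨ν₁ + ν₃, ν₂ + ν₄, regular_add ν₁ ν₃, regular_add ν₂ ν₄, fun φ hφ hc => ?_⟩
  have hi : ∀ (ν : Measure G) [IsFiniteMeasureOnCompacts ν], Integrable φ ν := fun ν _ =>
    hφ.continuous.integrable_of_hasCompactSupport hc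
  simp only [lieDeriv_add_left]
  rw [integral_add (integrable_lieDeriv X hφ hc).integrableOn
    (integrable_lieDeriv Y hφ hc).integrableOn, integral_add_measure (hi _) (hi _),
    integral_add_measure (hi _) (hi _)]
  linear_combination h φ hφ hc + h' φ hφ hc

theorem HasRadonDerivative.smul (hX : HasRadonDerivative μ X S) (c : ℝ) :
    HasRadonDerivative μ (c • X) S := by
  have key : ∀ {X : GroupLieAlgebra 𝓘(ℝ, E) G} (c : NNReal), HasRadonDerivative μ X S →
      HasRadonDerivative μ ((c : ℝ) • X) S := by
    intro X c hX
    obtain ⟨ν₁, ν₂, h1, h2, h⟩ := hX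
    refine ⟨c • ν₁, c • ν₂, inferInstance, inferInstance, fun φ hφ hc => ?_⟩
    simp only [lieDeriv_smul_left, integral_const_mul, integral_smul_nnreal_measure, NNReal.smul_def,
      smul_eq_mul]
    linear_combination (c : ℝ) * h φ hφ hc
  have hneg : HasRadonDerivative μ (-X) S := by
    obtain ⟨ν₁, ν₂, h1, h2, h⟩ := hX
    refine ⟨ν₂, ν₁, h2, h1, fun φ hφ hc => ?_⟩
    rw [← neg_one_smul ℝ X]
    simp only [lieDeriv_smul_left, integral_const_mul]
    linear_combination -h φ hφ hc
  rcases le_total 0 c with hc | hc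
  · exact key ⟨c, hc⟩ hX
  · have : HasRadonDerivative μ (-c • -X) S := key ⟨-c, neg_nonneg.2 hc⟩ hneg
    rwa [smul_neg, neg_smul, neg_neg] at this

/-- Calibration against a cutoff that equals `1` on `K` bounds the difference quotients of `𝟙_S` in
`L¹(K)`, uniformly for small `t`. A vague limit then represents the distribution. -/
theorem IsMonotoneDirection.hasRadonDerivative [SFinite μ]
    (hS : NullMeasurableSet S μ) (h : IsMonotoneDirection μ X S)
    (hX : ∀ t : ℝ, MeasurePreserving (fun x : G => x * lieExp (t • X)) μ μ) :
    HasRadonDerivative μ X S := by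
  set U : Ultrafilter ℝ := Ultrafilter.of (𝓝[>] 0) with hU
  have hUle : (U : Filter ℝ) ≤ 𝓝[>] 0 := Ultrafilter.of_le _
  obtain ⟨ν₁, ν₂, h1, h2, hν⟩ := exists_measure_sub_tendsto_integral_mul (μ := μ) U
    (fun t x => t⁻¹ * translateDiff S (lieExp (t • X)) x)
    (fun t => (aestronglyMeasurable_translateDiff hS (hX t)).const_mul _)
    (fun t => ⟨|t⁻¹|, fun x => by
      rw [abs_mul]
      exact mul_le_of_le_one_right (abs_nonneg _) (abs_translateDiff_le_one _ _ _)⟩) (by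
    intro K hK
    obtain ⟨η, hη, hηc, -, hη1, hη01⟩ := exists_contMDiff_cutoff E hK isOpen_univ (subset_univ K)
    obtain ⟨C, hC0, hC⟩ := exists_integral_abs_sub_le (μ := μ) X hη hηc
    have hηi : Integrable η μ := hη.continuous.integrable_of_hasCompactSupport hηc
    refine ⟨C, Filter.Eventually.filter_mono hUle ?_⟩
    filter_upwards [Ioc_mem_nhdsGT (zero_lt_one (α := ℝ))] with t ht
    have h3 := ((h.isMonotoneAlong hS hX ht.1.le).integral_abs_translateDiff_le_integral_abs_sub
      hS (hX t) hηi).trans (hC t ht.1.le ht.2)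
    have h4 := integrable_abs_translateDiff_mul hS (hX t) hηi
    have h5 : ∀ x, 0 ≤ |translateDiff S (lieExp (t • X)) x| * η x := fun x =>
      mul_nonneg (abs_nonneg _) (hη01 x).1
    simp only [abs_mul, integral_const_mul, abs_inv, abs_of_pos ht.1]
    rw [inv_mul_le_iff₀ ht.1, mul_comm]
    refine le_trans ?_ h3
    refine le_trans (le_of_eq ?_) (setIntegral_le_integral (s := K) h4
      (Filter.Eventually.of_forall h5))
    refine setIntegral_congr_fun hK.measurableSet fun x hx => ?_
    simp only [hη1.self_of_nhdsSet x hx, mul_one])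
  -- The quotients converge to `∫_S Xφ`, the negative of the distribution, so the two measures
  -- change places.
  refine ⟨ν₂, ν₁, h2, h1, fun φ hφ hc => ?_⟩
  have hφi : Integrable φ μ := hφ.continuous.integrable_of_hasCompactSupport hc
  have h3 := hν φ hφ.continuous hc
  have h4 := (tendsto_integral_sub_div (μ := μ) X hφ hc S).mono_left hUle
  have h5 := tendsto_nhds_unique (h3.congr fun t => by
    simp only [mul_assoc, integral_const_mul]
    rw [integral_translateDiff_mul hS (hX t) hφi]) h4
  linarith

/-- Used to discard uniformly small errors in a test field without any control of their derivatives.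
-/
theorem HasRadonDerivative.exists_abs_integral_le (h : HasRadonDerivative μ X S) {K : Set G}
    (hK : IsCompact K) : ∃ C, 0 ≤ C ∧ ∀ (φ : G → ℝ) (δ : ℝ), ContMDiff 𝓘(ℝ, E) 𝓘(ℝ, ℝ) 1 φ →
      tsupport φ ⊆ K → (∀ x, |φ x| ≤ δ) → |∫ x in S, lieDeriv X φ x ∂μ| ≤ C * δ := by
  obtain ⟨ν₁, ν₂, h1, h2, h⟩ := h
  refine ⟨ν₁.real K + ν₂.real K, by positivity, fun φ δ hφ hφK hδ => ?_⟩
  have hc : HasCompactSupport φ := hK.of_isClosed_subset (isClosed_tsupport _) hφK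
  have h3 := h φ hφ hc
  have h4 : ∀ (ν : Measure G) [IsFiniteMeasureOnCompacts ν], |∫ x, φ x ∂ν| ≤ δ * ν.real K := by
    intro ν _
    rw [← setIntegral_eq_integral_of_forall_compl_eq_zero (s := K) fun x hx =>
      image_eq_zero_of_notMem_tsupport fun hx' => hx (hφK hx')]
    exact norm_setIntegral_le_of_norm_le_const (f := φ) hK.measure_lt_top fun x _ => hδ x
  have h5 := h4 ν₁
  have h6 := h4 ν₂
  rw [← abs_neg, h3]
  calc _ ≤ |∫ x, φ x ∂ν₁| + |∫ x, φ x ∂ν₂| := abs_sub _ _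
    _ ≤ _ := by linarith

/-- The admissible coefficients form a linear subspace, which is closed in finite dimension, so a
dense set of them suffices. -/
theorem hasRadonDerivative_of_dense {ι : Type*} [Fintype ι] (b : ι → GroupLieAlgebra 𝓘(ℝ, E) G)
    {D : Set (ι → ℝ)} (hD : Dense D) (h : ∀ c ∈ D, HasRadonDerivative μ (∑ i, c i • b i) S)
    (c : ι → ℝ) : HasRadonDerivative μ (∑ i, c i • b i) S := by
  let W : Submodule ℝ (ι → ℝ) :=
    { carrier := {c | HasRadonDerivative μ (∑ i, c i • b i) S}
      add_mem' := fun {c d} hc hd => by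
        simpa [add_smul, Finset.sum_add_distrib] using! hc.add hd
      zero_mem' := by simpa using! hasRadonDerivative_zero μ S
      smul_mem' := fun a c hc => by
        simpa [Finset.smul_sum, mul_smul] using! hc.smul a }
  have hW : IsClosed (W : Set (ι → ℝ)) := W.closed_of_finiteDimensional
  have : closure D ⊆ W := closure_minimal h hW
  exact this (hD c)

end Radon

/-! ### Almost every direction is good -/

section Directions

variable {E : Type*} [NormedAddCommGroup E] [NormedSpace ℝ E] [FiniteDimensional ℝ E]
  {G : Type*} [TopologicalSpace G] [ChartedSpace E G] [Group G] [LieGroup 𝓘(ℝ, E) ∞ G]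
  [MeasurableSpace G] {μ : Measure G} [SFinite μ] {S : Set G}

theorem IsMonotoneSet.ae_isMonotoneDirection {V : Submodule ℝ (GroupLieAlgebra 𝓘(ℝ, E) G)}
    (hS : IsMonotoneSet μ V S) : ∀ᵐ c : Fin (Module.finrank ℝ V) → ℝ,
      IsMonotoneDirection μ ((∑ i, c i • Module.finBasis ℝ V i : V) : GroupLieAlgebra 𝓘(ℝ, E) G)
        S := by
  have h := Measure.ae_ae_of_ae_prod (measure_eq_zero_iff_ae_notMem.1 hS.2)
  filter_upwards [h] with c hc
  -- The zero vector defines no line, but its flow is stationary, so monotonicity is trivial.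
  by_cases h0 : (∑ i, c i • Module.finBasis ℝ V i : V) = 0
  · refine Filter.Eventually.of_forall fun x => ?_
    refine ⟨fun _ => S.indicator (1 : G → ℝ) (flow (0 : GroupLieAlgebra 𝓘(ℝ, E) G) x 0), Or.inl monotone_const, ?_⟩
    refine Filter.Eventually.of_forall fun t => ?_
    simp only [h0, flow, Submodule.coe_zero, smul_zero]
  · filter_upwards [hc] with x hx
    by_contra hcon
    exact hx ⟨⟨_, h0⟩, rfl, fun hm => hcon (hm ⟨_, h0⟩ x rfl)⟩

end Directions

/-! ### Finite frames approximating the Euclidean norm -/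

section Frames

variable {F : Type*} [NormedAddCommGroup F] [InnerProductSpace ℝ F] [FiniteDimensional ℝ F]

/-- The function `ν ↦ |⟨x, ν⟩|` on the unit sphere. -/
def absInner (x : F) : C(Metric.sphere (0 : F) 1, ℝ) :=
  ⟨fun ν => |inner ℝ x (ν : F)|, by fun_prop⟩

theorem continuous_absInner : Continuous (absInner : F → C(Metric.sphere (0 : F) 1, ℝ)) := by
  refine ContinuousMap.continuous_of_continuous_uncurry _ ?_
  change Continuous fun p : F × Metric.sphere (0 : F) 1 => |inner ℝ p.1 (p.2 : F)|
  fun_prop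

theorem smul_absInner {a : ℝ} (ha : 0 ≤ a) (x : F) : a • absInner x = absInner (a • x) := by
  ext ν
  simp [absInner, inner_smul_left, abs_mul, abs_of_nonneg ha]

section Integrals

variable [MeasurableSpace F] [BorelSpace F]

theorem setIntegral_ball_abs_inner_eq {ν ν' : F} (h : ‖ν‖ = ‖ν'‖) :
    ∫ x in Metric.ball (0 : F) 1, |inner ℝ x ν| = ∫ x in Metric.ball (0 : F) 1, |inner ℝ x ν'| := by
  set R : F ≃ₗᵢ[ℝ] F := (Submodule.span ℝ {ν - ν'})ᗮ.reflection
  have hR : R ν = ν' := Submodule.reflection_sub h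
  have h1 := R.measurePreserving.setIntegral_preimage_emb
    R.toHomeomorph.measurableEmbedding (fun x => |inner ℝ x ν'|) (Metric.ball 0 1)
  rw [← h1]
  have h2 : R ⁻¹' Metric.ball 0 1 = Metric.ball 0 1 := by
    ext x; simp
  rw [h2]
  simp only [← hR, R.inner_map_map]

theorem setIntegral_ball_abs_inner_pos {ν : F} (h : ν ≠ 0) :
    0 < ∫ x in Metric.ball (0 : F) 1, |inner ℝ x ν| := by
  have hc : Continuous fun x : F => |inner ℝ x ν| := by fun_prop
  have hi : IntegrableOn (fun x : F => |inner ℝ x ν|) (Metric.ball 0 1) :=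
    (hc.continuousOn.integrableOn_compact (isCompact_closedBall 0 1)).mono_set
      Metric.ball_subset_closedBall
  refine lt_of_le_of_ne (integral_nonneg fun x => abs_nonneg _) fun h0 => ?_
  have h1 := (setIntegral_eq_zero_iff_of_nonneg_ae
    (Filter.Eventually.of_forall fun x => abs_nonneg _) hi).1 h0.symm
  have h2 := Measure.eqOn_open_of_ae_eq h1 Metric.isOpen_ball hc.continuousOn continuousOn_const
  have hν : 0 < ‖ν‖ := norm_pos_iff.2 h
  have h3 : (2 * ‖ν‖)⁻¹ • ν ∈ Metric.ball (0 : F) 1 := by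
    rw [mem_ball_zero_iff, norm_smul, norm_inv, Real.norm_of_nonneg (by positivity)]
    rw [inv_mul_lt_iff₀ (by positivity)]
    linarith
  have h4 := h2 h3
  simp only [Pi.zero_apply, abs_eq_zero, inner_smul_left, real_inner_self_eq_norm_sq] at h4
  have : (0 : ℝ) < (2 * ‖ν‖)⁻¹ * ‖ν‖ ^ 2 := by positivity
  exact this.ne' h4

end Integrals

/-- Averaging `|⟨x, ν⟩|` over the unit ball gives a multiple of `‖ν‖` by rotation invariance. This
average lies in the closed convex cone generated by the functions `|⟨x, ·⟩|`, so on the sphere it is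
a uniform limit of finite sums. Weights are absorbed into the vectors, and density allows these to
be taken from `D`. -/
theorem exists_frame_of_dense {D : Set F} (hD : Dense D) {ε : ℝ} (hε : 0 < ε) :
    ∃ (N : ℕ) (e : Fin N → F), (∀ j, e j ∈ D) ∧ ∀ ν : F,
      (1 - ε) * ‖ν‖ ≤ ∑ j, |inner ℝ (e j) ν| ∧ ∑ j, |inner ℝ (e j) ν| ≤ (1 + ε) * ‖ν‖ := by
  borelize F
  rcases subsingleton_or_nontrivial F with hF | hF
  · refine ⟨0, Fin.elim0, fun j => j.elim0, fun ν => ?_⟩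
    simp [Subsingleton.elim ν 0]
  set T := (AddSubmonoid.closure (absInner '' D)).topologicalClosure with hT
  have hTc : IsClosed (T : Set C(Metric.sphere (0 : F) 1, ℝ)) :=
    AddSubmonoid.isClosed_topologicalClosure _
  have hTf : ∀ x, absInner x ∈ T := by
    intro x
    have h1 : absInner x ∈ closure (absInner '' D) :=
      continuous_absInner.range_subset_closure_image_dense hD ⟨x, rfl⟩
    exact closure_mono AddSubmonoid.subset_closure h1
  -- `D` need not be stable under scaling; only its closure, the whole space, is used.
  have hTs : ∀ a : ℝ, 0 ≤ a → ∀ g ∈ T, a • g ∈ T := by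
    intro a ha g hg
    have h1 : AddSubmonoid.closure (absInner '' D) ≤
        T.comap (DistribSMul.toAddMonoidHom C(Metric.sphere (0 : F) 1, ℝ) a) := by
      rw [AddSubmonoid.closure_le]
      rintro _ ⟨x, -, rfl⟩
      change a • absInner x ∈ T
      rw [smul_absInner ha]; exact hTf _
    have h2 := AddSubmonoid.topologicalClosure_minimal _ h1
      (hTc.preimage (continuous_const_smul a))
    exact h2 hg
  have hTconv : Convex ℝ (T : Set C(Metric.sphere (0 : F) 1, ℝ)) :=
    fun g hg h hh a b ha hb _ => T.add_mem (hTs a ha g hg) (hTs b hb h hh)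
  obtain ⟨ν₀, hν₀⟩ := exists_norm_eq F zero_le_one
  have hB0 : volume (Metric.ball (0 : F) 1) ≠ 0 := (Metric.measure_ball_pos _ _ one_pos).ne'
  have hBt : volume (Metric.ball (0 : F) 1) ≠ ⊤ := measure_ball_lt_top.ne
  have hint : IntegrableOn (absInner : F → C(Metric.sphere (0 : F) 1, ℝ)) (Metric.ball 0 1) :=
    (continuous_absInner.continuousOn.integrableOn_compact (isCompact_closedBall 0 1)).mono_set
      Metric.ball_subset_closedBall
  have hav := hTconv.set_average_mem hTc hB0 hBt
    (Filter.Eventually.of_forall hTf) hint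
  have hone : (1 : C(Metric.sphere (0 : F) 1, ℝ)) ∈ T := by
    set c := ⨍ x in Metric.ball (0 : F) 1, |inner ℝ x ν₀| with hc
    have hcpos : 0 < c := by
      rw [hc, setAverage_eq, smul_eq_mul]
      exact mul_pos (inv_pos.2 (ENNReal.toReal_pos hB0 hBt))
        (setIntegral_ball_abs_inner_pos (norm_ne_zero_iff.1 (by rw [hν₀]; exact one_ne_zero)))
    have h1 : (1 : C(Metric.sphere (0 : F) 1, ℝ)) =
        c⁻¹ • ⨍ x in Metric.ball (0 : F) 1, absInner x := by
      ext ν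
      have h2 : (∫ x in Metric.ball (0 : F) 1, absInner x) ν =
          ∫ x in Metric.ball (0 : F) 1, |inner ℝ x ν₀| := by
        have h3 := (ContinuousMap.evalCLM ℝ ν).integral_comp_comm hint
        rw [setIntegral_ball_abs_inner_eq (ν' := (ν : F)) (by
          rw [hν₀, mem_sphere_zero_iff_norm.1 ν.2])]
        exact h3.symm
      rw [ContinuousMap.smul_apply, setAverage_eq, ContinuousMap.smul_apply, h2, ← setAverage_eq,
        ← hc, smul_eq_mul, inv_mul_cancel₀ hcpos.ne', ContinuousMap.one_apply]
    rw [h1]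
    exact hTs _ (inv_nonneg.2 hcpos.le) _ hav
  obtain ⟨g, hg, hgε⟩ := Metric.mem_closure_iff.1 hone ε hε
  have hsum : ∀ g ∈ AddSubmonoid.closure (absInner '' D),
      ∃ (N : ℕ) (e : Fin N → F), (∀ j, e j ∈ D) ∧
        ∀ ν : Metric.sphere (0 : F) 1, g ν = ∑ j, |inner ℝ (e j) (ν : F)| := by
    intro g hg
    induction hg using AddSubmonoid.closure_induction with
    | mem g hg =>
      obtain ⟨x, hx, rfl⟩ := hg
      exact ⟨1, fun _ => x, fun _ => hx, fun ν => by simp [absInner]⟩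
    | zero => exact ⟨0, Fin.elim0, fun j => j.elim0, fun ν => by simp⟩
    | add g h _ _ hg hh =>
      obtain ⟨N, e, he, h1⟩ := hg
      obtain ⟨M, e', he', h2⟩ := hh
      refine ⟨N + M, Fin.append e e', fun j => ?_, fun ν => ?_⟩
      · refine Fin.addCases (fun i => ?_) (fun i => ?_) j
        · rw [Fin.append_left]; exact he i
        · rw [Fin.append_right]; exact he' i
      · simp [Fin.sum_univ_add, h1, h2]
  obtain ⟨N, e, he, hge⟩ := hsum g hg
  refine ⟨N, e, he, fun ν => ?_⟩
  rcases eq_or_ne ν 0 with rfl | hν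
  · simp
  have hν' : 0 < ‖ν‖ := norm_pos_iff.2 hν
  have hmem : ‖ν‖⁻¹ • ν ∈ Metric.sphere (0 : F) 1 := by
    rw [mem_sphere_zero_iff_norm, norm_smul, norm_inv, norm_norm, inv_mul_cancel₀ hν'.ne']
  have h1 := (ContinuousMap.dist_apply_le_dist (f := 1) (g := g) ⟨_, hmem⟩).trans_lt hgε
  have h2 : g ⟨_, hmem⟩ = ‖ν‖⁻¹ * ∑ j, |inner ℝ (e j) ν| := by
    rw [hge, Finset.mul_sum]
    refine Finset.sum_congr rfl fun j _ => ?_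
    simp [inner_smul_right, abs_mul]
  rw [h2, Real.dist_eq, ContinuousMap.one_apply, abs_lt] at h1
  have h3 : ∑ j, |inner ℝ (e j) ν| = ‖ν‖ * (‖ν‖⁻¹ * ∑ j, |inner ℝ (e j) ν|) := by
    rw [mul_inv_cancel_left₀ hν'.ne']
  rw [h3, mul_comm _ ‖ν‖, mul_comm _ ‖ν‖]
  exact ⟨mul_le_mul_of_nonneg_left (by linarith) hν'.le,
    mul_le_mul_of_nonneg_left (by linarith) hν'.le⟩

/-- The sums `∑ a j • e j` with `|a j| ≤ 1` form a compact convex set with support function `∑ |⟨e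
j, ν⟩|`. The hypothesis compares it with the support function of the ball of radius `c`. -/
theorem exists_coeff_of_frame {N : ℕ} {e : Fin N → F} {c : ℝ}
    (he : ∀ ν : F, c * ‖ν‖ ≤ ∑ j, |inner ℝ (e j) ν|) (hc : 0 ≤ c) {v : F} (hv : ‖v‖ ≤ 1) :
    ∃ a : Fin N → ℝ, (∀ j, |a j| ≤ 1) ∧ ∑ j, a j • e j = c • v := by
  set B : Set (Fin N → ℝ) := Icc (-1) 1 with hB
  have hBabs : ∀ a, a ∈ B ↔ ∀ j, |a j| ≤ 1 := fun a => by
    simp only [hB, mem_Icc, Pi.le_def, abs_le, Pi.neg_apply, Pi.one_apply, forall_and]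
  set A : (Fin N → ℝ) →ₗ[ℝ] F := Fintype.linearCombination ℝ e with hA
  by_contra! hcon
  have hnot : c • v ∉ A '' B := by
    rintro ⟨a, ha, hav⟩
    exact hcon a ((hBabs a).1 ha) (by rw [← hav, hA, Fintype.linearCombination_apply])
  have hAc : IsCompact (A '' B) :=
    isCompact_Icc.image (LinearMap.continuous_of_finiteDimensional A)
  obtain ⟨f, u, hfu, hu⟩ := geometric_hahn_banach_closed_point
    ((convex_Icc _ _).linear_image A) hAc.isClosed hnot
  set ν := (InnerProductSpace.toDual ℝ F).symm f with hν
  have hf : ∀ x, f x = inner ℝ ν x := fun x =>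
    (InnerProductSpace.toDual_symm_apply (x := x) (y := f)).symm
  -- Signs as coefficients maximize the separating functional.
  have h1 := hfu (A fun j => SignType.sign (inner ℝ (e j) ν)) ⟨_, (hBabs _).2 fun j => by
    rcases lt_trichotomy (inner ℝ (e j) ν) 0 with h | h | h <;> simp [h], rfl⟩
  rw [hA, Fintype.linearCombination_apply, map_sum] at h1
  have h2 : ∀ j, f (((SignType.sign (inner ℝ (e j) ν) : SignType) : ℝ) • e j) =
      |inner ℝ (e j) ν| := fun j => by
    rw [map_smul, hf, real_inner_comm, smul_eq_mul, sign_mul_self]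
  rw [Finset.sum_congr rfl fun j _ => h2 j] at h1
  have h3 : f (c • v) ≤ c * ‖ν‖ := by
    rw [map_smul, hf, smul_eq_mul]
    refine mul_le_mul_of_nonneg_left ((real_inner_le_norm _ _).trans ?_) hc
    exact mul_le_of_le_one_right (norm_nonneg _) hv
  linarith [he ν]

/-- Allowing an error `δ` makes each admissible coefficient vector work near its point. The
constraints are convex, so a partition of unity glues these constant choices smoothly. -/
theorem exists_contDiff_coeff_of_frame {N : ℕ} {e : Fin N → F} {c : ℝ}
    (he : ∀ ν : F, c * ‖ν‖ ≤ ∑ j, |inner ℝ (e j) ν|) (hc : 0 ≤ c) {δ : ℝ} (hδ : 0 < δ) :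
    ∃ ψ : F → Fin N → ℝ, ContDiff ℝ 1 ψ ∧ ψ 0 = 0 ∧ ∀ v, ‖v‖ ≤ 1 →
      (∀ j, |ψ v j| ≤ 1) ∧ ‖∑ j, ψ v j • e j - c • v‖ ≤ δ := by
  set t : F → Set (Fin N → ℝ) := fun v =>
    {a | ‖v‖ ≤ 1 → (∀ j, |a j| ≤ 1) ∧ ‖∑ j, a j • e j - c • v‖ ≤ δ} with ht
  have hmid : ∀ {v} {a b : Fin N → ℝ} {s r : ℝ}, 0 ≤ s → 0 ≤ r → s + r = 1 →
      a ∈ t v → b ∈ t v → s • a + r • b ∈ t v := by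
    intro v a b s r hs hr hsr ha hb hv
    obtain ⟨ha1, ha2⟩ := ha hv
    obtain ⟨hb1, hb2⟩ := hb hv
    constructor
    · intro j
      have h := convex_closedBall (0 : ℝ) 1 (x := a j) (y := b j)
        (by simpa using ha1 j) (by simpa using hb1 j) hs hr hsr
      simpa using h
    · have h := convex_closedBall (c • v) δ (x := ∑ j, a j • e j) (y := ∑ j, b j • e j)
        (by simpa [dist_eq_norm] using ha2) (by simpa [dist_eq_norm] using hb2) hs hr hsr
      have h' : ∑ j, (s • a + r • b) j • e j = s • ∑ j, a j • e j + r • ∑ j, b j • e j := by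
        simp [add_smul, Finset.sum_add_distrib, Finset.smul_sum, mul_smul]
      rw [h']
      simpa [dist_eq_norm] using h
  obtain ⟨ψ, hψ⟩ := exists_contMDiffMap_forall_mem_convex_of_local_const 𝓘(ℝ, F) (n := 1)
    (t := t) (fun v a ha b hb s r hs hr hsr => hmid hs hr hsr ha hb) (by
      intro x
      rcases le_or_gt ‖x‖ 1 with hx | hx
      · obtain ⟨a, ha, hax⟩ := exists_coeff_of_frame he hc hx
        refine ⟨a, ?_⟩
        have h1 : Continuous fun y : F => ‖c • x - c • y‖ := by fun_prop
        have h2 : ∀ᶠ y in 𝓝 x, ‖c • x - c • y‖ < δ :=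
          h1.continuousAt.eventually_lt continuousAt_const (by simpa using hδ)
        filter_upwards [h2] with y hy _
        exact ⟨ha, by rw [hax]; exact hy.le⟩
      · refine ⟨0, ?_⟩
        filter_upwards [continuous_norm.continuousAt.eventually_const_lt hx] with y hy hy'
        exact absurd hy' (not_le.2 hy))
  have hψs : ContDiff ℝ 1 ψ := ψ.contMDiff.contDiff
  -- The odd part keeps the estimates and vanishes at `0`, so composing with a test field does not
  -- enlarge its support.
  refine ⟨fun v => (1 / 2 : ℝ) • ψ v + (1 / 2 : ℝ) • (-ψ (-v)), ?_, ?_, fun v hv => ?_⟩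
  · exact (hψs.const_smul _).add ((hψs.comp contDiff_neg).neg.const_smul _)
  · simp
  · refine hmid (by norm_num) (by norm_num) (by norm_num) (hψ v) (fun _ => ?_) hv
    obtain ⟨h1, h2⟩ := hψ (-v) (by rwa [norm_neg])
    refine ⟨fun j => by simpa using h1 j, ?_⟩
    rw [← norm_neg]
    simpa [neg_sub, Finset.sum_neg_distrib, sub_eq_add_neg, add_comm] using h2

end Frames

/-! ### Directional variations and the perimeter -/

section Variation

variable {E : Type*} [NormedAddCommGroup E] [NormedSpace ℝ E] [FiniteDimensional ℝ E]
  {G : Type*} [TopologicalSpace G] [ChartedSpace E G] [Group G] [LieGroup 𝓘(ℝ, E) ∞ G]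
  [T2Space G] [IsTopologicalGroup G] [SecondCountableTopology G] [LocallyCompactSpace G]
  [MeasurableSpace G] [BorelSpace G] {μ : Measure G} [IsFiniteMeasureOnCompacts μ]

theorem exists_isCompact_subset_diff_lt [μ.InnerRegularCompactLTTop] {A K : Set G}
    (hA : NullMeasurableSet A μ) (hK : IsCompact K) (hAK : A ⊆ K) {ε : ℝ} (hε : 0 < ε) :
    ∃ L ⊆ A, IsCompact L ∧ μ.real (A \ L) ≤ ε := by
  obtain ⟨B, hBA, hBm, hB⟩ := hA.exists_measurable_subset_ae_eq
  have hBt : μ B ≠ ⊤ := ((measure_mono (hBA.trans hAK)).trans_lt hK.measure_lt_top).ne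
  obtain ⟨L, hLB, hL, hlt⟩ := hBm.exists_isCompact_sdiff_lt hBt
    (ENNReal.ofReal_pos.2 hε).ne'
  refine ⟨L, hLB.trans hBA, hL, ?_⟩
  have h1 : μ (A \ L) = μ (B \ L) := measure_congr (hB.symm.diff (ae_eq_refl L))
  rw [measureReal_def, h1]
  exact ENNReal.toReal_le_of_le_ofReal hε.le hlt.le

variable (E) in
/-- The sign of a bounded function is approximated in the mean by smooth functions. -/
theorem exists_contMDiff_integral_abs_mul_le [μ.InnerRegularCompactLTTop] {d η : G → ℝ}
    (hd : AEStronglyMeasurable d μ) (hd1 : ∀ x, |d x| ≤ 1) (hη : Continuous η)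
    (hηc : HasCompactSupport η) (hη01 : ∀ x, η x ∈ Icc 0 1) {ε : ℝ} (hε : 0 < ε) :
    ∃ u : G → ℝ, ContMDiff 𝓘(ℝ, E) 𝓘(ℝ, ℝ) 1 u ∧ (∀ x, |u x| ≤ 1) ∧
      ∫ x, |d x| * η x ∂μ ≤ ∫ x, d x * (η x * u x) ∂μ + ε := by
  have hηi : Integrable η μ := hη.integrable_of_hasCompactSupport hηc
  have hηm : NullMeasurableSet (tsupport η) μ := (isClosed_tsupport η).measurableSet.nullMeasurableSet
  set P : Set G := {x | 0 < d x} ∩ tsupport η with hP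
  set N : Set G := {x | d x < 0} ∩ tsupport η with hN
  have hPm : NullMeasurableSet P μ :=
    (nullMeasurableSet_lt aemeasurable_const hd.aemeasurable).inter hηm
  have hNm : NullMeasurableSet N μ :=
    (nullMeasurableSet_lt hd.aemeasurable aemeasurable_const).inter hηm
  obtain ⟨L₁, hL₁P, hL₁, h1⟩ := exists_isCompact_subset_diff_lt hPm hηc inter_subset_right
    (ε := ε / 4) (by positivity)
  obtain ⟨L₂, hL₂N, hL₂, h2⟩ := exists_isCompact_subset_diff_lt hNm hηc inter_subset_right
    (ε := ε / 4) (by positivity)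
  have hdisj : Disjoint L₂ L₁ := by
    rw [Set.disjoint_left]
    intro x hx2 hx1
    have h3 : 0 < d x := (hL₁P hx1).1
    have h4 : d x < 0 := (hL₂N hx2).1
    exact lt_asymm h3 h4
  -- The function `2 w - 1` equals the sign of `d` on the two compact sets. Elsewhere on the support
  -- the error is at most `2`, on a set of measure at most `ε / 2`.
  obtain ⟨w, hw0, hw1, hw⟩ := exists_contMDiffMap_zero_one_of_isClosed 𝓘(ℝ, E) (n := 1)
    hL₂.isClosed hL₁.isClosed hdisj
  have hu1 : ∀ x, |2 * w x - 1| ≤ 1 := fun x => by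
    obtain ⟨h3, h4⟩ := hw x
    rw [abs_le]; constructor <;> linarith
  have hus : ContMDiff 𝓘(ℝ, E) 𝓘(ℝ, ℝ) 1 fun x => 2 * w x - 1 :=
    (contMDiff_const.mul w.contMDiff).sub contMDiff_const
  refine ⟨fun x => 2 * w x - 1, hus, hu1, ?_⟩
  have hQ : NullMeasurableSet ((P \ L₁) ∪ (N \ L₂)) μ :=
    (hPm.diff hL₁.measurableSet.nullMeasurableSet).union
      (hNm.diff hL₂.measurableSet.nullMeasurableSet)
  have hQt : μ ((P \ L₁) ∪ (N \ L₂)) < ⊤ :=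
    (measure_mono (union_subset (sdiff_subset.trans inter_subset_right)
      (sdiff_subset.trans inter_subset_right))).trans_lt hηc.measure_lt_top
  have hpt : ∀ x, |d x| * η x - d x * (η x * (2 * w x - 1)) ≤
      ((P \ L₁) ∪ (N \ L₂)).indicator (fun _ => (2 : ℝ)) x := by
    intro x
    obtain ⟨hη0, hη1⟩ := hη01 x
    by_cases hx : x ∈ (P \ L₁) ∪ (N \ L₂)
    · rw [indicator_of_mem hx]
      have h3 := abs_le.1 (hu1 x)
      have h4 : |d x * (η x * (2 * w x - 1))| ≤ 1 := by
        rw [abs_mul, abs_mul, abs_of_nonneg hη0]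
        exact mul_le_one₀ (hd1 x) (by positivity) (mul_le_one₀ hη1 (abs_nonneg _) (hu1 x))
      have h5 : |d x| * η x ≤ 1 := mul_le_one₀ (hd1 x) hη0 hη1
      linarith [neg_le_abs (d x * (η x * (2 * w x - 1)))]
    · rw [indicator_of_notMem hx]
      by_cases hxη : x ∈ tsupport η
      · rcases lt_trichotomy (d x) 0 with h3 | h3 | h3
        · have h4 : x ∈ L₂ := by
            by_contra h4; exact hx (Or.inr ⟨⟨h3, hxη⟩, h4⟩)
          rw [hw0 h4, abs_of_neg h3]
          simp
        · simp [h3]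
        · have h4 : x ∈ L₁ := by
            by_contra h4; exact hx (Or.inl ⟨⟨h3, hxη⟩, h4⟩)
          rw [hw1 h4, abs_of_pos h3]
          simp only [Pi.one_apply]
          linarith
      · simp [image_eq_zero_of_notMem_tsupport hxη]
  have hi1 : Integrable (fun x => |d x| * η x) μ :=
    hηi.bdd_mul hd.norm (Filter.Eventually.of_forall fun x => by simpa using hd1 x)
  have hi2 : Integrable (fun x => d x * (η x * (2 * w x - 1))) μ := by
    refine Integrable.bdd_mul ?_ hd (Filter.Eventually.of_forall hd1)
    exact (hη.mul hus.continuous).integrable_of_hasCompactSupport hηc.mul_right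
  have h3 : ∫ x, (|d x| * η x - d x * (η x * (2 * w x - 1))) ∂μ ≤
      ∫ x, ((P \ L₁) ∪ (N \ L₂)).indicator (fun _ => (2 : ℝ)) x ∂μ :=
    integral_mono (hi1.sub hi2)
      ((integrableOn_const hQt.ne).integrable_indicator₀ hQ) hpt
  rw [integral_sub hi1 hi2, integral_indicator₀ hQ, setIntegral_const, smul_eq_mul] at h3
  have h4 := measureReal_union_le (μ := μ) (P \ L₁) (N \ L₂)
  linarith

theorem tsupport_average_subset {Y : GroupLieAlgebra 𝓘(ℝ, E) G} {σ : G → ℝ}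
    (hσ : HasCompactSupport σ) {t : ℝ} (ht : 0 ≤ t) (N : ℕ) :
    tsupport (fun x => ∑ k ∈ Finset.range N, (N : ℝ)⁻¹ * σ (x * lieExp ((k * (t / N)) • Y))) ⊆
      flowHull Y (tsupport σ) t := by
  refine closure_minimal (fun x hx => ?_) (isCompact_flowHull Y hσ t).isClosed
  by_contra hxK
  refine hx (Finset.sum_eq_zero fun k hk => ?_)
  have hN : (0 : ℝ) < N := by exact_mod_cast (Nat.zero_le k).trans_lt (Finset.mem_range.1 hk)
  have hkN : (k : ℝ) ≤ N := by exact_mod_cast (Finset.mem_range.1 hk).le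
  rw [image_eq_zero_of_notMem_tsupport (notMem_of_notMem_flowHull hxK (by positivity) ?_), mul_zero]
  calc k * (t / N) ≤ N * (t / N) := by gcongr
    _ = t := by field_simp

theorem contMDiff_comp_mul_lieExp {σ : G → ℝ} (hσ : ContMDiff 𝓘(ℝ, E) 𝓘(ℝ, ℝ) 1 σ) (g : G) :
    ContMDiff 𝓘(ℝ, E) 𝓘(ℝ, ℝ) 1 fun x => σ (x * g) :=
  hσ.comp ((contMDiff_mul_right (I := 𝓘(ℝ, E)) (n := ∞) (a := g)).of_le (by simp))

/-- Difference quotients along a flow are bounded by derivatives of admissible functions. -/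
theorem exists_integral_abs_translateDiff_le [μ.InnerRegularCompactLTTop] {F Ω : Set G}
    (hF : NullMeasurableSet F μ) {Y : GroupLieAlgebra 𝓘(ℝ, E) G} {t : ℝ} (ht : 0 < t)
    (hY : MeasurePreserving (fun x : G => x * lieExp (t • Y)) μ μ) {η : G → ℝ}
    (hη : ContMDiff 𝓘(ℝ, E) 𝓘(ℝ, ℝ) 1 η) (hηc : HasCompactSupport η)
    (hη01 : ∀ x, η x ∈ Icc 0 1) (hΩ : flowHull Y (tsupport η) t ⊆ Ω) {ε : ℝ} (hε : 0 < ε) :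
    ∃ σ : G → ℝ, ContMDiff 𝓘(ℝ, E) 𝓘(ℝ, ℝ) 1 σ ∧ HasCompactSupport σ ∧ tsupport σ ⊆ Ω ∧
      (∀ x, |σ x| ≤ 1) ∧ t⁻¹ * ∫ x, |translateDiff F (lieExp (t • Y)) x| * η x ∂μ ≤
        ∫ x in F, lieDeriv Y σ x ∂μ + ε := by
  obtain ⟨u, hu, hu1, h1⟩ := exists_contMDiff_integral_abs_mul_le E
    (aestronglyMeasurable_translateDiff hF hY) (abs_translateDiff_le_one F _) hη.continuous hηc
    hη01 (ε := ε / 2 * t) (by positivity)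
  set σ₀ : G → ℝ := fun x => η x * u x with hσ₀
  have hσ₀s : ContMDiff 𝓘(ℝ, E) 𝓘(ℝ, ℝ) 1 σ₀ := hη.mul hu
  have hσ₀c : HasCompactSupport σ₀ := hηc.mul_right
  have hσ₀t : tsupport σ₀ ⊆ tsupport η := tsupport_mul_subset_left
  have hσ₀1 : ∀ x, |σ₀ x| ≤ 1 := fun x => by
    rw [hσ₀, abs_mul, abs_of_nonneg (hη01 x).1]
    exact mul_le_one₀ (hη01 x).2 (abs_nonneg _) (hu1 x)
  have hσ₀i : Integrable σ₀ μ := hσ₀s.continuous.integrable_of_hasCompactSupport hσ₀c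
  set K := flowHull Y (tsupport σ₀) t with hK
  have hKc : IsCompact K := isCompact_flowHull Y hσ₀c t
  have hKη : K ⊆ flowHull Y (tsupport η) t :=
    image_mono (prod_mono hσ₀t subset_rfl)
  have hK0 : (0 : ℝ) ≤ μ.real K := measureReal_nonneg
  obtain ⟨N, hN, h2⟩ := exists_abs_slope_sub_average_le Y hσ₀s hσ₀c ht
    (δ := ε / 2 / (μ.real K + 1)) (by positivity)
  have hN' : (0 : ℝ) < N := by exact_mod_cast hN
  -- The derivative of this average is the Riemann sum of `h2`, so it nearly equals the difference
  -- quotient of `σ₀`.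
  set σ : G → ℝ := fun x => ∑ k ∈ Finset.range N, (N : ℝ)⁻¹ * σ₀ (x * lieExp ((k * (t / N)) • Y))
    with hσ
  have hσK : tsupport σ ⊆ K := tsupport_average_subset hσ₀c ht.le N
  have hσc : HasCompactSupport σ := hKc.of_isClosed_subset (isClosed_tsupport _) hσK
  have hσs : ContMDiff 𝓘(ℝ, E) 𝓘(ℝ, ℝ) 1 σ :=
    contMDiff_finsetSum fun k _ => contMDiff_const.mul (contMDiff_comp_mul_lieExp hσ₀s _)
  have hσd : ∀ x, lieDeriv Y σ x =
      (N : ℝ)⁻¹ * ∑ k ∈ Finset.range N, lieDeriv Y σ₀ (x * lieExp ((k * (t / N)) • Y)) := by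
    intro x
    rw [hσ, lieDeriv_linearCombination (Finset.range N) (fun _ => (N : ℝ)⁻¹)
      (fun k => contMDiff_comp_mul_lieExp hσ₀s (lieExp ((k * (t / N)) • Y))), Finset.mul_sum]
    exact Finset.sum_congr rfl fun k _ => by rw [lieDeriv_comp_mul_lieExp Y hσ₀s]
  refine ⟨σ, hσs, hσc, hσK.trans (hKη.trans hΩ), fun x => ?_, ?_⟩
  · calc |σ x| ≤ ∑ k ∈ Finset.range N, |(N : ℝ)⁻¹ * σ₀ (x * lieExp ((k * (t / N)) • Y))| :=
          Finset.abs_sum_le_sum_abs _ _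
      _ ≤ ∑ k ∈ Finset.range N, (N : ℝ)⁻¹ := by
          refine Finset.sum_le_sum fun k _ => ?_
          rw [abs_mul, abs_of_pos (inv_pos.2 hN')]
          exact mul_le_of_le_one_right (inv_pos.2 hN').le (hσ₀1 _)
      _ = 1 := by
          rw [Finset.sum_const, Finset.card_range, nsmul_eq_mul, mul_inv_cancel₀ hN'.ne']
  · have h3 : t⁻¹ * ∫ x in F, (σ₀ (x * lieExp (t • Y)) - σ₀ x) ∂μ - ∫ x in F, lieDeriv Y σ x ∂μ ≤
        ε / 2 := by
      have hi1 : Integrable (fun x => σ₀ (x * lieExp (t • Y)) - σ₀ x) μ :=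
        (integrable_comp_mul_right hY hσ₀i).sub hσ₀i
      have hi2 : Integrable (lieDeriv Y σ) μ := integrable_lieDeriv Y hσs hσc
      rw [← integral_const_mul, ← integral_sub (hi1.const_mul _).integrableOn hi2.integrableOn]
      have hpt : ∀ x, t⁻¹ * (σ₀ (x * lieExp (t • Y)) - σ₀ x) - lieDeriv Y σ x ≤
          K.indicator (fun _ => ε / 2 / (μ.real K + 1)) x := by
        intro x
        by_cases hx : x ∈ K
        · rw [indicator_of_mem hx, hσd]
          exact (le_abs_self _).trans (h2 x)
        · rw [indicator_of_notMem hx, sub_eq_zero_of_notMem_flowHull hx ht.le le_rfl,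
            lieDeriv_eq_zero_of_notMem_tsupport fun h => hx (hσK h)]
          simp
      have hKi : Integrable (K.indicator fun _ => ε / 2 / (μ.real K + 1)) μ :=
        (integrable_indicator_iff hKc.measurableSet).2 (integrableOn_const hKc.measure_lt_top.ne)
      calc _ ≤ ∫ x in F, K.indicator (fun _ => ε / 2 / (μ.real K + 1)) x ∂μ :=
            integral_mono ((hi1.const_mul _).sub hi2).integrableOn hKi.integrableOn hpt
        _ ≤ ∫ x, K.indicator (fun _ => ε / 2 / (μ.real K + 1)) x ∂μ :=
            setIntegral_le_integral hKi (Filter.Eventually.of_forall fun x =>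
              indicator_nonneg (fun _ _ => by positivity) x)
        _ = μ.real K * (ε / 2 / (μ.real K + 1)) := by
            rw [integral_indicator hKc.measurableSet, setIntegral_const, smul_eq_mul]
        _ ≤ ε / 2 := by
            rw [mul_div_assoc', div_le_iff₀ (by positivity)]
            nlinarith
    rw [integral_translateDiff_mul hF hY hσ₀i] at h1
    have h4 : t⁻¹ * ∫ x, |translateDiff F (lieExp (t • Y)) x| * η x ∂μ ≤
        t⁻¹ * (∫ x in F, (σ₀ (x * lieExp (t • Y)) - σ₀ x) ∂μ + ε / 2 * t) := by
      gcongr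
    have h5 : t⁻¹ * (ε / 2 * t) = ε / 2 := by field_simp
    rw [mul_add, h5] at h4
    linarith

section Divergence

variable {r N : ℕ} (X : Fin r → GroupLieAlgebra 𝓘(ℝ, E) G) (e : Fin N → EuclideanSpace ℝ (Fin r))

/-- The left-invariant field `∑ᵢ vᵢ Xᵢ`. -/
def combination (v : EuclideanSpace ℝ (Fin r)) : GroupLieAlgebra 𝓘(ℝ, E) G :=
  ∑ i, v i • X i

theorem sum_lieDeriv_linearCombination {σ : Fin N → G → ℝ}
    (hσ : ∀ j, ContMDiff 𝓘(ℝ, E) 𝓘(ℝ, ℝ) 1 (σ j)) (x : G) :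
    ∑ i, lieDeriv (X i) (fun y => ∑ j, e j i * σ j y) x =
      ∑ j, lieDeriv (combination X (e j)) (σ j) x := by
  simp only [lieDeriv_linearCombination _ _ hσ, combination, lieDeriv_sum_left]
  exact Finset.sum_comm

theorem contMDiff_apply {φ : G → EuclideanSpace ℝ (Fin r)}
    (hφ : ContMDiff 𝓘(ℝ, E) 𝓘(ℝ, EuclideanSpace ℝ (Fin r)) 1 φ) (i : Fin r) :
    ContMDiff 𝓘(ℝ, E) 𝓘(ℝ, ℝ) 1 fun x => φ x i :=
  (EuclideanSpace.proj (𝕜 := ℝ) i).contMDiff.comp hφ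

theorem tsupport_apply_subset (φ : G → EuclideanSpace ℝ (Fin r)) (i : Fin r) :
    tsupport (fun x => φ x i) ⊆ tsupport φ :=
  tsupport_comp_subset (g := fun v : EuclideanSpace ℝ (Fin r) => v i) rfl φ

/-- The field `w = ∑ σ j • e j` satisfies `‖w‖² = ∑ σ j ⟨e j, w⟩ ≤ c ‖w‖`, so `c⁻¹ • w` competes in
the perimeter. -/
theorem sum_integral_lieDeriv_le_of_perimeter_le {F Ω : Set G} {c P : ℝ} (hc : 0 < c) (hP0 : 0 ≤ P)
    (he : ∀ ν, ∑ j, |inner ℝ (e j) ν| ≤ c * ‖ν‖)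
    (hP : perimeter μ X F Ω ≤ ENNReal.ofReal P) {σ : Fin N → G → ℝ}
    (hσ : ∀ j, ContMDiff 𝓘(ℝ, E) 𝓘(ℝ, ℝ) 1 (σ j)) (hσc : ∀ j, HasCompactSupport (σ j))
    (hσΩ : ∀ j, tsupport (σ j) ⊆ Ω) (hσ1 : ∀ j x, |σ j x| ≤ 1) :
    ∑ j, ∫ x in F, lieDeriv (combination X (e j)) (σ j) x ∂μ ≤ c * P := by
  set φ : G → EuclideanSpace ℝ (Fin r) := fun x => c⁻¹ • ∑ j, σ j x • e j with hφ
  have hφs : ContMDiff 𝓘(ℝ, E) 𝓘(ℝ, EuclideanSpace ℝ (Fin r)) 1 φ := by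
    have hcst : ContMDiff 𝓘(ℝ, E) 𝓘(ℝ, ℝ) 1 fun _ : G => c⁻¹ := contMDiff_const
    have hej : ∀ j, ContMDiff 𝓘(ℝ, E) 𝓘(ℝ, EuclideanSpace ℝ (Fin r)) 1 fun _ : G => e j :=
      fun j => contMDiff_const
    exact hcst.smul (contMDiff_finsetSum fun j _ => (hσ j).smul (hej j))
  have hφt : tsupport φ ⊆ ⋃ j, tsupport (σ j) := by
    refine closure_minimal (fun x hx => ?_) (isClosed_iUnion_of_finite fun j => isClosed_tsupport _)
    by_contra hxn
    simp only [mem_iUnion, not_exists] at hxn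
    refine hx ?_
    simp only [hφ, image_eq_zero_of_notMem_tsupport (hxn _), zero_smul, Finset.sum_const_zero,
      smul_zero]
  have hφc : HasCompactSupport φ :=
    (isCompact_iUnion hσc).of_isClosed_subset (isClosed_tsupport _) hφt
  have hφ1 : ∀ x, ‖φ x‖ ≤ 1 := by
    intro x
    set w := ∑ j, σ j x • e j with hw
    have h1 : ‖w‖ * ‖w‖ ≤ c * ‖w‖ := by
      calc ‖w‖ * ‖w‖ = inner ℝ w w := (real_inner_self_eq_norm_mul_norm w).symm
        _ = ∑ j, σ j x * inner ℝ (e j) w := by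
            conv_lhs => rw [hw, sum_inner]
            simp only [inner_smul_left, RCLike.conj_to_real, ← hw]
        _ ≤ ∑ j, |inner ℝ (e j) w| := by
            refine Finset.sum_le_sum fun j _ => (le_abs_self _).trans ?_
            rw [abs_mul]
            exact mul_le_of_le_one_left (abs_nonneg _) (hσ1 j x)
        _ ≤ c * ‖w‖ := he w
    have h2 : ‖w‖ ≤ c := by
      rcases eq_or_ne w 0 with h | h
      · rw [h, norm_zero]; exact hc.le
      · exact le_of_mul_le_mul_right h1 (norm_pos_iff.2 h)
    change ‖c⁻¹ • w‖ ≤ 1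
    rw [norm_smul, norm_inv, Real.norm_of_nonneg hc.le, inv_mul_le_iff₀ hc, mul_one]
    exact h2
  have h1 : ENNReal.ofReal (∫ x in F, ∑ i, lieDeriv (X i) (fun y => φ y i) x ∂μ) ≤
      ENNReal.ofReal P :=
    (le_iSup (fun φ : {φ : G → EuclideanSpace ℝ (Fin r) //
      ContMDiff 𝓘(ℝ, E) 𝓘(ℝ, EuclideanSpace ℝ (Fin r)) 1 φ ∧ HasCompactSupport φ ∧
        tsupport φ ⊆ Ω ∧ ∀ x, ‖φ x‖ ≤ 1} =>
      ENNReal.ofReal (∫ x in F, ∑ i, lieDeriv (X i) (fun y => φ.1 y i) x ∂μ))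
      ⟨φ, hφs, hφc, hφt.trans (iUnion_subset hσΩ), hφ1⟩).trans hP
  rw [ENNReal.ofReal_le_ofReal_iff hP0] at h1
  have h2 : ∀ x, ∑ i, lieDeriv (X i) (fun y => φ y i) x =
      c⁻¹ * ∑ j, lieDeriv (combination X (e j)) (σ j) x := by
    intro x
    have h3 : ∀ i, (fun y => φ y i) = fun y => ∑ j, (c⁻¹ • e j) i * σ j y := by
      intro i
      ext y
      simp only [hφ, PiLp.smul_apply, WithLp.ofLp_sum, Finset.sum_apply, smul_eq_mul,
        Finset.mul_sum, WithLp.ofLp_smul, Pi.smul_apply]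
      exact Finset.sum_congr rfl fun j _ => by ring
    simp only [h3]
    rw [sum_lieDeriv_linearCombination X (fun j => c⁻¹ • e j) hσ, Finset.mul_sum]
    refine Finset.sum_congr rfl fun j _ => ?_
    have h4 : combination X (c⁻¹ • e j) = c⁻¹ • combination X (e j) := by
      simp only [combination, Finset.smul_sum, smul_smul, PiLp.smul_apply, smul_eq_mul]
    rw [h4, lieDeriv_smul_left]
  simp only [h2] at h1
  rw [integral_const_mul, inv_mul_le_iff₀ hc, integral_finsetSum] at h1
  · exact h1
  · exact fun j _ => (integrable_lieDeriv _ (hσ j) (hσc j)).integrableOn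

theorem eventually_sum_integral_abs_translateDiff_le [μ.InnerRegularCompactLTTop] {F Ω : Set G}
    (hF : NullMeasurableSet F μ) (hΩ : IsOpen Ω) {c P : ℝ} (hc : 0 < c) (hP0 : 0 ≤ P)
    (he : ∀ ν, ∑ j, |inner ℝ (e j) ν| ≤ c * ‖ν‖)
    (hinv : ∀ j (t : ℝ), MeasurePreserving (fun x : G => x * lieExp (t • combination X (e j))) μ μ)
    (hP : perimeter μ X F Ω ≤ ENNReal.ofReal P) {η : G → ℝ}
    (hη : ContMDiff 𝓘(ℝ, E) 𝓘(ℝ, ℝ) 1 η) (hηc : HasCompactSupport η)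
    (hη01 : ∀ x, η x ∈ Icc 0 1) (hηΩ : tsupport η ⊆ Ω) :
    ∀ᶠ t : ℝ in 𝓝[>] 0, ∑ j, t⁻¹ *
      ∫ x, |translateDiff F (lieExp (t • combination X (e j))) x| * η x ∂μ ≤ c * P := by
  have h1 : ∀ᶠ t : ℝ in 𝓝[>] 0, ∀ j, flowHull (combination X (e j)) (tsupport η) t ⊆ Ω :=
    Filter.eventually_all.2 fun j =>
      (eventually_flowHull_subset _ hηc hΩ hηΩ).filter_mono nhdsWithin_le_nhds
  filter_upwards [h1, self_mem_nhdsWithin] with t ht ht0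
  refine le_of_forall_pos_le_add fun ε hε => ?_
  have hN : (0 : ℝ) < N + 1 := by positivity
  choose σ hσ hσc hσΩ hσ1 h2 using fun j => exists_integral_abs_translateDiff_le hF ht0
    (hinv j t) hη hηc hη01 (ht j) (ε := ε / (N + 1)) (by positivity)
  calc _ ≤ ∑ j, (∫ x in F, lieDeriv (combination X (e j)) (σ j) x ∂μ + ε / (N + 1)) :=
        Finset.sum_le_sum fun j _ => h2 j
    _ = ∑ j, ∫ x in F, lieDeriv (combination X (e j)) (σ j) x ∂μ + N * (ε / (N + 1)) := by
        rw [Finset.sum_add_distrib, Finset.sum_const, Finset.card_univ, Fintype.card_fin,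
          nsmul_eq_mul]
    _ ≤ c * P + ε := by
        refine add_le_add
          (sum_integral_lieDeriv_le_of_perimeter_le X e hc hP0 he hP hσ hσc hσΩ hσ1) ?_
        rw [mul_div_assoc', div_le_iff₀ hN]
        nlinarith

end Divergence

end Variation

/-! ### Comparison with a competitor -/

section Minimality

variable {E : Type*} [NormedAddCommGroup E] [NormedSpace ℝ E] [FiniteDimensional ℝ E]
  {G : Type*} [TopologicalSpace G] [ChartedSpace E G] [Group G] [LieGroup 𝓘(ℝ, E) ∞ G]
  [T2Space G] [IsTopologicalGroup G] [SecondCountableTopology G] [LocallyCompactSpace G]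
  [MeasurableSpace G] [BorelSpace G] {μ : Measure G} [IsFiniteMeasureOnCompacts μ] [SFinite μ]
  [μ.InnerRegularCompactLTTop] {r : ℕ} {X : Fin r → GroupLieAlgebra 𝓘(ℝ, E) G} {S F Ω : Set G}

/-- At small `t > 0`, each quotient of `p j` over `S` is at most the `η`-weighted variation of `S`,
hence of `F` by calibration. The frame bounds the sum over `j` by the perimeter of `F`; then `t →
0`. -/
theorem sum_integral_lieDeriv_le_of_isMonotoneDirection {N : ℕ}
    (e : Fin N → EuclideanSpace ℝ (Fin r)) (hS : NullMeasurableSet S μ) (hF : NullMeasurableSet F μ)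
    (hΩ : IsOpen Ω) {c P : ℝ} (hc : 0 < c) (hP0 : 0 ≤ P)
    (he : ∀ ν, ∑ j, |inner ℝ (e j) ν| ≤ c * ‖ν‖)
    (hinv : ∀ j (t : ℝ), MeasurePreserving (fun x : G => x * lieExp (t • combination X (e j))) μ μ)
    (hmon : ∀ j, IsMonotoneDirection μ (combination X (e j)) S)
    (hP : perimeter μ X F Ω ≤ ENNReal.ofReal P) {K : Set G} (hK : IsCompact K) (hKΩ : K ⊆ Ω)
    (hSF : symmDiff S F ⊆ K) {p : Fin N → G → ℝ}
    (hp : ∀ j, ContMDiff 𝓘(ℝ, E) 𝓘(ℝ, ℝ) 1 (p j)) (hpK : ∀ j, tsupport (p j) ⊆ K)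
    (hp1 : ∀ j x, |p j x| ≤ 1) :
    ∑ j, ∫ x in S, lieDeriv (combination X (e j)) (p j) x ∂μ ≤ c * P := by
  obtain ⟨η, hη, hηc, hηΩ, hη1, hη01⟩ := exists_contMDiff_cutoff E hK hΩ hKΩ
  have hηi : Integrable η μ := hη.continuous.integrable_of_hasCompactSupport hηc
  have hpc : ∀ j, HasCompactSupport (p j) := fun j =>
    hK.of_isClosed_subset (isClosed_tsupport _) (hpK j)
  have hpi : ∀ j, Integrable (p j) μ := fun j =>
    (hp j).continuous.integrable_of_hasCompactSupport (hpc j)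
  -- The cutoff is `1` on a neighbourhood of `K`, not just on `K`, so short translations of points
  -- of `S ∆ F` leave it unchanged.
  obtain ⟨W, hW, hKW, hWη⟩ := mem_nhdsSet_iff_exists.1 hη1
  have h1 : ∀ᶠ t : ℝ in 𝓝[>] 0, ∀ j, ∀ x ∈ K, x * lieExp (t • combination X (e j)) ∈ W :=
    Filter.eventually_all.2 fun j =>
      (eventually_mul_lieExp_mem _ hK hW hKW).filter_mono nhdsWithin_le_nhds
  have h2 := eventually_sum_integral_abs_translateDiff_le X e hF hΩ hc hP0 he hinv hP hη hηc hη01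
    hηΩ
  have h3 := tendsto_finsetSum Finset.univ fun (j : Fin N) _ =>
    tendsto_integral_sub_div (μ := μ) (combination X (e j)) (hp j) (hpc j) S
  refine le_of_tendsto h3 ?_
  filter_upwards [h1, h2, self_mem_nhdsWithin] with t ht1 ht2 ht0
  have ht0' : (0 : ℝ) < t := ht0
  refine le_trans (Finset.sum_le_sum fun j _ => ?_) ht2
  refine mul_le_mul_of_nonneg_left ?_ (inv_pos.2 ht0').le
  have h4 : ∫ x, |translateDiff S (lieExp (t • combination X (e j))) x| * η x ∂μ ≤
      ∫ x, |translateDiff F (lieExp (t • combination X (e j))) x| * η x ∂μ := by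
    refine ((hmon j).isMonotoneAlong hS (hinv j) ht0'.le).integral_abs_translateDiff_le hS hF
      (hinv j t) hηi (fun x => (hη01 x).1) fun x hx => ?_
    have h5 : η (x * lieExp (t • combination X (e j))) = 1 := hWη (ht1 j x (hSF hx))
    have h6 : η x = 1 := hWη (hKW (hSF hx))
    rw [h5, h6]
  refine le_trans ?_ h4
  rw [← integral_translateDiff_mul hS (hinv j t) (hpi j)]
  refine integral_mono (integrable_translateDiff_mul hS (hinv j t) (hpi j))
    (integrable_abs_translateDiff_mul hS (hinv j t) hηi) fun x => ?_
  have h7 : |p j x| ≤ η x := by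
    by_cases hx : x ∈ K
    · rw [show η x = 1 from hWη (hKW hx)]
      exact hp1 j x
    · rw [image_eq_zero_of_notMem_tsupport fun h => hx (hpK j h), abs_zero]
      exact (hη01 x).1
  calc translateDiff S (lieExp (t • combination X (e j))) x * p j x
      ≤ |translateDiff S (lieExp (t • combination X (e j))) x * p j x| := le_abs_self _
    _ ≤ _ := by
      rw [abs_mul]
      exact mul_le_mul_of_nonneg_left h7 (abs_nonneg _)

/-- Replace `(1 - ε) φ` by its frame expansion. The expansion is handled direction by direction, and
the remainder `ρ` is of size `ε`, so the Radon derivatives make its contribution `O(ε)`. The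
constants `C i` depend on the support of `φ` but not on the frame. -/
theorem integral_sum_lieDeriv_le_of_isMonotoneDirection (hS : NullMeasurableSet S μ)
    (hF : NullMeasurableSet F μ) (hΩ : IsOpen Ω)
    (hinv : ∀ v (t : ℝ), MeasurePreserving (fun x : G => x * lieExp (t • combination X v)) μ μ)
    (hmon : Dense {v | IsMonotoneDirection μ (combination X v) S})
    (hrad : ∀ i, HasRadonDerivative μ (X i) S) {P : ℝ} (hP0 : 0 ≤ P)
    (hP : perimeter μ X F Ω ≤ ENNReal.ofReal P) (hSF : IsRelativelyCompactIn (symmDiff S F) Ω)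
    {φ : G → EuclideanSpace ℝ (Fin r)}
    (hφ : ContMDiff 𝓘(ℝ, E) 𝓘(ℝ, EuclideanSpace ℝ (Fin r)) 1 φ) (hφc : HasCompactSupport φ)
    (hφΩ : tsupport φ ⊆ Ω) (hφ1 : ∀ x, ‖φ x‖ ≤ 1) :
    ∫ x in S, ∑ i, lieDeriv (X i) (fun y => φ y i) x ∂μ ≤ P := by
  choose C hC0 hC using fun i => (hrad i).exists_abs_integral_le hφc
  have hφi : ∀ i, ContMDiff 𝓘(ℝ, E) 𝓘(ℝ, ℝ) 1 fun x => φ x i := contMDiff_apply hφ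
  have hφic : ∀ i, HasCompactSupport fun x => φ x i := fun i =>
    hφc.of_isClosed_subset (isClosed_tsupport _) (tsupport_apply_subset φ i)
  set A := ∫ x in S, ∑ i, lieDeriv (X i) (fun y => φ y i) x ∂μ with hA
  have hAsum : A = ∑ i, ∫ x in S, lieDeriv (X i) (fun y => φ y i) x ∂μ :=
    integral_finsetSum _ fun i _ => (integrable_lieDeriv _ (hφi i) (hφic i)).integrableOn
  have key : ∀ ε ∈ Ioo (0 : ℝ) 1, (1 - ε) * A ≤ (1 + ε) * P + (∑ i, C i) * ε := by
    intro ε hε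
    obtain ⟨N, e, heD, he⟩ := exists_frame_of_dense hmon hε.1
    obtain ⟨ψ, hψ, hψ0, hψ1⟩ := exists_contDiff_coeff_of_frame (e := e) (c := 1 - ε)
      (fun ν => (he ν).1) (by linarith [hε.2]) hε.1
    have hψφ : ∀ j, ContMDiff 𝓘(ℝ, E) 𝓘(ℝ, ℝ) 1 fun x => ψ (φ x) j := fun j =>
      (contDiff_pi.1 hψ j).contMDiff.comp hφ
    have hψt : ∀ j, tsupport (fun x => ψ (φ x) j) ⊆ tsupport φ := fun j =>
      tsupport_comp_subset (g := fun v => ψ v j) (by rw [hψ0]; rfl) φ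
    have hψc : ∀ j, HasCompactSupport fun x => ψ (φ x) j := fun j =>
      hφc.of_isClosed_subset (isClosed_tsupport _) (hψt j)
    have h1 := sum_integral_lieDeriv_le_of_isMonotoneDirection (p := fun j x => ψ (φ x) j) e hS hF
      hΩ (by linarith [hε.1]) hP0 (fun ν => (he ν).2) (fun j => hinv (e j)) heD hP
      (hSF.1.union hφc) (union_subset hSF.2 hφΩ) (subset_closure.trans subset_union_left) hψφ
      (fun j => (hψt j).trans subset_union_right) fun j x => (hψ1 _ (hφ1 x)).1 j
    set ρ : Fin r → G → ℝ := fun i x => ∑ j, e j i * ψ (φ x) j - (1 - ε) * φ x i with hρ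
    have hsum : ∀ i, ContMDiff 𝓘(ℝ, E) 𝓘(ℝ, ℝ) 1 fun x => ∑ j, e j i * ψ (φ x) j := fun i =>
      contMDiff_finsetSum fun j _ => contMDiff_const.mul (hψφ j)
    have hρs : ∀ i, ContMDiff 𝓘(ℝ, E) 𝓘(ℝ, ℝ) 1 (ρ i) := fun i =>
      (hsum i).sub (contMDiff_const.mul (hφi i))
    have hρt : ∀ i, tsupport (ρ i) ⊆ tsupport φ := fun i =>
      tsupport_comp_subset (g := fun v : EuclideanSpace ℝ (Fin r) =>
        ∑ j, e j i * ψ v j - (1 - ε) * v i) (by simp [hψ0]) φ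
    have hρc : ∀ i, HasCompactSupport (ρ i) := fun i =>
      hφc.of_isClosed_subset (isClosed_tsupport _) (hρt i)
    have hρε : ∀ i x, |ρ i x| ≤ ε := by
      intro i x
      refine le_trans ?_ (hψ1 _ (hφ1 x)).2
      have h2 : ρ i x = (∑ j, ψ (φ x) j • e j - (1 - ε) • φ x) i := by
        simp [hρ, mul_comm]
      rw [h2, ← Real.norm_eq_abs]
      exact PiLp.norm_apply_le _ i
    have h2 : ∀ x, ∑ j, lieDeriv (combination X (e j)) (fun x => ψ (φ x) j) x =
        (1 - ε) * ∑ i, lieDeriv (X i) (fun y => φ y i) x + ∑ i, lieDeriv (X i) (ρ i) x := by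
      intro x
      rw [← sum_lieDeriv_linearCombination X e hψφ, Finset.mul_sum, ← Finset.sum_add_distrib]
      refine Finset.sum_congr rfl fun i _ => ?_
      -- The expansion is `(1 - ε) φ + ρ` by the definition of `ρ`, a two-term combination.
      have h3 := lieDeriv_linearCombination (Finset.univ : Finset (Fin 2)) ![1 - ε, 1]
        (φ := ![fun y => φ y i, ρ i]) (fun k => by
          fin_cases k
          · exact hφi i
          · exact hρs i) (X i) x
      simp only [Fin.sum_univ_two, Matrix.cons_val_zero, Matrix.cons_val_one, one_mul] at h3
      rw [← h3]
      congr 1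
      ext y
      simp [hρ]
    have h3 : ∑ j, ∫ x in S, lieDeriv (combination X (e j)) (fun x => ψ (φ x) j) x ∂μ =
        (1 - ε) * A + ∑ i, ∫ x in S, lieDeriv (X i) (ρ i) x ∂μ := by
      rw [← integral_finsetSum _ fun j _ =>
        (integrable_lieDeriv _ (hψφ j) (hψc j)).integrableOn]
      simp only [h2]
      rw [integral_add, integral_const_mul, integral_finsetSum (f := fun i => lieDeriv (X i) (ρ i))
        _ fun i _ => (integrable_lieDeriv _ (hρs i) (hρc i)).integrableOn]
      · exact ((integrable_finsetSum _ fun i _ =>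
          integrable_lieDeriv _ (hφi i) (hφic i)).const_mul _).integrableOn
      · exact (integrable_finsetSum _ fun i _ =>
          integrable_lieDeriv _ (hρs i) (hρc i)).integrableOn
    have h4 : -∑ i, ∫ x in S, lieDeriv (X i) (ρ i) x ∂μ ≤ (∑ i, C i) * ε := by
      rw [← Finset.sum_neg_distrib, Finset.sum_mul]
      exact Finset.sum_le_sum fun i _ =>
        (neg_le_abs _).trans (hC i (ρ i) ε (hρs i) (hρt i) (hρε i))
    rw [h3] at h1
    linarith
  have hl : Filter.Tendsto (fun ε : ℝ => (1 - ε) * A) (𝓝[>] 0) (𝓝 A) := by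
    have : Continuous fun ε : ℝ => (1 - ε) * A := by fun_prop
    simpa using (this.tendsto 0).mono_left nhdsWithin_le_nhds
  have hr : Filter.Tendsto (fun ε : ℝ => (1 + ε) * P + (∑ i, C i) * ε) (𝓝[>] 0) (𝓝 P) := by
    have : Continuous fun ε : ℝ => (1 + ε) * P + (∑ i, C i) * ε := by fun_prop
    simpa using (this.tendsto 0).mono_left nhdsWithin_le_nhds
  exact le_of_tendsto_of_tendsto hl hr
    (Filter.eventually_of_mem (Ioo_mem_nhdsGT zero_lt_one) key)

theorem perimeter_le_of_isMonotoneDirection (hS : NullMeasurableSet S μ)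
    (hF : NullMeasurableSet F μ) (hΩ : IsOpen Ω)
    (hinv : ∀ v (t : ℝ), MeasurePreserving (fun x : G => x * lieExp (t • combination X v)) μ μ)
    (hmon : Dense {v | IsMonotoneDirection μ (combination X v) S})
    (hrad : ∀ i, HasRadonDerivative μ (X i) S) (hSF : IsRelativelyCompactIn (symmDiff S F) Ω) :
    perimeter μ X S Ω ≤ perimeter μ X F Ω := by
  rcases eq_or_ne (perimeter μ X F Ω) ⊤ with h | h
  · rw [h]; exact le_top
  · refine iSup_le fun ⟨φ, hφ, hφc, hφΩ, hφ1⟩ => ENNReal.ofReal_le_of_le_toReal ?_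
    exact integral_sum_lieDeriv_le_of_isMonotoneDirection hS hF hΩ hinv hmon hrad
      ENNReal.toReal_nonneg (ENNReal.ofReal_toReal h).ge hSF hφ hφc hφΩ hφ1

end Minimality

end Carnot

end

/-! ### The theorem -/

theorem theorem1p2 {n : ℕ}
    {G : Type*} [TopologicalSpace G] [T2Space G] [SecondCountableTopology G]
    [SimplyConnectedSpace G] [ChartedSpace (EuclideanSpace ℝ (Fin n)) G] [Group G]
    [LieGroup 𝓘(ℝ, EuclideanSpace ℝ (Fin n)) ∞ G]
    [MeasurableSpace G] [BorelSpace G] (μ : Measure G) [μ.IsHaarMeasure]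
    (𝔰 : Carnot.Stratification (GroupLieAlgebra 𝓘(ℝ, EuclideanSpace ℝ (Fin n)) G))
    (B : LinearMap.BilinForm ℝ (𝔰.layer 1)) (hB : Carnot.IsScalarProduct B)
    {r : ℕ} (X : Module.Basis (Fin r) ℝ (𝔰.layer 1)) (hX : Carnot.IsOrthonormalBasis B X)
    (S : Set G) (hS : Carnot.IsMonotoneSet μ (𝔰.layer 1) S) :
    Carnot.IsLocalMinimizer μ (𝔰.layer 1) X S := by
  have : IsTopologicalGroup G := topologicalGroup_of_lieGroup 𝓘(ℝ, EuclideanSpace ℝ (Fin n)) ∞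
  have : LocallyCompactSpace G :=
    Manifold.locallyCompact_of_finiteDimensional 𝓘(ℝ, EuclideanSpace ℝ (Fin n))
  have := TopologicalSpace.metrizableSpace_of_t3_secondCountable G
  have hinv : ∀ Y ∈ 𝔰.layer 1, ∀ t : ℝ,
      MeasurePreserving (fun x : G => x * Carnot.lieExp (t • Y)) μ μ := fun Y hY t =>
    ⟨measurable_mul_const _, Carnot.map_mul_lieExp_eq μ
      (𝔰.ad_pow_step_eq_zero ((𝔰.layer 1).smul_mem t hY))⟩
  have hdense := Measure.dense_of_ae hS.ae_isMonotoneDirection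
  have hrad : ∀ Y ∈ 𝔰.layer 1, Carnot.HasRadonDerivative μ Y S := by
    intro Y hY
    have h := Carnot.hasRadonDerivative_of_dense (μ := μ) (S := S)
      (fun i => (Module.finBasis ℝ (𝔰.layer 1) i : GroupLieAlgebra 𝓘(ℝ, EuclideanSpace ℝ (Fin n)) G)) hdense
      (fun c hc => by
        have h1 := Carnot.IsMonotoneDirection.hasRadonDerivative hS.1 hc
          (hinv _ (Submodule.coe_mem _))
        simpa using h1) ((Module.finBasis ℝ (𝔰.layer 1)).equivFun ⟨Y, hY⟩)
    have h2 := congrArg Subtype.val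
      ((Module.finBasis ℝ (𝔰.layer 1)).sum_equivFun ⟨Y, hY⟩)
    simp only [Submodule.coe_sum, Submodule.coe_smul] at h2
    rwa [h2] at h
  refine ⟨⟨hS.1, fun Y hY => (hrad Y hY).isRadonDerivative⟩, fun Ω hΩ _ F hF hSF => ?_⟩
  have hcomb : ∀ v : EuclideanSpace ℝ (Fin r),
      Carnot.combination (fun i => (X i : GroupLieAlgebra 𝓘(ℝ, EuclideanSpace ℝ (Fin n)) G)) v =
        ((∑ i, v i • X i : 𝔰.layer 1) : GroupLieAlgebra 𝓘(ℝ, EuclideanSpace ℝ (Fin n)) G) := fun v => by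
    simp [Carnot.combination]
  refine Carnot.perimeter_le_of_isMonotoneDirection hS.1 hF hΩ
    (fun v => hinv _ (by rw [hcomb]; exact Submodule.coe_mem _)) ?_
    (fun i => hrad _ (Submodule.coe_mem _)) hSF
  -- Null sets of lines are measured in the coordinates of `Module.finBasis`, the frame in those of
  -- `X`. A linear change of coordinates preserves density.
  let L : EuclideanSpace ℝ (Fin r) ≃L[ℝ] (Fin (Module.finrank ℝ (𝔰.layer 1)) → ℝ) :=
    ((EuclideanSpace.equiv (Fin r) ℝ).toLinearEquiv.trans (X.equivFun.symm.trans
      (Module.finBasis ℝ (𝔰.layer 1)).equivFun)).toContinuousLinearEquiv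
  refine (hdense.preimage L.toHomeomorph.isOpenMap).mono fun v hv => ?_
  have h1 : ∑ i, L v i • Module.finBasis ℝ (𝔰.layer 1) i = ∑ i, v i • X i := by
    have h2 := (Module.finBasis ℝ (𝔰.layer 1)).sum_equivFun (∑ i, v i • X i)
    rw [← h2]
    simp [L, X.equivFun_symm_apply]
  have hv' : Carnot.IsMonotoneDirection μ
    ((∑ i, L v i • Module.finBasis ℝ (𝔰.layer 1) i : 𝔰.layer 1) :
      GroupLieAlgebra 𝓘(ℝ, EuclideanSpace ℝ (Fin n)) G) S := hv
  rw [h1, ← hcomb] at hv'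
  exact hv'
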